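/- **Notation.** Let $\mathbb O=\mathbb H\oplus\mathbb H l$ be the octonion division algebra, with $(a,b)(c,d)=(ac-\bar d b,\;da+b\bar c)$, standard involution $x\mapsto\bar x$, norm $n$, polar form $q(x,y)=n(x+y)-n(x)-n(y)$ and basis $(e_0,\dots,e_7)=(1,i,j,k,l,il,jl,kl)$. The para-octonion algebra $p\mathbb O$ is $\mathbb O$ with the product $x*y=\bar x\bar y$. Let $\mathbb A=\mathbb A_{(1,1,1)}(p\mathbb O)=\mathbb R^3\oplus\iota_0(p\mathbb O)\oplus\iota_1(p\mathbb O)\oplus\iota_2(p\mathbb O)$ be the commutative algebra in which $\mathbb R^3=\langle E_0,E_1,E_2\rangle$ has the componentwise product and $$(\alpha_0,\alpha_1,\alpha_2)\iota_i(x)=\tfrac12(\alpha_{i+1}+\alpha_{i+2})\iota_i(x),\quad \iota_i(x)\iota_{i+1}(y)=\iota_{i+2}(x*y),\quad \iota_i(x)\iota_i(y)=2q(x,y)(E_{i+1}+E_{i+2})$$ (indices modulo 3). Let $\operatorname{tr}$ be the sum of the $\mathbb R^3$-coordinates, $\mathbb A_0=\ker\operatorname{tr}$, and $l_x$ the left multiplication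 by $x$. Let $\mathfrak g=\operatorname{Der}(\mathbb A)\oplus\mathbb A_0$ be the Lie algebra with the commutator bracket on $\operatorname{Der}(\mathbb A)$, $[d,x]=d(x)$ and $[x,y]=[l_x,l_y]$ for $d\in\operatorname{Der}(\mathbb A)$, $x,y\in\mathbb A_0$. Put $\mathfrak t=\operatorname{Der}(\mathbb A)$ and $\mathfrak p=\mathbb A_0$. For $x,y\in\mathbb O$ let $t_{x,y}=(d_0,d_1,d_2)$ with $$d_0(z)=q(x,z)y-q(y,z)x,\quad d_1(z)=\tfrac12q(x,y)z-(y*z)*x,\quad d_2(z)=\tfrac12q(x,y)z-x*(z*y),$$ and let $\rho(t_{x,y})\in\operatorname{Der}(\mathbb A)$ be the derivation that kills $\mathbb R^3$ and sends $\iota_i(z)$ to $\iota_i(d_i(z))$. Put $$h_1=\tfrac12\rho(t_{e_0,e_1}),\ h_2=\tfrac12\rho(t_{e_2,e_3}),\ h_3=\tfrac12\rho(t_{e_4,e_5}),\ h_4=\tfrac12\rho(t_{e_6,e_7}),\ h_5=E_2-E_0,\ h_6=E_0-E_1,$$ $\mathfrak a=\langle E_0-E_1,E_2-E_0\rangle$,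 and let $\mathfrak h$ be the subalgebra of $\mathfrak g$ generated by $h_1,\dots,h_6$. A decomposition $\mathfrak g=\mathfrak t\oplus\mathfrak p$ into a subalgebra and a subspace is a *Cartan decomposition* if there is a compact real form $\mathfrak u$ of $\mathfrak g^{\mathbb C}$ with $\mathfrak t=\mathfrak g\cap\mathfrak u$ and $\mathfrak p=\mathfrak g\cap\mathbf i\mathfrak u$. For $\lambda\in\mathfrak a^*$ let $\mathfrak g_\lambda=\{x\in\mathfrak g: [h,x]=\lambda(h)x\ \forall h\in\mathfrak a\}$; $\lambda$ is a *restricted root* if $\lambda\neq0$ and $\mathfrak g_\lambda\ne0$, and $m_\lambda=\dim\mathfrak g_\lambda$ is its multiplicity. If $\mathfrak h\supseteq\mathfrak a$ is such that $\mathfrak h^{\mathbb C}$ is a Cartan subalgebra of $\mathfrak g^{\mathbb C}$, with root system $\Delta$, write $\bar\alpha=\alpha|_{\mathfrak a}$; a basis $B$ of $\Delta$ is *adapted* if every $\alpha\in\Delta$ with $\bar\alpha=0$ is plus or minus a sum of elements of $B_0=\{\beta\in B:\bar\beta=0\}$. The *Satake diagram* is then the Dynkin diagram of $B$ with the nodes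 in $B_0$ black, those in $B\setminus B_0$ white, and two different white nodes $\alpha,\beta$ joined by an arrow when $\bar\alpha=\bar\beta$. **Theorem.** 1. The linear map $$(\alpha_0,\alpha_1,\alpha_2)+\iota_0(x)+\iota_1(y)+\iota_2(z)\mapsto\begin{pmatrix}\alpha_0&2\bar z&2y\\2z&\alpha_1&2\bar x\\2\bar y&2x&\alpha_2\end{pmatrix}$$ is an isomorphism from $\mathbb A$ onto the algebra $H_3(\mathbb O)$ of hermitian octonion matrices with the product $\frac12(XY+YX)$. 2. $\mathfrak g=\mathfrak t\oplus\mathfrak p$ is a Cartan decomposition; the Killing form of $\mathfrak g$ is positive definite on $\mathfrak p$ and negative definite on $\mathfrak t$; $\dim\mathfrak t=52$, $\dim\mathfrak p=26$, and the signature of the Killing form is $-26$. The Lie algebra $\mathfrak t$ is of type $F_4$ (that is, $\mathfrak t^{\mathbb C}$ is). 3. $\mathfrak a$ is a maximal abelian subspace of $\mathfrak p$. The subalgebra $\mathfrak h$ is a maximal abelian subalgebra of $\mathfrak g$, $\mathfrak h=\mathfrak a\oplus(\mathfrak h\cap\mathfrak t)$ with $\mathfrak h\cap\mathfrak t=\langle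 h_1,h_2,h_3,h_4\rangle$, the Killing form of $\mathfrak g^{\mathbb C}$ is nondegenerate, and $\mathfrak h^{\mathbb C}$ is a Cartan subalgebra of $\mathfrak g^{\mathbb C}$. 4. In terms of $h=\sum_{k=1}^6w_kh_k\in\mathfrak h^{\mathbb C}$, the set $\Delta$ of roots of $\mathfrak g^{\mathbb C}$ relative to $\mathfrak h^{\mathbb C}$ consists of the functionals $\mathbf i(\pm w_j\pm w_k)$ for $1\le j\ne k\le4$; $\pm\mathbf iw_j\pm\frac12(w_5+w_6)$ for $1\le j\le4$; $\frac12(\mathbf i\sum_{j=1}^4\varepsilon_jw_j\pm(2w_5-w_6))$ with $\varepsilon_j=\pm1$, $\prod_j\varepsilon_j=-1$; and $\frac12(\mathbf i\sum_{j=1}^4\varepsilon_jw_j\pm(w_5-2w_6))$ with $\varepsilon_j=\pm1$, $\prod_j\varepsilon_j=1$. 5. The functionals $$\begin{aligned}&\alpha_1=\tfrac12(-\mathbf iw_1-\mathbf iw_2-\mathbf iw_3-\mathbf iw_4+w_5-2w_6),\quad \alpha_2=\mathbf i(-w_1+w_2),\quad \alpha_3=\mathbf i(w_1+w_2),\\&\alpha_4=\mathbf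 i(-w_2+w_3),\quad\alpha_5=\mathbf i(-w_3+w_4),\quad\alpha_6=\tfrac12(-2\mathbf iw_4+w_5+w_6)\end{aligned}$$ form an adapted basis $B$ of $\Delta$. The corresponding Satake diagram is the Dynkin diagram $E_6$ (the chain $\alpha_1-\alpha_3-\alpha_4-\alpha_5-\alpha_6$ with $\alpha_2$ joined to $\alpha_4$), with $\alpha_2,\alpha_3,\alpha_4,\alpha_5$ black, $\alpha_1,\alpha_6$ white and no arrows. 6. $\bar\alpha_1(w_5h_5+w_6h_6)=\frac12(w_5-2w_6)$ and $\bar\alpha_6(w_5h_5+w_6h_6)=\frac12(w_5+w_6)$. The set of restricted roots is $\{\pm\bar\alpha_1,\pm\bar\alpha_6,\pm(\bar\alpha_1+\bar\alpha_6)\}$; it is a reduced root system of type $A_2$ in $\mathfrak a^*$ with basis $\{\bar\alpha_1,\bar\alpha_6\}$, and $m_{\bar\alpha_1}=m_{\bar\alpha_6}=8$. -/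

import Mathlib

open scoped TensorProduct Quaternion

noncomputable section

namespace E626

attribute [local instance] LieRing.ofAssociativeRing

/-! ### Octonions and para-octonions -/

/-- The octonion division algebra, i.e. the Cayley-Dickson double `CD(ℍ, -1)`. -/
def Octonion : Type := ℍ[ℝ] × ℍ[ℝ]

namespace Octonion

instance : AddCommGroup Octonion := inferInstanceAs (AddCommGroup (ℍ[ℝ] × ℍ[ℝ]))
instance : Module ℝ Octonion := inferInstanceAs (Module ℝ (ℍ[ℝ] × ℍ[ℝ]))
instance : Module.Finite ℝ Octonion := inferInstanceAs (Module.Finite ℝ (ℍ[ℝ] × ℍ[ℝ]))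

/-- `(a, b) (c, d) = (a c - d̄ b, d a + b c̄)`. -/
instance : Mul Octonion :=
  ⟨fun x y => (x.1 * y.1 - star y.2 * x.2, y.2 * x.1 + x.2 * star y.1)⟩

/-- The standard involution. -/
instance : Star Octonion := ⟨fun x => (star x.1, -x.2)⟩

/-- The multiplicative norm. -/
def norm (x : Octonion) : ℝ := Quaternion.normSq x.1 + Quaternion.normSq x.2

/-- The basis `1, i, j, k, l, il, jl, kl` of the octonions. -/
def e : Fin 8 → Octonion :=
  ![(⟨1, 0, 0, 0⟩, 0), (⟨0, 1, 0, 0⟩, 0), (⟨0, 0, 1, 0⟩, 0), (⟨0, 0, 0, 1⟩, 0),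
    (0, ⟨1, 0, 0, 0⟩), (0, ⟨0, 1, 0, 0⟩), (0, ⟨0, 0, 1, 0⟩), (0, ⟨0, 0, 0, 1⟩)]

theorem ext' {x y : Octonion}
    (h1 : x.1.re = y.1.re) (h2 : x.1.imI = y.1.imI) (h3 : x.1.imJ = y.1.imJ)
    (h4 : x.1.imK = y.1.imK) (h5 : x.2.re = y.2.re) (h6 : x.2.imI = y.2.imI)
    (h7 : x.2.imJ = y.2.imJ) (h8 : x.2.imK = y.2.imK) : x = y :=
  Prod.ext (QuaternionAlgebra.ext h1 h2 h3 h4) (QuaternionAlgebra.ext h5 h6 h7 h8)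

@[simp] theorem add_fst (x y : Octonion) : (x + y).1 = x.1 + y.1 := rfl
@[simp] theorem add_snd (x y : Octonion) : (x + y).2 = x.2 + y.2 := rfl
@[simp] theorem smul_fst (r : ℝ) (x : Octonion) : (r • x).1 = r • x.1 := rfl
@[simp] theorem smul_snd (r : ℝ) (x : Octonion) : (r • x).2 = r • x.2 := rfl
@[simp] theorem mul_fst (x y : Octonion) : (x * y).1 = x.1 * y.1 - star y.2 * x.2 := rfl
@[simp] theorem mul_snd (x y : Octonion) : (x * y).2 = y.2 * x.1 + x.2 * star y.1 := rfl
@[simp] theorem star_fst (x : Octonion) : (star x).1 = star x.1 := rfl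
@[simp] theorem star_snd (x : Octonion) : (star x).2 = -x.2 := rfl

/-- The product `x * y = x̄ ȳ` of the para-octonion algebra `pO`. -/
def pmul : Octonion →ₗ[ℝ] Octonion →ₗ[ℝ] Octonion :=
  LinearMap.mk₂ ℝ (fun x y => star x * star y)
    (fun x y z => by apply ext' <;> simp <;> ring)
    (fun r x y => by apply ext' <;> simp <;> ring)
    (fun x y z => by apply ext' <;> simp <;> ring)
    (fun r x y => by apply ext' <;> simp <;> ring)

theorem norm_eq (x : Octonion) : norm x = x.1.re ^ 2 + x.1.imI ^ 2 + x.1.imJ ^ 2 + x.1.imK ^ 2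
    + (x.2.re ^ 2 + x.2.imI ^ 2 + x.2.imJ ^ 2 + x.2.imK ^ 2) := by
  simp [norm, Quaternion.normSq_def']

/-- The polar form `q(x, y) = n(x + y) - n(x) - n(y)` of the norm. -/
def q : Octonion →ₗ[ℝ] Octonion →ₗ[ℝ] ℝ :=
  LinearMap.mk₂ ℝ (fun x y => norm (x + y) - norm x - norm y)
    (fun x y z => by simp [norm_eq]; ring)
    (fun r x y => by simp [norm_eq]; ring)
    (fun x y z => by simp [norm_eq]; ring)
    (fun r x y => by simp [norm_eq]; ring)

theorem pmul_apply (x y : Octonion) : pmul x y = star x * star y := rfl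

theorem q_apply (x y : Octonion) : q x y = norm (x + y) - norm x - norm y := rfl

theorem q_eq (x y : Octonion) : q x y = 2 * (x.1.re * y.1.re + x.1.imI * y.1.imI + x.1.imJ * y.1.imJ + x.1.imK * y.1.imK + x.2.re * y.2.re + x.2.imI * y.2.imI + x.2.imJ * y.2.imJ + x.2.imK * y.2.imK) := by
  simp only [q_apply, norm_eq, add_fst, add_snd, Quaternion.re_add, Quaternion.imI_add,
    Quaternion.imJ_add, Quaternion.imK_add]
  ring

theorem pmul_0 (x y : Octonion) : (pmul x y).1.re =
    x.1.re * y.1.re - x.1.imI * y.1.imI - x.1.imJ * y.1.imJ - x.1.imK * y.1.imK - x.2.re * y.2.re - x.2.imI * y.2.imI - x.2.imJ * y.2.imJ - x.2.imK * y.2.imK := by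
  simp [pmul_apply]; ring

theorem pmul_1 (x y : Octonion) : (pmul x y).1.imI =
    -(x.1.re * y.1.imI) - x.1.imI * y.1.re + x.1.imJ * y.1.imK - x.1.imK * y.1.imJ + x.2.re * y.2.imI - x.2.imI * y.2.re - x.2.imJ * y.2.imK + x.2.imK * y.2.imJ := by
  simp [pmul_apply]; ring

theorem pmul_2 (x y : Octonion) : (pmul x y).1.imJ =
    -(x.1.re * y.1.imJ) - x.1.imI * y.1.imK - x.1.imJ * y.1.re + x.1.imK * y.1.imI + x.2.re * y.2.imJ + x.2.imI * y.2.imK - x.2.imJ * y.2.re - x.2.imK * y.2.imI := by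
  simp [pmul_apply]; ring

theorem pmul_3 (x y : Octonion) : (pmul x y).1.imK =
    -(x.1.re * y.1.imK) + x.1.imI * y.1.imJ - x.1.imJ * y.1.imI - x.1.imK * y.1.re + x.2.re * y.2.imK - x.2.imI * y.2.imJ + x.2.imJ * y.2.imI - x.2.imK * y.2.re := by
  simp [pmul_apply]; ring

theorem pmul_4 (x y : Octonion) : (pmul x y).2.re =
    -(x.1.re * y.2.re) - x.1.imI * y.2.imI - x.1.imJ * y.2.imJ - x.1.imK * y.2.imK - x.2.re * y.1.re + x.2.imI * y.1.imI + x.2.imJ * y.1.imJ + x.2.imK * y.1.imK := by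
  simp [pmul_apply]; ring

theorem pmul_5 (x y : Octonion) : (pmul x y).2.imI =
    -(x.1.re * y.2.imI) + x.1.imI * y.2.re - x.1.imJ * y.2.imK + x.1.imK * y.2.imJ - x.2.re * y.1.imI - x.2.imI * y.1.re - x.2.imJ * y.1.imK + x.2.imK * y.1.imJ := by
  simp [pmul_apply]; ring

theorem pmul_6 (x y : Octonion) : (pmul x y).2.imJ =
    -(x.1.re * y.2.imJ) + x.1.imI * y.2.imK + x.1.imJ * y.2.re - x.1.imK * y.2.imI - x.2.re * y.1.imJ + x.2.imI * y.1.imK - x.2.imJ * y.1.re - x.2.imK * y.1.imI := by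
  simp [pmul_apply]; ring

theorem pmul_7 (x y : Octonion) : (pmul x y).2.imK =
    -(x.1.re * y.2.imK) - x.1.imI * y.2.imJ + x.1.imJ * y.2.imI + x.1.imK * y.2.re - x.2.re * y.1.imK - x.2.imI * y.1.imJ + x.2.imJ * y.1.imI - x.2.imK * y.1.re := by
  simp [pmul_apply]; ring

theorem q_comm (x y : Octonion) : q x y = q y x := by
  simp only [q_eq]; ring

theorem q_assoc (x y z : Octonion) : q (pmul x y) z = q x (pmul y z) := by
  simp only [q_eq, pmul_0, pmul_1, pmul_2, pmul_3, pmul_4, pmul_5, pmul_6, pmul_7]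
  ring

theorem pmul_left (x y z : Octonion) :
    pmul (pmul x y) z + pmul (pmul z y) x = q x z • y := by
  apply ext' <;>
  · simp only [q_eq, pmul_0, pmul_1, pmul_2, pmul_3, pmul_4, pmul_5, pmul_6, pmul_7,
      add_fst, add_snd, smul_fst, smul_snd, Quaternion.re_add, Quaternion.imI_add,
      Quaternion.imJ_add, Quaternion.imK_add, Quaternion.re_smul, Quaternion.imI_smul,
      Quaternion.imJ_smul, Quaternion.imK_smul, smul_eq_mul]
    ring

theorem pmul_right (x y z : Octonion) :
    pmul x (pmul y z) + pmul z (pmul y x) = q x z • y := by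
  apply ext' <;>
  · simp only [q_eq, pmul_0, pmul_1, pmul_2, pmul_3, pmul_4, pmul_5, pmul_6, pmul_7,
      add_fst, add_snd, smul_fst, smul_snd, Quaternion.re_add, Quaternion.imI_add,
      Quaternion.imJ_add, Quaternion.imK_add, Quaternion.re_smul, Quaternion.imI_smul,
      Quaternion.imJ_smul, Quaternion.imK_smul, smul_eq_mul]
    ring

end Octonion

/-! ### The triality Lie algebra of the para-octonions -/

open Octonion

/-- Triples `(d₀, d₁, d₂)` of skew maps with `d₀(x * y) = d₁(x) * y + x * d₂(y)`. -/
def tri : Submodule ℝ (Fin 3 → Module.End ℝ Octonion) where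
  carrier := {d | (∀ i x y, q (d i x) y + q x (d i y) = 0) ∧
    ∀ x y, d 0 (pmul x y) = pmul (d 1 x) y + pmul x (d 2 y)}
  zero_mem' := by simp
  add_mem' := by
    rintro a b ⟨ha, ha'⟩ ⟨hb, hb'⟩
    refine ⟨fun i x y => ?_, fun x y => ?_⟩
    · have h1 := ha i x y
      have h2 := hb i x y
      simp only [Pi.add_apply, LinearMap.add_apply, map_add]
      linarith
    · simp only [Pi.add_apply, LinearMap.add_apply, map_add, ha', hb']
      abel
  smul_mem' := by
    rintro r a ⟨ha, ha'⟩
    refine ⟨fun i x y => ?_, fun x y => ?_⟩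
    · have h1 := ha i x y
      simp only [Pi.smul_apply, LinearMap.smul_apply, map_smul, smul_eq_mul]
      linear_combination r * h1
    · simp only [Pi.smul_apply, LinearMap.smul_apply, map_smul, ha', smul_add]

/-- Left multiplication `l_x(z) = x * z` in `pO`. -/
def pl (x : Octonion) : Module.End ℝ Octonion := pmul x

/-- Right multiplication `r_x(z) = z * x` in `pO`. -/
def pr (x : Octonion) : Module.End ℝ Octonion := pmul.flip x

/-- `σ_{x,y}(z) = q(x, z) y - q(y, z) x`. -/
def sigma (x y : Octonion) : Module.End ℝ Octonion :=
  (q x).smulRight y - (q y).smulRight x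

/-- `t_{x,y} = (σ_{x,y}, q(x,y)/2 id - r_x l_y, q(x,y)/2 id - l_x r_y)`. -/
def t (x y : Octonion) : Fin 3 → Module.End ℝ Octonion :=
  ![sigma x y, (1 / 2 * q x y) • LinearMap.id - pr x ∘ₗ pl y,
    (1 / 2 * q x y) • LinearMap.id - pl x ∘ₗ pr y]

theorem t_zero_apply (x y z : Octonion) : t x y 0 z = q x z • y - q y z • x := by
  simp [t, sigma]

theorem t_one_apply (x y z : Octonion) :
    t x y 1 z = (1 / 2 * q x y) • z - pmul (pmul y z) x := by
  simp [t, pl, pr]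

theorem t_two_apply (x y z : Octonion) :
    t x y 2 z = (1 / 2 * q x y) • z - pmul x (pmul z y) := by
  simp [t, pl, pr]

theorem q_pmul_pmul_left (x y z w : Octonion) :
    q (pmul (pmul y z) x) w + q z (pmul (pmul y w) x) = q x y * q z w := by
  have h2 : q z (pmul (pmul y w) x) = q (pmul (pmul x z) y) w := by
    rw [q_comm, q_assoc, q_comm, ← q_assoc]
  have h3 := congrArg (fun u => q u w) (pmul_left y z x)
  simp only [map_add, LinearMap.add_apply, map_smul, LinearMap.smul_apply, smul_eq_mul] at h3
  rw [h2, h3, q_comm y x]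

theorem q_pmul_pmul_right (x y z w : Octonion) :
    q (pmul x (pmul z y)) w + q z (pmul x (pmul w y)) = q x y * q z w := by
  have h2 : q z (pmul x (pmul w y)) = q w (pmul y (pmul z x)) := by
    rw [← q_assoc, q_comm, q_assoc]
  have h3 := congrArg (fun u => q w u) (pmul_right x z y)
  simp only [map_add, map_smul, smul_eq_mul] at h3
  rw [h2, q_comm _ w, h3, q_comm w z]

theorem t_mem (x y : Octonion) : t x y ∈ tri := by
  refine ⟨fun i z w => ?_, fun u v => ?_⟩
  · fin_cases i
    · simp only [Fin.zero_eta, t_zero_apply, map_sub, map_smul, LinearMap.sub_apply,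
        LinearMap.smul_apply, smul_eq_mul, q_comm z]
      ring
    · have := q_pmul_pmul_left x y z w
      simp only [Fin.mk_one, t_one_apply, map_sub, map_smul, LinearMap.sub_apply,
        LinearMap.smul_apply, smul_eq_mul]
      linarith
    · have := q_pmul_pmul_right x y z w
      simp only [Fin.reduceFinMk, t_two_apply, map_sub, map_smul, LinearMap.sub_apply,
        LinearMap.smul_apply, smul_eq_mul]
      linarith
  · simp only [t_zero_apply, t_one_apply, t_two_apply, map_sub, map_smul, LinearMap.sub_apply,
      LinearMap.smul_apply]
    have h1 := pmul_left (pmul y u) x v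
    have h3 := pmul_right (pmul v x) y u
    have h5 := congrArg (pmul u) (pmul_right y v x)
    simp only [map_add, map_smul] at h5
    have e1 : q (pmul y u) v = q y (pmul u v) := q_assoc y u v
    have e2 : q (pmul v x) u = q x (pmul u v) := by rw [q_comm, ← q_assoc, q_comm]
    have e4 : q y x = q x y := q_comm y x
    rw [e1] at h1
    rw [e2] at h3
    rw [e4] at h5
    linear_combination (norm := module) h1 - h3 + h5

/-- The triality condition in its three cyclic forms. -/
theorem tri_cyclic {d : Fin 3 → Module.End ℝ Octonion} (hd : d ∈ tri) (i : Fin 3)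
    (x y : Octonion) : d i (pmul x y) = pmul (d (i + 1) x) y + pmul x (d (i + 2) y) := by
  obtain ⟨hs, h0⟩ := hd
  have nondeg : ∀ u v : Octonion, (∀ w, q u w = q v w) → u = v := by
    intro u v h
    have h' := h (u - v)
    have h2 : q (u - v) (u - v) = 0 := by
      rw [map_sub (q (u - v)), q_comm _ u, q_comm _ v, h', sub_self]
    have h3 : Octonion.norm (u - v) = 0 := by
      have : q (u - v) (u - v) = 2 * Octonion.norm (u - v) := by rw [q_eq, norm_eq]; ring
      linarith
    rw [Octonion.norm, add_eq_zero_iff_of_nonneg Quaternion.normSq_nonneg Quaternion.normSq_nonneg,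
      Quaternion.normSq_eq_zero, Quaternion.normSq_eq_zero] at h3
    exact sub_eq_zero.1 (Prod.ext h3.1 h3.2)
  have key : ∀ x y z, q (d 0 (pmul x y)) z = q (pmul (d 1 x) y) z + q (pmul x (d 2 y)) z := by
    intro x y z
    rw [h0, map_add, LinearMap.add_apply]
  fin_cases i
  · exact h0 x y
  · refine nondeg _ _ fun w => ?_
    have h1 := key w x y
    have h2 := hs 0 (pmul w x) y
    have h3 := hs 1 w (pmul x y)
    have c1 : q (pmul (d 2 x) y) w = q w (pmul (d 2 x) y) := q_comm _ _
    have c2 : q (pmul x (d 0 y)) w = q w (pmul x (d 0 y)) := q_comm _ _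
    have c3 : q (d 1 (pmul x y)) w = q w (d 1 (pmul x y)) := q_comm _ _
    simp only [q_assoc] at h1 h2
    change q (d 1 (pmul x y)) w = q (pmul (d 2 x) y + pmul x (d 0 y)) w
    rw [map_add, LinearMap.add_apply, c1, c2, c3]
    linarith
  · refine nondeg _ _ fun w => ?_
    have h1 := key y w x
    have h2 := hs 0 (pmul y w) x
    have h3 := hs 2 w (pmul x y)
    have c : ∀ a b c : Octonion, q (pmul a b) c = q b (pmul c a) := by
      intro a b c
      rw [q_comm, ← q_assoc, q_comm]
    have c1 : q (d 2 (pmul x y)) w = q w (d 2 (pmul x y)) := q_comm _ _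
    have c2 : q (pmul (d 0 x) y) w = q w (pmul (d 0 x) y) := q_comm _ _
    have c3 : q (pmul x (d 1 y)) w = q w (pmul x (d 1 y)) := q_comm _ _
    have c4 := c (d 1 y) w x
    have c5 := c y (d 2 w) x
    have c6 := c y w (d 0 x)
    have c7 := q_comm (pmul y (d 2 w)) x
    have c8 := q_comm (d 2 w) (pmul x y)
    change q (d 2 (pmul x y)) w = q (pmul (d 0 x) y + pmul x (d 1 y)) w
    rw [map_add, LinearMap.add_apply, c1, c2, c3]
    rw [c4, c5] at h1
    rw [c6] at h2
    linarith

/-! ### The Albert algebra `A₍₁,₁,₁₎(pO)` -/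

/-- The vector space `ℝ³ ⊕ ι₀(pO) ⊕ ι₁(pO) ⊕ ι₂(pO)`. -/
def Albert : Type := (Fin 3 → ℝ) × (Fin 3 → Octonion)

namespace Albert

instance : AddCommGroup Albert := inferInstanceAs (AddCommGroup ((Fin 3 → ℝ) × (Fin 3 → Octonion)))
instance : Module ℝ Albert := inferInstanceAs (Module ℝ ((Fin 3 → ℝ) × (Fin 3 → Octonion)))
instance : Module.Finite ℝ Albert :=
  inferInstanceAs (Module.Finite ℝ ((Fin 3 → ℝ) × (Fin 3 → Octonion)))

theorem ext' {x y : Albert} (h1 : ∀ i, x.1 i = y.1 i) (h2 : ∀ i, x.2 i = y.2 i) : x = y :=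
  Prod.ext (funext h1) (funext h2)

@[simp] theorem add_fst (x y : Albert) (i) : (x + y).1 i = x.1 i + y.1 i := rfl
@[simp] theorem add_snd (x y : Albert) (i) : (x + y).2 i = x.2 i + y.2 i := rfl
@[simp] theorem sub_fst (x y : Albert) (i) : (x - y).1 i = x.1 i - y.1 i := rfl
@[simp] theorem sub_snd (x y : Albert) (i) : (x - y).2 i = x.2 i - y.2 i := rfl
@[simp] theorem smul_fst (r : ℝ) (x : Albert) (i) : (r • x).1 i = r * x.1 i := rfl
@[simp] theorem smul_snd (r : ℝ) (x : Albert) (i) : (r • x).2 i = r • x.2 i := rfl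

/-- The multiplication of the Albert algebra: the commutative bilinear product with
`E_i E_j = δ_{ij} E_i`, `(α₀, α₁, α₂) ι_i(x) = (α_{i+1} + α_{i+2})/2 ι_i(x)`,
`ι_i(x) ι_{i+1}(y) = ι_{i+2}(x * y)` and `ι_i(x) ι_i(y) = 2 q(x, y) (E_{i+1} + E_{i+2})`,
indices modulo 3. -/
def mul (x y : Albert) : Albert :=
  (fun j => x.1 j * y.1 j + 2 * q (x.2 (j + 1)) (y.2 (j + 1)) + 2 * q (x.2 (j + 2)) (y.2 (j + 2)),
   fun i => (1 / 2 * (x.1 (i + 1) + x.1 (i + 2))) • y.2 i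
      + (1 / 2 * (y.1 (i + 1) + y.1 (i + 2))) • x.2 i
      + pmul (x.2 (i + 1)) (y.2 (i + 2)) + pmul (y.2 (i + 1)) (x.2 (i + 2)))

theorem mul_fst (x y : Albert) (j : Fin 3) : (mul x y).1 j =
    x.1 j * y.1 j + 2 * q (x.2 (j + 1)) (y.2 (j + 1)) + 2 * q (x.2 (j + 2)) (y.2 (j + 2)) := rfl

theorem mul_snd (x y : Albert) (i : Fin 3) : (mul x y).2 i =
    (1 / 2 * (x.1 (i + 1) + x.1 (i + 2))) • y.2 i + (1 / 2 * (y.1 (i + 1) + y.1 (i + 2))) • x.2 i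
      + pmul (x.2 (i + 1)) (y.2 (i + 2)) + pmul (y.2 (i + 1)) (x.2 (i + 2)) := rfl

instance : Mul Albert := ⟨mul⟩

/-- The left multiplication operators `l_x`. -/
def L : Albert →ₗ[ℝ] Module.End ℝ Albert :=
  LinearMap.mk₂ ℝ mul
    (fun x y z => by
      apply ext' <;> intro i
      · simp [mul_fst]; ring
      · simp [mul_snd]; module)
    (fun r x y => by
      apply ext' <;> intro i
      · simp [mul_fst]; ring
      · simp [mul_snd]; module)
    (fun x y z => by
      apply ext' <;> intro i
      · simp [mul_fst]; ring
      · simp [mul_snd]; module)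
    (fun r x y => by
      apply ext' <;> intro i
      · simp [mul_fst]; ring
      · simp [mul_snd]; module)

theorem mul_def (x y : Albert) : x * y = L x y := rfl

theorem L_fst (x y : Albert) (j : Fin 3) : (L x y).1 j =
    x.1 j * y.1 j + 2 * q (x.2 (j + 1)) (y.2 (j + 1)) + 2 * q (x.2 (j + 2)) (y.2 (j + 2)) := rfl

theorem L_snd (x y : Albert) (i : Fin 3) : (L x y).2 i =
    (1 / 2 * (x.1 (i + 1) + x.1 (i + 2))) • y.2 i + (1 / 2 * (y.1 (i + 1) + y.1 (i + 2))) • x.2 i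
      + pmul (x.2 (i + 1)) (y.2 (i + 2)) + pmul (y.2 (i + 1)) (x.2 (i + 2)) := rfl

theorem L_comm (x y : Albert) : L x y = L y x := by
  apply ext' <;> intro i
  · simp only [L_fst, q_comm (x.2 _)]; ring
  · simp only [L_snd]; module

/-- The idempotents `E_0, E_1, E_2`. -/
def E (i : Fin 3) : Albert := (Pi.single i 1, 0)

/-- The embeddings `ι_0, ι_1, ι_2` of `pO`. -/
def iota (i : Fin 3) (x : Octonion) : Albert := (0, Pi.single i x)

@[simp] theorem E_fst (i : Fin 3) : (E i).1 = Pi.single i 1 := rfl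
@[simp] theorem E_snd (i : Fin 3) : (E i).2 = 0 := rfl
@[simp] theorem iota_fst (i : Fin 3) (x : Octonion) : (iota i x).1 = 0 := rfl
@[simp] theorem iota_snd (i : Fin 3) (x : Octonion) : (iota i x).2 = Pi.single i x := rfl

/-- The unit element `E_0 + E_1 + E_2`. -/
instance : One Albert := ⟨(1, 0)⟩

theorem L_one (x : Albert) : L x 1 = x := by
  have h1 : ∀ i, (1 : Albert).1 i = 1 := fun _ => rfl
  have h2 : ∀ i, (1 : Albert).2 i = 0 := fun _ => rfl
  apply ext' <;> intro i
  · simp [L_fst, h1, h2]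
  · simp [L_snd, h1, h2]
    norm_num

/-- The trace `α₀ + α₁ + α₂`. -/
def tr : Albert →ₗ[ℝ] ℝ where
  toFun x := ∑ i, x.1 i
  map_add' x y := by simp [Finset.sum_add_distrib]
  map_smul' r x := by simp [Finset.mul_sum]

/-- The subspace `A₀` of elements of trace zero. -/
def A0 : Submodule ℝ Albert := LinearMap.ker tr

theorem tr_apply (x : Albert) : tr x = x.1 0 + x.1 1 + x.1 2 := by
  simp [tr, Fin.sum_univ_three]

/-- The Lie algebra `Der(A)` of derivations of the Albert algebra. -/
def Der : LieSubalgebra ℝ (Module.End ℝ Albert) where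
  carrier := {d | ∀ x y : Albert, d (x * y) = d x * y + x * d y}
  zero_mem' := by intro x y; simp [mul_def]
  add_mem' := by
    intro a b ha hb x y
    have h1 := ha x y
    have h2 := hb x y
    simp only [mul_def, LinearMap.add_apply, map_add] at *
    rw [h1, h2]; abel
  smul_mem' := by
    intro r a ha x y
    have h1 := ha x y
    simp only [mul_def, LinearMap.smul_apply, map_smul] at *
    rw [h1, smul_add]
  lie_mem' := by
    intro a b ha hb x y
    have ha' : ∀ x y, a (L x y) = L (a x) y + L x (a y) := ha
    have hb' : ∀ x y, b (L x y) = L (b x) y + L x (b y) := hb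
    simp only [mul_def, LieRing.of_associative_ring_bracket, LinearMap.sub_apply,
      Module.End.mul_apply, map_sub, map_add, ha', hb']
    abel

/-- `ρ(d₀, d₁, d₂)` as an endomorphism: it kills `ℝ³` and maps `ι_i(x)` to `ι_i(d_i(x))`. -/
def rhoEnd (d : Fin 3 → Module.End ℝ Octonion) : Module.End ℝ Albert where
  toFun x := (0, fun i => d i (x.2 i))
  map_add' _ _ := ext' (fun _ => (add_zero 0).symm) (fun i => map_add (d i) _ _)
  map_smul' r _ := ext' (fun _ => (mul_zero r).symm) (fun i => map_smul (d i) r _)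

@[simp] theorem rhoEnd_fst (d : Fin 3 → Module.End ℝ Octonion) (x : Albert) (i) :
    (rhoEnd d x).1 i = 0 := rfl
@[simp] theorem rhoEnd_snd (d : Fin 3 → Module.End ℝ Octonion) (x : Albert) (i) :
    (rhoEnd d x).2 i = d i (x.2 i) := rfl

theorem f11 (i : Fin 3) : i + 1 + 1 = i + 2 := by fin_cases i <;> rfl
theorem f12 (i : Fin 3) : i + 1 + 2 = i := by fin_cases i <;> rfl
theorem f21 (i : Fin 3) : i + 2 + 1 = i := by fin_cases i <;> rfl
theorem f22 (i : Fin 3) : i + 2 + 2 = i + 1 := by fin_cases i <;> rfl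

theorem rhoEnd_mem {d : Fin 3 → Module.End ℝ Octonion} (hd : d ∈ tri) : rhoEnd d ∈ Der := by
  intro x y
  apply ext' <;> intro i
  · have h1 := hd.1 (i + 1) (x.2 (i + 1)) (y.2 (i + 1))
    have h2 := hd.1 (i + 2) (x.2 (i + 2)) (y.2 (i + 2))
    simp only [mul_def, add_fst, L_fst, rhoEnd_fst, rhoEnd_snd]
    linarith
  · have h1 := tri_cyclic hd i (x.2 (i + 1)) (y.2 (i + 2))
    have h2 := tri_cyclic hd i (y.2 (i + 1)) (x.2 (i + 2))
    simp only [mul_def, add_snd, L_snd, rhoEnd_fst, rhoEnd_snd, map_add, map_smul, h1, h2]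
    module

/-- The map `ρ : tri(pO) → Der(A)`. -/
def rho : tri →ₗ[ℝ] Der where
  toFun d := ⟨rhoEnd d, rhoEnd_mem d.2⟩
  map_add' _ _ := Subtype.ext (LinearMap.ext fun x => by
    apply ext' <;> intro i <;> simp)
  map_smul' _ _ := Subtype.ext (LinearMap.ext fun x => by
    apply ext' <;> intro i <;> simp)

/-- The underlying map of the derivation `∑ ρ(ι_i(u_i))`, where `ρ(ι_i(u)) = 2 [l_{ι_i(u)}, l_{E_{i+1}}]`. -/
def rhoIotaFun (u : Fin 3 → Octonion) (x : Albert) : Albert :=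
  (fun j => 2 * q (u (j + 1)) (x.2 (j + 1)) - 2 * q (u (j + 2)) (x.2 (j + 2)),
    fun i => (1 / 2 * (x.1 (i + 1) - x.1 (i + 2))) • u i
      - pmul (u (i + 1)) (x.2 (i + 2)) + pmul (x.2 (i + 1)) (u (i + 2)))

theorem rhoIotaFun_fst (u : Fin 3 → Octonion) (x : Albert) (j) : (rhoIotaFun u x).1 j =
    2 * q (u (j + 1)) (x.2 (j + 1)) - 2 * q (u (j + 2)) (x.2 (j + 2)) := rfl

theorem rhoIotaFun_snd (u : Fin 3 → Octonion) (x : Albert) (i) : (rhoIotaFun u x).2 i =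
    (1 / 2 * (x.1 (i + 1) - x.1 (i + 2))) • u i
      - pmul (u (i + 1)) (x.2 (i + 2)) + pmul (x.2 (i + 1)) (u (i + 2)) := rfl

/-- The derivation `∑ ρ(ι_i(u_i))`, as an endomorphism. -/
def rhoIotaEnd (u : Fin 3 → Octonion) : Module.End ℝ Albert where
  toFun := rhoIotaFun u
  map_add' x y := by
    refine ext' (fun i => ?_) (fun i => ?_)
    · simp only [rhoIotaFun_fst, add_fst, add_snd, map_add]; ring
    · simp only [rhoIotaFun_snd, add_fst, add_snd, map_add, LinearMap.add_apply]; module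
  map_smul' r x := by
    refine ext' (fun i => ?_) (fun i => ?_)
    · simp only [rhoIotaFun_fst, RingHom.id_apply, smul_fst, smul_snd, map_smul, smul_eq_mul]
      ring
    · simp only [rhoIotaFun_snd, RingHom.id_apply, smul_fst, smul_snd, map_smul,
        LinearMap.smul_apply]
      module

theorem rhoIotaEnd_fst (u : Fin 3 → Octonion) (x : Albert) (j) : (rhoIotaEnd u x).1 j =
    2 * q (u (j + 1)) (x.2 (j + 1)) - 2 * q (u (j + 2)) (x.2 (j + 2)) := rfl

theorem rhoIotaEnd_snd (u : Fin 3 → Octonion) (x : Albert) (i) : (rhoIotaEnd u x).2 i =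
    (1 / 2 * (x.1 (i + 1) - x.1 (i + 2))) • u i
      - pmul (u (i + 1)) (x.2 (i + 2)) + pmul (x.2 (i + 1)) (u (i + 2)) := rfl

theorem q_cyc (a b c : Octonion) : q a (pmul b c) = q b (pmul c a) := by
  rw [← q_assoc b, q_comm]

theorem L_mul (x y : Albert) : x * y = mul x y := rfl

theorem rhoIotaEnd_mem (u : Fin 3 → Octonion) : rhoIotaEnd u ∈ Der := by
  intro x y
  apply ext' <;> intro i
  · simp only [L_mul, add_fst, mul_fst, rhoIotaEnd_fst, rhoIotaEnd_snd, mul_snd, f11, f12, f21,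
      f22, map_add, map_sub, map_smul, LinearMap.add_apply, LinearMap.sub_apply,
      LinearMap.smul_apply, smul_eq_mul, q_assoc, q_comm (x.2 (i + 1)) (u (i + 1)),
      q_comm (x.2 (i + 2)) (u (i + 2))]
    linear_combination 2 * q_cyc (u (i + 1)) (x.2 (i + 2)) (y.2 i)
      - 2 * q_cyc (x.2 i) (u (i + 1)) (y.2 (i + 2)) + 2 * q_cyc (x.2 (i + 1)) (u (i + 2)) (y.2 i)
      + 2 * q_cyc (u i) (x.2 (i + 1)) (y.2 (i + 2))
  · have a1 := pmul_left (x.2 (i + 2)) (u i) (y.2 (i + 2))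
    have a2 := pmul_left (x.2 (i + 2)) (y.2 i) (u (i + 2))
    have a3 := pmul_left (y.2 (i + 2)) (x.2 i) (u (i + 2))
    have b1 := pmul_right (x.2 (i + 1)) (u i) (y.2 (i + 1))
    have b2 := pmul_right (u (i + 1)) (x.2 i) (y.2 (i + 1))
    have b3 := pmul_right (u (i + 1)) (y.2 i) (x.2 (i + 1))
    rw [q_comm (x.2 _) (u _)] at a2
    rw [q_comm (y.2 _) (u _)] at a3
    simp only [L_mul, add_snd, mul_fst, rhoIotaEnd_fst, rhoIotaEnd_snd, mul_snd, f11, f12, f21,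
      f22, map_add, map_sub, map_smul, LinearMap.add_apply, LinearMap.sub_apply,
      LinearMap.smul_apply]
    linear_combination (norm := module) -a1 + a2 + a3 + b1 - b2 - b3

theorem shift_mem {d : Fin 3 → Module.End ℝ Octonion} (hd : d ∈ tri) (i : Fin 3) :
    (fun k => d (k + i)) ∈ tri := by
  refine ⟨fun k => hd.1 (k + i), fun x y => ?_⟩
  have h := tri_cyclic hd i x y
  simp only [zero_add]
  rw [h, add_comm 1 i, add_comm 2 i]

/-- The triality triple and the off-diagonal part of `[l_x, l_y]`. -/
theorem lie_L (x y : Albert) : ⁅L x, L y⁆ =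
    rhoEnd ((-2 : ℝ) • ((fun k => t (x.2 0) (y.2 0) (k + 0)) + (fun k => t (x.2 1) (y.2 1) (k + 2))
      + (fun k => t (x.2 2) (y.2 2) (k + 1))))
    + rhoIotaEnd (fun i => (1 / 2 * (y.1 (i + 1) - y.1 (i + 2))) • x.2 i
      - (1 / 2 * (x.1 (i + 1) - x.1 (i + 2))) • y.2 i + pmul (x.2 (i + 1)) (y.2 (i + 2))
      - pmul (y.2 (i + 1)) (x.2 (i + 2))) := by
  have hsum : ∀ i : Fin 3, ∀ z, ((-2 : ℝ) • ((fun k => t (x.2 0) (y.2 0) (k + 0))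
      + (fun k => t (x.2 1) (y.2 1) (k + 2)) + (fun k => t (x.2 2) (y.2 2) (k + 1)))) i z
      = (-2 : ℝ) • (t (x.2 i) (y.2 i) 0 z + t (x.2 (i + 1)) (y.2 (i + 1)) 2 z
        + t (x.2 (i + 2)) (y.2 (i + 2)) 1 z) := by
    intro i z
    fin_cases i
    · simp
    · simp; abel
    · simp; abel
  refine LinearMap.ext fun z => ?_
  have hL : ∀ a b, L a b = mul a b := fun _ _ => rfl
  rw [LieRing.of_associative_ring_bracket]
  simp only [LinearMap.sub_apply, LinearMap.add_apply, Module.End.mul_apply, hL]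
  apply ext' <;> intro i
  · simp only [sub_fst, add_fst, rhoEnd_fst, rhoIotaEnd_fst, mul_fst, mul_snd, f11, f12, f21, f22,
      map_add, map_sub, map_smul, LinearMap.add_apply, LinearMap.sub_apply,
      LinearMap.smul_apply, smul_eq_mul, q_assoc]
    linear_combination (z.1 i + z.1 (i + 2)) * q_comm (x.2 (i + 1)) (y.2 (i + 1))
      + (z.1 i + z.1 (i + 1)) * q_comm (x.2 (i + 2)) (y.2 (i + 2))
      + 2 * q_cyc (x.2 (i + 1)) (y.2 (i + 2)) (z.2 i)
      - 2 * q_cyc (y.2 i) (x.2 (i + 1)) (z.2 (i + 2))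
      - 2 * q_cyc (y.2 (i + 1)) (x.2 (i + 2)) (z.2 i)
      + 2 * q_cyc (x.2 i) (y.2 (i + 1)) (z.2 (i + 2))
  · have c1 := pmul_left (x.2 (i + 2)) (y.2 i) (z.2 (i + 2))
    have c2 := pmul_left (y.2 (i + 2)) (x.2 i) (z.2 (i + 2))
    have c3 := pmul_left (x.2 (i + 2)) (z.2 i) (y.2 (i + 2))
    have d1 := pmul_right (x.2 (i + 1)) (y.2 i) (z.2 (i + 1))
    have d2 := pmul_right (y.2 (i + 1)) (x.2 i) (z.2 (i + 1))
    have d3 := pmul_right (x.2 (i + 1)) (z.2 i) (y.2 (i + 1))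
    simp only [sub_snd, add_snd, rhoEnd_snd, hsum]
    simp only [t_zero_apply, t_one_apply, t_two_apply, mul_fst,
      rhoIotaEnd_snd, mul_snd, f11, f12, f21, f22, map_add, map_sub, map_smul,
      LinearMap.add_apply, LinearMap.sub_apply, LinearMap.smul_apply]
    linear_combination (norm := module) c1 - c2 - c3 + d1 - d2 - d3

/-- `[l_x, l_y]` is a derivation. -/
theorem lie_L_mem (x y : Albert) : ⁅L x, L y⁆ ∈ Der := by
  rw [lie_L]
  refine Der.add_mem (rhoEnd_mem (tri.smul_mem _ (tri.add_mem (tri.add_mem ?_ ?_) ?_)))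
    (rhoIotaEnd_mem _)
  · exact shift_mem (t_mem _ _) 0
  · exact shift_mem (t_mem _ _) 2
  · exact shift_mem (t_mem _ _) 1

theorem der_L (d : Der) (x : Albert) :
    ⁅(d : Module.End ℝ Albert), L x⁆ = L ((d : Module.End ℝ Albert) x) := by
  refine LinearMap.ext fun y => ?_
  have h : (d : Module.End ℝ Albert) (L x y) = L ((d : Module.End ℝ Albert) x) y
      + L x ((d : Module.End ℝ Albert) y) := d.2 x y
  rw [LieRing.of_associative_ring_bracket]
  simp only [LinearMap.sub_apply, Module.End.mul_apply, h, add_sub_cancel_right]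

theorem der_one (d : Der) : (d : Module.End ℝ Albert) 1 = 0 := by
  have h : (d : Module.End ℝ Albert) (L 1 1) = L ((d : Module.End ℝ Albert) 1) 1
      + L 1 ((d : Module.End ℝ Albert) 1) := d.2 1 1
  rw [L_comm 1 ((d : Module.End ℝ Albert) 1), L_one, L_one] at h
  exact left_eq_add.mp h

theorem tr_assoc (x y z : Albert) : tr (L (L x y) z) = tr (L x (L y z)) := by
  have hL : ∀ a b, L a b = mul a b := fun _ _ => rfl
  simp only [tr_apply, hL, mul_fst, mul_snd, Fin.isValue, zero_add, Fin.reduceAdd, map_add,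
    map_smul, LinearMap.add_apply, LinearMap.smul_apply, smul_eq_mul, q_assoc]
  linear_combination 4 * q_cyc (y.2 1) (x.2 2) (z.2 0) + 4 * q_cyc (y.2 2) (x.2 0) (z.2 1)
    + 4 * q_cyc (y.2 0) (x.2 1) (z.2 2)

theorem L_E_E (i : Fin 3) : L (E i) (E i) = E i := by
  have hL : ∀ a b, L a b = mul a b := fun _ _ => rfl
  refine ext' (fun j => ?_) (fun j => ?_)
  · rw [hL, mul_fst]
    simp [Pi.single_apply]
  · rw [hL, mul_snd]
    simp

theorem L_E_iota (i : Fin 3) (x : Octonion) :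
    L (E (i + 1)) (iota i x) = (1 / 2 : ℝ) • iota i x := by
  have hL : ∀ a b, L a b = mul a b := fun _ _ => rfl
  refine ext' (fun j => ?_) (fun j => ?_)
  · rw [hL, mul_fst]
    fin_cases i <;> fin_cases j <;> simp
  · rw [hL, mul_snd]
    fin_cases i <;> fin_cases j <;> simp

theorem decomp (x : Albert) : x = (x.1 0 • E 0 + x.1 1 • E 1 + x.1 2 • E 2) +
    (iota 0 (x.2 0) + iota 1 (x.2 1) + iota 2 (x.2 2)) := by
  refine ext' (fun j => ?_) (fun j => ?_)
  · fin_cases j <;> simp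
  · fin_cases j <;> simp

/-- Derivations take values in the elements of trace zero. -/
theorem tr_der (d : Der) (x : Albert) : tr ((d : Module.End ℝ Albert) x) = 0 := by
  obtain ⟨d, hd⟩ := d
  have hd' : ∀ x y, d (L x y) = L (d x) y + L x (d y) := hd
  have hE : ∀ i, tr (d (E i)) = 0 := by
    intro i
    have h := hd' (E i) (E i)
    rw [L_E_E, L_comm (d (E i))] at h
    have h0 : ∀ j, (d (E i)).1 j = 0 := by
      intro j
      have hj := congrArg (fun w : Albert => w.1 j) h
      have hL : ∀ a b, L a b = mul a b := fun _ _ => rfl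
      simp only [add_fst, hL, mul_fst] at hj
      by_cases hij : j = i
      · subst hij
        simp at hj
        exact hj
      · simp [hij] at hj
        exact hj
    simp [tr_apply, h0]
  have hI : ∀ i u, tr (d (iota i u)) = 0 := by
    intro i u
    have h : iota i u = (4 : ℝ) • (L (L (E (i + 1)) (E (i + 1))) (iota i u)
        - L (E (i + 1)) (L (E (i + 1)) (iota i u))) := by
      rw [L_E_E, L_E_iota, map_smul, L_E_iota]
      module
    rw [h]
    simp only [map_smul, map_sub, hd', map_add, LinearMap.add_apply, tr_assoc]
    rw [smul_eq_mul]
    ring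
  change tr (d x) = 0
  rw [decomp x]
  simp only [map_add, map_smul, hE, hI]
  simp

end Albert

/-! ### The Lie algebra `Der(A) ⊕ A₀` -/

open Albert

/-- The vector space `Der(A) ⊕ A₀`. -/
def LieE : Type := Der × A0

namespace LieE

instance : AddCommGroup LieE := inferInstanceAs (AddCommGroup (Der × A0))
instance : Module ℝ LieE := inferInstanceAs (Module ℝ (Der × A0))
instance : Module.Finite ℝ LieE := inferInstanceAs (Module.Finite ℝ (Der × A0))

/-- The action of a derivation on `A₀`. -/
def act (d : Der) (x : A0) : A0 := ⟨(d : Module.End ℝ Albert) x, tr_der d x⟩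

/-- `[d + x, d' + x'] = ([d, d'] + [l_x, l_{x'}]) + (d(x') - d'(x))`. -/
instance : Bracket LieE LieE :=
  ⟨fun a b => (⁅a.1, b.1⁆ + ⟨⁅L a.2, L b.2⁆, lie_L_mem a.2 b.2⟩, act a.1 b.2 - act b.1 a.2)⟩

/-- The faithful representation `d + x ↦ d + l_x` on the Albert algebra. -/
def toEnd : LieE →ₗ[ℝ] Module.End ℝ Albert where
  toFun a := (a.1 : Module.End ℝ Albert) + L a.2
  map_add' a b := by
    change ((a.1 + b.1 : Der) : Module.End ℝ Albert) + L ((a.2 + b.2 : A0) : Albert) = _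
    have h : ((a.1 + b.1 : Der) : Module.End ℝ Albert) = a.1 + b.1 := rfl
    rw [h, Submodule.coe_add, map_add]
    abel
  map_smul' r a := by
    change ((r • a.1 : Der) : Module.End ℝ Albert) + L ((r • a.2 : A0) : Albert) = _
    have h : ((r • a.1 : Der) : Module.End ℝ Albert) = r • (a.1 : Module.End ℝ Albert) := rfl
    rw [h, Submodule.coe_smul, map_smul, RingHom.id_apply, smul_add]

theorem toEnd_apply (a : LieE) : toEnd a = (a.1 : Module.End ℝ Albert) + L a.2 := rfl

theorem toEnd_injective : Function.Injective toEnd := by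
  rw [← LinearMap.ker_eq_bot, LinearMap.ker_eq_bot']
  intro a ha
  have h1 : (a.2 : Albert) = 0 := by
    have := LinearMap.congr_fun ha 1
    rwa [toEnd_apply, LinearMap.add_apply, der_one, L_one, zero_add] at this
  rw [toEnd_apply, h1, map_zero, add_zero] at ha
  exact Prod.ext (Subtype.ext ha) (Subtype.ext h1)

theorem toEnd_lie (a b : LieE) : toEnd ⁅a, b⁆ = ⁅toEnd a, toEnd b⁆ := by
  have h : toEnd ⁅a, b⁆ = (⁅(a.1 : Module.End ℝ Albert), (b.1 : Module.End ℝ Albert)⁆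
      + ⁅L a.2, L b.2⁆) + L ((a.1 : Module.End ℝ Albert) b.2 - (b.1 : Module.End ℝ Albert) a.2) :=
    rfl
  rw [h, map_sub, ← der_L, ← der_L, toEnd_apply, toEnd_apply, add_lie, lie_add, lie_add,
    ← lie_skew (L a.2 : Module.End ℝ Albert) (b.1 : Module.End ℝ Albert)]
  abel

instance : LieRing LieE where
  add_lie a b c := toEnd_injective (by simp only [toEnd_lie, map_add, add_lie])
  lie_add a b c := toEnd_injective (by simp only [toEnd_lie, map_add, lie_add])
  lie_self a := toEnd_injective (by simp only [toEnd_lie, lie_self, map_zero])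
  leibniz_lie a b c := toEnd_injective (by
    simp only [toEnd_lie, map_add]
    exact leibniz_lie _ _ _)

instance : LieAlgebra ℝ LieE where
  lie_smul r a b := toEnd_injective (by simp only [toEnd_lie, map_smul, lie_smul])

/-- The subalgebra `t = Der(A)`. -/
def tSub : LieSubalgebra ℝ LieE where
  carrier := {a | a.2 = 0}
  zero_mem' := rfl
  add_mem' := by
    intro a b (ha : a.2 = 0) (hb : b.2 = 0)
    change a.2 + b.2 = 0
    rw [ha, hb, add_zero]
  smul_mem' := by
    intro r a (ha : a.2 = 0)
    change r • a.2 = 0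
    rw [ha, smul_zero]
  lie_mem' := by
    intro a b (ha : a.2 = 0) (hb : b.2 = 0)
    change act a.1 b.2 - act b.1 a.2 = 0
    rw [ha, hb]
    apply Subtype.ext
    simp [act]

/-- The subspace `p = A₀`. -/
def pSub : Submodule ℝ LieE where
  carrier := {a | a.1 = 0}
  zero_mem' := rfl
  add_mem' := by
    intro a b (ha : a.1 = 0) (hb : b.1 = 0)
    change a.1 + b.1 = 0
    rw [ha, hb, add_zero]
  smul_mem' := by
    intro r a (ha : a.1 = 0)
    change r • a.1 = 0
    rw [ha, smul_zero]

/-- The inclusion of `Der(A)`. -/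
def ofDer : Der →ₗ[ℝ] LieE := LinearMap.inl ℝ Der A0

/-- The inclusion of `A₀`. -/
def ofA0 : A0 →ₗ[ℝ] LieE := LinearMap.inr ℝ Der A0

theorem E_sub_mem (i j : Fin 3) : E i - E j ∈ A0 := by
  change tr (E i - E j) = 0
  rw [map_sub, tr_apply, tr_apply]
  fin_cases i <;> fin_cases j <;> simp

/-- The elements `h₁, …, h₆`: `h₁ = ρ(t_{1,i})/2`, `h₂ = ρ(t_{j,k})/2`, `h₃ = ρ(t_{l,il})/2`,
`h₄ = ρ(t_{jl,kl})/2`, `h₅ = E₂ - E₀`, `h₆ = E₀ - E₁`. -/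
def h : Fin 6 → LieE :=
  ![ofDer ((1 / 2 : ℝ) • rho ⟨t (e 0) (e 1), t_mem _ _⟩),
    ofDer ((1 / 2 : ℝ) • rho ⟨t (e 2) (e 3), t_mem _ _⟩),
    ofDer ((1 / 2 : ℝ) • rho ⟨t (e 4) (e 5), t_mem _ _⟩),
    ofDer ((1 / 2 : ℝ) • rho ⟨t (e 6) (e 7), t_mem _ _⟩),
    ofA0 ⟨E 2 - E 0, E_sub_mem 2 0⟩,
    ofA0 ⟨E 0 - E 1, E_sub_mem 0 1⟩]

/-- The subspace `a = ⟨E₀ - E₁, E₂ - E₀⟩` of `p`. -/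
def aSub : Submodule ℝ LieE :=
  Submodule.span ℝ {ofA0 ⟨E 0 - E 1, E_sub_mem 0 1⟩, ofA0 ⟨E 2 - E 0, E_sub_mem 2 0⟩}

/-- The Lie subalgebra generated by `h₁, …, h₆`. -/
def hSub : LieSubalgebra ℝ LieE := LieSubalgebra.lieSpan ℝ LieE (Set.range h)

theorem h_mem (k : Fin 6) : h k ∈ hSub := LieSubalgebra.subset_lieSpan ⟨k, rfl⟩

theorem aSub_le : aSub ≤ hSub.toSubmodule := by
  refine Submodule.span_le.2 ?_
  rintro x (rfl | rfl)
  · exact h_mem 5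
  · exact h_mem 4

/-- The point `w₅ h₅ + w₆ h₆` of `a`. -/
def aPt (w₅ w₆ : ℝ) : aSub :=
  w₅ • ⟨h 4, Submodule.subset_span (Or.inr rfl)⟩ + w₆ • ⟨h 5, Submodule.subset_span (Or.inl rfl)⟩

end LieE

/-! ### Real forms, Cartan decompositions, restricted roots -/

section General

/-- The complexification of a Lie subalgebra. -/
def complexify {g : Type*} [LieRing g] [LieAlgebra ℝ g] (k : LieSubalgebra ℝ g) :
    LieSubalgebra ℂ (ℂ ⊗[ℝ] g) where
  __ := k.toSubmodule.baseChange ℂ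
  lie_mem' := by
    intro x y hx hy
    change x ∈ k.toSubmodule.baseChange ℂ at hx
    change y ∈ k.toSubmodule.baseChange ℂ at hy
    change ⁅x, y⁆ ∈ k.toSubmodule.baseChange ℂ
    rw [Submodule.baseChange_eq_span] at hx
    induction hx using Submodule.span_induction with
    | zero => rw [zero_lie]; exact zero_mem _
    | add a b _ _ ha hb => rw [add_lie]; exact add_mem ha hb
    | smul c a _ ha => rw [smul_lie]; exact Submodule.smul_mem _ c ha
    | mem x hx =>
      rw [Submodule.baseChange_eq_span] at hy
      induction hy using Submodule.span_induction with
      | zero => rw [show ⁅x, (0 : ℂ ⊗[ℝ] g)⁆ = 0 from lie_zero x]; exact zero_mem _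
      | add a b _ _ ha hb =>
        rw [show ⁅x, a + b⁆ = ⁅x, a⁆ + ⁅x, b⁆ from lie_add x a b]; exact add_mem ha hb
      | smul c a _ ha =>
        rw [show ⁅x, c • a⁆ = c • ⁅x, a⁆ from lie_smul c x a]; exact Submodule.smul_mem _ c ha
      | mem y hy =>
        obtain ⟨x, hx, rfl⟩ := hx
        obtain ⟨y, hy, rfl⟩ := hy
        exact Submodule.tmul_mem_baseChange_of_mem _ (k.lie_mem hx hy)

theorem tmul_mem_complexify {g : Type*} [LieRing g] [LieAlgebra ℝ g] {k : LieSubalgebra ℝ g}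
    {x : g} (hx : x ∈ k) : (1 : ℂ) ⊗ₜ[ℝ] x ∈ complexify k :=
  Submodule.tmul_mem_baseChange_of_mem (1 : ℂ) hx

/-- `u` is a real form of the complexification of `g`: the latter is `u ⊕ i u`. -/
def IsRealForm {g : Type*} [LieRing g] [LieAlgebra ℝ g] (u : LieSubalgebra ℝ (ℂ ⊗[ℝ] g)) : Prop :=
  IsCompl u.toSubmodule
    (u.toSubmodule.map (DistribSMul.toLinearMap ℝ (ℂ ⊗[ℝ] g) Complex.I))

/-- A real Lie algebra is compact if its Killing form is negative definite. -/
def IsCompactLie (u : Type*) [LieRing u] [LieAlgebra ℝ u] : Prop :=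
  ∀ x : u, x ≠ 0 → killingForm ℝ u x x < 0

/-- `g = t ⊕ p` is a Cartan decomposition: there is a compact real form `u` of the complexification
with `t = g ∩ u` and `p = g ∩ i u`. -/
structure IsCartanDecomposition {g : Type*} [LieRing g] [LieAlgebra ℝ g]
    (t : LieSubalgebra ℝ g) (p : Submodule ℝ g) : Prop where
  isCompl : IsCompl t.toSubmodule p
  exists_compact : ∃ u : LieSubalgebra ℝ (ℂ ⊗[ℝ] g), IsRealForm u ∧ IsCompactLie u ∧
    (∀ x : g, x ∈ t ↔ (1 : ℂ) ⊗ₜ[ℝ] x ∈ u) ∧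
    (∀ x : g, x ∈ p ↔ ∃ y ∈ u, (1 : ℂ) ⊗ₜ[ℝ] x = Complex.I • y)

/-- The signature of the Killing form of a real Lie algebra. -/
def killingSignature (g : Type*) [LieRing g] [LieAlgebra ℝ g] : ℤ :=
  (sigPos (killingForm ℝ g).toQuadraticMap : ℤ)
    - sigNeg (killingForm ℝ g).toQuadraticMap

/-- A complex Lie algebra is semisimple with root system (relative to some Cartan subalgebra) of
Cartan matrix `A`, up to the numbering of the simple roots. -/
def HasCartanType {n : ℕ} (g : Type*) [LieRing g] [LieAlgebra ℂ g] [FiniteDimensional ℂ g]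
    (A : Matrix (Fin n) (Fin n) ℤ) : Prop :=
  ∃ (_ : LieAlgebra.IsKilling ℂ g) (H : LieSubalgebra ℂ g) (_ : H.IsCartanSubalgebra)
    (b : (LieAlgebra.IsKilling.rootSystem H).Base) (f : Fin n ≃ b.support),
    ∀ i j, b.cartanMatrix (f i) (f j) = A i j

/-- `a` is a maximal abelian subspace of `p`. -/
def IsMaximalAbelianIn {g : Type*} [LieRing g] [LieAlgebra ℝ g] (p a : Submodule ℝ g) : Prop :=
  Maximal (fun c : Submodule ℝ g => c ≤ p ∧ ∀ x ∈ c, ∀ y ∈ c, ⁅x, y⁆ = 0) a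

/-- `k` is a maximal abelian subalgebra. -/
def IsMaximalAbelian {g : Type*} [LieRing g] [LieAlgebra ℝ g] (k : LieSubalgebra ℝ g) : Prop :=
  Maximal (fun c : LieSubalgebra ℝ g => ∀ x ∈ c, ∀ y ∈ c, ⁅x, y⁆ = 0) k

/-- `g_λ = {x | [h, x] = λ(h) x for all h ∈ a}`. -/
def restrictedRootSpace {g : Type*} [LieRing g] [LieAlgebra ℝ g] (a : Submodule ℝ g)
    (l : Module.Dual ℝ a) : Submodule ℝ g where
  carrier := {x | ∀ y : a, ⁅(y : g), x⁆ = l y • x}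
  zero_mem' := by intro y; simp
  add_mem' := by
    intro x x' hx hx' y
    rw [lie_add, hx y, hx' y, smul_add]
  smul_mem' := by
    intro r x hx y
    rw [lie_smul, hx y, smul_comm]

/-- The set of restricted roots. -/
def restrictedRoots {g : Type*} [LieRing g] [LieAlgebra ℝ g] (a : Submodule ℝ g) :
    Set (Module.Dual ℝ a) :=
  {l | l ≠ 0 ∧ restrictedRootSpace a l ≠ ⊥}

/-- The multiplicity `m_λ = dim g_λ`. -/
def rootMultiplicity {g : Type*} [LieRing g] [LieAlgebra ℝ g] (a : Submodule ℝ g)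
    (l : Module.Dual ℝ a) : ℕ :=
  Module.finrank ℝ (restrictedRootSpace a l)

/-- The subset `Φ` of `V` is a reduced crystallographic root system in `V`, and `B` is a base of it
with Cartan matrix `A`. -/
def IsRootSystemWithBase {n : ℕ} {V : Type*} [AddCommGroup V] [Module ℝ V] (Φ : Set V)
    (B : Fin n → V) (A : Matrix (Fin n) (Fin n) ℤ) : Prop :=
  ∃ P : RootPairing Φ ℝ V (Module.Dual ℝ V), P.toLinearMap = Module.Dual.eval ℝ V ∧
    P.IsRootSystem ∧ P.IsCrystallographic ∧ P.IsReduced ∧ (∀ i, P.root i = i) ∧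
    ∃ (b : P.Base) (f : Fin n ≃ b.support), (∀ i, P.root (f i) = B i) ∧
      ∀ i j, P.pairing (f i) (f j) = A i j

/-! ### Satake diagrams -/

/-- A Satake diagram with nodes `ι`: a Dynkin diagram, given by its Cartan matrix, the set of black
nodes, and the relation that two nodes are joined by an arrow. -/
@[ext] structure SatakeDiagram (ι : Type*) where
  cartanMatrix : Matrix ι ι ℤ
  black : Set ι
  arrow : ι → ι → Prop

/-- The restriction to `a` of a functional on the complexification of `k ⊇ a`. -/
def restrict {g : Type*} [LieRing g] [LieAlgebra ℝ g] {a : Submodule ℝ g} {k : LieSubalgebra ℝ g}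
    (hak : a ≤ k.toSubmodule) (α : Module.Dual ℂ (complexify k)) : a →ₗ[ℝ] ℂ where
  toFun x := α ⟨(1 : ℂ) ⊗ₜ[ℝ] (x : g), tmul_mem_complexify (hak x.2)⟩
  map_add' x y := by
    rw [← map_add]
    congr 1
    exact Subtype.ext (TensorProduct.tmul_add _ _ _)
  map_smul' r x := by
    rw [RingHom.id_apply, Complex.real_smul, ← smul_eq_mul, ← map_smul]
    congr 1
    refine Subtype.ext ?_
    change (1 : ℂ) ⊗ₜ[ℝ] (r • (x : g)) = (r : ℂ) • ((1 : ℂ) ⊗ₜ[ℝ] (x : g))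
    rw [TensorProduct.tmul_smul, TensorProduct.smul_tmul', TensorProduct.smul_tmul']
    simp

open LieAlgebra.IsKilling in
/-- The base `b` is adapted to `a`: with `B₀` the simple roots that vanish on `a`, every root that
vanishes on `a` is plus or minus a sum of elements of `B₀`. -/
def IsAdaptedBase {g : Type*} [LieRing g] [LieAlgebra ℝ g] [FiniteDimensional ℂ (ℂ ⊗[ℝ] g)]
    [LieAlgebra.IsKilling ℂ (ℂ ⊗[ℝ] g)] {a : Submodule ℝ g} {k : LieSubalgebra ℝ g}
    [(complexify k).IsCartanSubalgebra] (hak : a ≤ k.toSubmodule)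
    (b : (rootSystem (complexify k)).Base) : Prop :=
  ∀ i, restrict hak ((rootSystem (complexify k)).root i) = 0 →
    (rootSystem (complexify k)).root i ∈ AddSubmonoid.closure
      ((rootSystem (complexify k)).root ''
        {j | j ∈ b.support ∧ restrict hak ((rootSystem (complexify k)).root j) = 0}) ∨
    -(rootSystem (complexify k)).root i ∈ AddSubmonoid.closure
      ((rootSystem (complexify k)).root ''
        {j | j ∈ b.support ∧ restrict hak ((rootSystem (complexify k)).root j) = 0})

open LieAlgebra.IsKilling in
/-- The Satake diagram of `g` with respect to `a ⊆ k` and a base `b`, whose elements are numbered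
by `f`: the Dynkin diagram of `b`; black nodes are the simple roots that vanish on `a`; two
different white nodes are joined by an arrow if their restrictions to `a` agree. -/
def satakeDiagram {g : Type*} [LieRing g] [LieAlgebra ℝ g] [FiniteDimensional ℂ (ℂ ⊗[ℝ] g)]
    [LieAlgebra.IsKilling ℂ (ℂ ⊗[ℝ] g)] {a : Submodule ℝ g} {k : LieSubalgebra ℝ g}
    [(complexify k).IsCartanSubalgebra] (hak : a ≤ k.toSubmodule)
    (b : (rootSystem (complexify k)).Base) {ι : Type*} (f : ι ≃ b.support) :
    SatakeDiagram ι where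
  cartanMatrix := Matrix.of fun i j => b.cartanMatrix (f i) (f j)
  black := {i | restrict hak ((rootSystem (complexify k)).root (f i)) = 0}
  arrow i j := i ≠ j ∧ restrict hak ((rootSystem (complexify k)).root (f i)) ≠ 0 ∧
    restrict hak ((rootSystem (complexify k)).root (f j)) ≠ 0 ∧
    restrict hak ((rootSystem (complexify k)).root (f i)) =
      restrict hak ((rootSystem (complexify k)).root (f j))

end General

/-! ### The explicit data -/

/-- The element `∑ w_k h_k` of the complexification of the subalgebra `hSub`. -/
def hPt (w : Fin 6 → ℂ) : complexify LieE.hSub :=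
  ∑ k, w k • ⟨(1 : ℂ) ⊗ₜ[ℝ] LieE.h k, tmul_mem_complexify (LieE.h_mem k)⟩

/-- The simple roots `α₁, …, α₆` as functions of the coordinates `w₁, …, w₆`. -/
def simpleRoot : Fin 6 → (Fin 6 → ℂ) → ℂ :=
  ![fun w => 1 / 2 * (-Complex.I * w 0 - Complex.I * w 1 - Complex.I * w 2 - Complex.I * w 3
      + w 4 - 2 * w 5),
    fun w => Complex.I * (-w 0 + w 1),
    fun w => Complex.I * (w 0 + w 1),
    fun w => Complex.I * (-w 1 + w 2),
    fun w => Complex.I * (-w 2 + w 3),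
    fun w => 1 / 2 * (-2 * Complex.I * w 3 + w 4 + w 5)]

/-- The roots as functions of the coordinates `w₁, …, w₆`. -/
def rootFunctions : Set ((Fin 6 → ℂ) → ℂ) :=
  {φ | ∃ (j k : Fin 4) (s s' : ℤˣ), j ≠ k ∧
      φ = fun w => Complex.I * (((s : ℤ) : ℂ) * w (j.castAdd 2) + ((s' : ℤ) : ℂ) * w (k.castAdd 2))} ∪
  {φ | ∃ (j : Fin 4) (s s' : ℤˣ),
      φ = fun w => ((s : ℤ) : ℂ) * Complex.I * w (j.castAdd 2) + ((s' : ℤ) : ℂ) * ((w 4 + w 5) / 2)} ∪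
  {φ | ∃ (ε : Fin 4 → ℤˣ) (s : ℤˣ), ∏ j, ε j = -1 ∧
      φ = fun w => 1 / 2 * (Complex.I * ∑ j, ((ε j : ℤ) : ℂ) * w (j.castAdd 2)
        + ((s : ℤ) : ℂ) * (2 * w 4 - w 5))} ∪
  {φ | ∃ (ε : Fin 4 → ℤˣ) (s : ℤˣ), ∏ j, ε j = 1 ∧
      φ = fun w => 1 / 2 * (Complex.I * ∑ j, ((ε j : ℤ) : ℂ) * w (j.castAdd 2)
        + ((s : ℤ) : ℂ) * (w 4 - 2 * w 5))}

/-- The Satake diagram with Dynkin diagram `E₆`, nodes `α₂, …, α₅` black, `α₁, α₆` white, and no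
arrows. Nodes are counted from zero. -/
def satakeEIV : SatakeDiagram (Fin 6) where
  cartanMatrix := CartanMatrix.E₆
  black := {1, 2, 3, 4}
  arrow _ _ := False

/-- The map from `A₍₁,₁,₁₎(pO)` to `3 × 3` octonion matrices that sends
`(α₀, α₁, α₂) + ι₀(x) + ι₁(y) + ι₂(z)` to
`!![α₀, 2 z̄, 2 y; 2 z, α₁, 2 x̄; 2 ȳ, 2 x, α₂]`. -/
def toMatrix (A : Albert) : Matrix (Fin 3) (Fin 3) Octonion :=
  !![A.1 0 • e 0, (2 : ℝ) • star (A.2 2), (2 : ℝ) • A.2 1;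
     (2 : ℝ) • A.2 2, A.1 1 • e 0, (2 : ℝ) • star (A.2 0);
     (2 : ℝ) • star (A.2 1), (2 : ℝ) • A.2 0, A.1 2 • e 0]

/-- The hermitian octonion matrices `X = X̄ᵗ`. -/
def hermitian : Set (Matrix (Fin 3) (Fin 3) Octonion) := {X | X.conjTranspose = X}

end E626

end

open E626

open scoped TensorProduct Quaternion

noncomputable section

namespace E626

attribute [local instance] LieRing.ofAssociativeRing

/-! The representation `d + x ↦ d + l_x` of `g` on `A` is faithful, and for the positive definite
form `tr(xy)` derivations are skew (they take values in trace zero) while multiplications are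
symmetric (the trace form is associative). Its trace form `repForm` is therefore negative on `t` and
positive on `p`. Reversing the sign on `t` gives an inner product `innerForm` on `g` for which `ad
t` is skew and `ad p` symmetric. Since `g` has trivial centre, `trace_sq_pos` applied to `ad x`
yields the signs of the Killing form, hence the signature and nondegeneracy. The real form `t + i p`
is compact because `-Re κ` is an invariant inner product on it.

The structure of `Der(A)` comes from Peirce theory. A derivation killing the idempotents preserves
the three spaces `ι_i(pO)` and is a triality triple (`der_eq_rhoEnd`); an arbitrary one is brought
to this case by subtracting some `∑ ρ(ι_i(u_i))`. By local triality (`tri_eq_zero`) a triple is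
determined by its first component, so `tri` is `so(8)`, and `dim Der(A) = 28 + 24`.

The elements `h₁, …, h₄` rotate the planes spanned by `ev m`, `od m` in each of the three copies of
the octonions, with the vector and the two half-spin weights (`wt`). A diagonal element of `a`
exchanges `ρ(ι_i(u))` and `ι_i(u)` up to a scalar, so that `ρ(ι_i(u)) ± ι_i(u)` are eigenvectors.
Hence `g` is spanned by the `h_k` and by real planes `⟨X, Y⟩` such that `X + i Y` is a common
eigenvector, and `range_root_eq_of_planes` reads off all roots: independence of weight spaces leaves
no room for others. The `h_k` form a self-centralizing torus of semisimple elements, so they span a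
Cartan subalgebra.

After doubling coordinates the roots are integer vectors, and what remains is finite: every root is
a nonnegative or nonpositive combination of the simple ones, and Cartan integers are lengths of root
strings. `exists_base_of_simple` turns such a check into a base with the given Cartan matrix; it is
used for `E₆`, for `F₄` (the same construction inside `t`), and for the restricted `A₂`.

Restriction to `a` keeps the last two coordinates. They vanish exactly on the roots without `α₁` and
`α₆`, which gives the adapted base and the colours. The restricted root spaces are the
eight-dimensional graphs `{ρ(ι_i(x)) ± ι_i(x)}`. The identification with hermitian matrices is an
entrywise computation whose only input is the polarized norm identity `x̄ y + ȳ x = q(x, y)`. -/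

/-! ### Definite forms and the Killing form -/

/-- If `T` is self-adjoint (`ε = 1`) or skew-adjoint (`ε = -1`) for a definite form, then the trace
of `T²` has the sign of `ε`. -/
theorem trace_sq_pos {V : Type*} [AddCommGroup V] [Module ℝ V] [FiniteDimensional ℝ V]
    (B : LinearMap.BilinForm ℝ V) (symm : ∀ x y, B x y = B y x) (pos : ∀ x, x ≠ 0 → 0 < B x x)
    {ε : ℝ} (hε : ε * ε = 1) {T : Module.End ℝ V} (hT : ∀ x y, B (T x) y = ε * B x (T y))
    (hne : T ≠ 0) : 0 < ε * LinearMap.trace ℝ V (T ∘ₗ T) := by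
  obtain ⟨b, hb⟩ := LinearMap.BilinForm.exists_orthogonal_basis (B := B) ⟨symm⟩
  have hb' : ∀ i j, i ≠ j → B (b i) (b j) = 0 := fun i j hij => hb hij
  have hrep : ∀ x i, b.repr x i = B x (b i) / B (b i) (b i) := by
    intro x i
    rw [eq_div_iff (pos _ (b.ne_zero i)).ne']
    conv_rhs => rw [← b.sum_repr x]
    rw [map_sum, LinearMap.sum_apply, Finset.sum_eq_single i]
    · simp
    · intro j _ hj
      simp [hb' j i hj]
    · simp
  -- In an orthogonal basis the diagonal entry of `T²` at `i` is `B (T² bᵢ) bᵢ / B bᵢ bᵢ`. Moving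
  -- one `T` across the form costs `ε`, which the prefactor cancels, so a sum of quotients of
  -- squared lengths remains.
  have htr : ε * LinearMap.trace ℝ V (T ∘ₗ T)
      = ∑ i, B (T (b i)) (T (b i)) / B (b i) (b i) := by
    rw [LinearMap.trace_eq_matrix_trace ℝ b, Matrix.trace, Finset.mul_sum]
    refine Finset.sum_congr rfl fun i _ => ?_
    rw [Matrix.diag_apply, LinearMap.toMatrix_apply, hrep, LinearMap.comp_apply, hT,
      ← mul_div_assoc, ← mul_assoc, hε, one_mul]
  have hnn : ∀ x, 0 ≤ B x x := fun x => by
    rcases eq_or_ne x 0 with rfl | hx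
    · simp
    · exact (pos x hx).le
  rw [htr]
  obtain ⟨i, hi⟩ : ∃ i, T (b i) ≠ 0 := by
    by_contra! h
    exact hne (b.ext fun i => by simp [h i])
  exact Finset.sum_pos' (fun i _ => div_nonneg (hnn _) (hnn _))
    ⟨i, Finset.mem_univ _, div_pos (pos _ hi) (pos _ (b.ne_zero i))⟩

theorem isKilling_of_forall {g : Type*} [LieRing g] [LieAlgebra ℝ g]
    (h : ∀ x : g, (∀ y, killingForm ℝ g x y = 0) → x = 0) :
    LieAlgebra.IsKilling ℝ g := by
  refine ⟨?_⟩
  rw [eq_bot_iff]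
  intro x hx
  rw [LieSubmodule.mem_bot]
  refine h x fun y => ?_
  rw [LieIdeal.mem_killingCompl] at hx
  rw [LieModule.traceForm_comm]
  exact hx y (LieSubmodule.mem_top _)

section

variable {g : Type*} [LieRing g] [LieAlgebra ℝ g] [FiniteDimensional ℝ g]

/-- If the adjoint operator of `x ≠ 0` is self-adjoint (`ε = 1`) or skew-adjoint (`ε = -1`) for a
definite form, then `κ(x, x)` has the sign of `ε`. -/
theorem killingForm_pos (B : LinearMap.BilinForm ℝ g) (symm : ∀ x y, B x y = B y x)
    (pos : ∀ x, x ≠ 0 → 0 < B x x) (center : ∀ x : g, (∀ y : g, ⁅x, y⁆ = 0) → x = 0)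
    {ε : ℝ} (hε : ε * ε = 1) {x : g} (hx : x ≠ 0)
    (hB : ∀ y z, B ⁅x, y⁆ z = ε * B y ⁅x, z⁆) : 0 < ε * killingForm ℝ g x x := by
  rw [killingForm_apply_apply]
  refine trace_sq_pos B symm pos hε hB fun h => hx (center x fun y => ?_)
  simpa using LinearMap.congr_fun h y

/-- A Lie algebra with trivial centre and an invariant definite form is compact. -/
theorem killingForm_neg_of_invariant (B : LinearMap.BilinForm ℝ g) (symm : ∀ x y, B x y = B y x)
    (pos : ∀ x, x ≠ 0 → 0 < B x x) (center : ∀ x : g, (∀ y : g, ⁅x, y⁆ = 0) → x = 0)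
    (hB : ∀ x y z : g, B ⁅x, y⁆ z = - B y ⁅x, z⁆) : IsCompactLie g := by
  intro x hx
  have := killingForm_pos B symm pos center (ε := -1) (by norm_num) hx
    (fun y z => by rw [hB]; ring)
  linarith

end

/-! ### Complexification and the compact real form `t + i p`. -/

section Complexification

variable {g : Type*} [LieRing g] [LieAlgebra ℝ g]

/-- The element `x + i y` of the complexification. -/
def cpl {V : Type*} [AddCommGroup V] [Module ℝ V] (x y : V) : ℂ ⊗[ℝ] V :=
  (1 : ℂ) ⊗ₜ[ℝ] x + Complex.I ⊗ₜ[ℝ] y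

theorem exists_cpl {V : Type*} [AddCommGroup V] [Module ℝ V] (z : ℂ ⊗[ℝ] V) :
    ∃ x y, z = cpl x y := by
  induction z using TensorProduct.induction_on with
  | zero => exact ⟨0, 0, by simp [cpl]⟩
  | tmul c v =>
    refine ⟨c.re • v, c.im • v, ?_⟩
    rw [cpl, TensorProduct.tmul_smul, TensorProduct.tmul_smul, TensorProduct.smul_tmul',
      TensorProduct.smul_tmul', ← TensorProduct.add_tmul]
    congr 1
    apply Complex.ext <;> simp
  | add z w hz hw =>
    obtain ⟨x, y, rfl⟩ := hz
    obtain ⟨x', y', rfl⟩ := hw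
    exact ⟨x + x', y + y', by simp only [cpl, TensorProduct.tmul_add]; abel⟩

/-- Tensoring the real maps `re` and `im` with `V` extracts the two components. -/
theorem cpl_eq_zero {V : Type*} [AddCommGroup V] [Module ℝ V] {x y : V} (h : cpl x y = 0) :
    x = 0 ∧ y = 0 := by
  have h1 := congrArg (TensorProduct.lid ℝ V ∘ (Complex.reLm.rTensor V)) h
  have h2 := congrArg (TensorProduct.lid ℝ V ∘ (Complex.imLm.rTensor V)) h
  simp [cpl] at h1 h2
  exact ⟨h1, h2⟩

theorem cpl_inj {V : Type*} [AddCommGroup V] [Module ℝ V] {x y x' y' : V}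
    (h : cpl x y = cpl x' y') : x = x' ∧ y = y' := by
  have : cpl (x - x') (y - y') = 0 := by
    have h' := sub_eq_zero.2 h
    rw [← h']
    simp only [cpl, TensorProduct.tmul_sub]
    abel
  obtain ⟨h1, h2⟩ := cpl_eq_zero this
  exact ⟨sub_eq_zero.1 h1, sub_eq_zero.1 h2⟩

theorem I_smul_cpl {V : Type*} [AddCommGroup V] [Module ℝ V] (x y : V) :
    Complex.I • cpl x y = cpl (-y) x := by
  rw [cpl, cpl, smul_add, TensorProduct.smul_tmul', TensorProduct.smul_tmul', smul_eq_mul,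
    smul_eq_mul, mul_one, Complex.I_mul_I, TensorProduct.neg_tmul, TensorProduct.tmul_neg]
  abel

theorem lie_cpl (x y x' y' : g) : ⁅cpl x y, cpl x' y'⁆ =
    cpl (⁅x, x'⁆ - ⁅y, y'⁆) (⁅x, y'⁆ + ⁅y, x'⁆) := by
  have e : (Complex.I * Complex.I) = -1 := Complex.I_mul_I
  simp only [cpl, add_lie, lie_add, LieAlgebra.ExtendScalars.bracket_tmul, e, mul_one, one_mul,
    TensorProduct.neg_tmul, TensorProduct.tmul_add, TensorProduct.tmul_sub]
  abel

theorem tmul_one_eq_cpl {V : Type*} [AddCommGroup V] [Module ℝ V] (x : V) :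
    (1 : ℂ) ⊗ₜ[ℝ] x = cpl x 0 := by simp [cpl]

theorem killingForm_cpl [FiniteDimensional ℝ g] (x y x' y' : g) :
    killingForm ℂ (ℂ ⊗[ℝ] g) (cpl x y) (cpl x' y') =
      ((killingForm ℝ g x x' - killingForm ℝ g y y' : ℝ) : ℂ) +
        Complex.I * ((killingForm ℝ g x y' + killingForm ℝ g y x' : ℝ) : ℂ) := by
  have e : (Complex.I * Complex.I) = -1 := Complex.I_mul_I
  rw [killingForm, LieModule.traceForm_baseChange]
  simp only [cpl, map_add, LinearMap.add_apply, LinearMap.BilinForm.baseChange_tmul]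
  simp [e]
  ring

/-- Pairing `x + i y` with real vectors only already separates `κ(x, ·)` and `κ(y, ·)` as real and
imaginary parts, so nondegeneracy over `ℝ` suffices. -/
theorem isKilling_complexification [FiniteDimensional ℝ g] [LieAlgebra.IsKilling ℝ g] :
    LieAlgebra.IsKilling ℂ (ℂ ⊗[ℝ] g) := by
  have nd : ∀ x : g, (∀ y, killingForm ℝ g x y = 0) → x = 0 := fun x hx =>
    (LieAlgebra.IsKilling.killingForm_nondegenerate ℝ g).1 x hx
  refine ⟨?_⟩
  rw [eq_bot_iff]
  intro z hz
  rw [LieSubmodule.mem_bot]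
  rw [LieIdeal.mem_killingCompl] at hz
  obtain ⟨x, y, rfl⟩ := exists_cpl z
  have key : ∀ w, killingForm ℝ g x w = 0 ∧ killingForm ℝ g y w = 0 := by
    intro w
    have h := hz (cpl w 0) (LieSubmodule.mem_top _)
    rw [killingForm_cpl, LieModule.traceForm_comm ℝ g g w x, LieModule.traceForm_comm ℝ g g w y]
      at h
    have h1 := congrArg Complex.re h
    have h2 := congrArg Complex.im h
    simp at h1 h2
    exact ⟨h1, h2⟩
  rw [nd x fun w => (key w).1, nd y fun w => (key w).2]
  simp [cpl]

/-- The real form `t + i p`. -/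
def compactForm (t : LieSubalgebra ℝ g) (p : Submodule ℝ g)
    (htp : ∀ x ∈ t, ∀ y ∈ p, ⁅x, y⁆ ∈ p) (hpp : ∀ x ∈ p, ∀ y ∈ p, ⁅x, y⁆ ∈ t) :
    LieSubalgebra ℝ (ℂ ⊗[ℝ] g) where
  carrier := {z | ∃ x ∈ t, ∃ y ∈ p, z = cpl x y}
  zero_mem' := ⟨0, t.zero_mem, 0, p.zero_mem, by simp [cpl]⟩
  add_mem' := by
    rintro _ _ ⟨x, hx, y, hy, rfl⟩ ⟨x', hx', y', hy', rfl⟩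
    exact ⟨x + x', t.add_mem hx hx', y + y', p.add_mem hy hy', by
      simp only [cpl, TensorProduct.tmul_add]; abel⟩
  smul_mem' := by
    rintro r _ ⟨x, hx, y, hy, rfl⟩
    exact ⟨r • x, t.smul_mem r hx, r • y, p.smul_mem r hy, by
      simp only [cpl, TensorProduct.tmul_smul, smul_add]⟩
  lie_mem' := by
    rintro _ _ ⟨x, hx, y, hy, rfl⟩ ⟨x', hx', y', hy', rfl⟩
    refine ⟨_, t.sub_mem (t.lie_mem hx hx') (hpp y hy y' hy'), _,
      p.add_mem (htp x hx y' hy') ?_, lie_cpl x y x' y'⟩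
    rw [← lie_skew]
    exact p.neg_mem (htp x' hx' y hy)

theorem killingForm_lie {L : Type*} {R : Type*} [CommRing R] [LieRing L] [LieAlgebra R L]
    (x y z : L) : killingForm R L ⁅x, y⁆ z = - killingForm R L y ⁅x, z⁆ := by
  rw [← lie_skew, map_neg, LinearMap.neg_apply, LieModule.traceForm_apply_lie_apply]

/-- A decomposition as in a symmetric pair, with the Killing form negative definite on `t` and
positive definite on `p`, is a Cartan decomposition. -/
theorem isCartanDecomposition_of_definite [FiniteDimensional ℝ g] [LieAlgebra.IsKilling ℝ g]
    {t : LieSubalgebra ℝ g} {p : Submodule ℝ g} (hc : IsCompl t.toSubmodule p)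
    (htp : ∀ x ∈ t, ∀ y ∈ p, ⁅x, y⁆ ∈ p) (hpp : ∀ x ∈ p, ∀ y ∈ p, ⁅x, y⁆ ∈ t)
    (ht : ∀ x ∈ t, x ≠ 0 → killingForm ℝ g x x < 0)
    (hp : ∀ x ∈ p, x ≠ 0 → 0 < killingForm ℝ g x x) : IsCartanDecomposition t p := by
  have split : ∀ z : g, ∃ x ∈ t, ∃ y ∈ p, x + y = z := fun z =>
    Submodule.mem_sup.1 (hc.sup_eq_top ▸ Submodule.mem_top : z ∈ t.toSubmodule ⊔ p)
  have inter : ∀ z, z ∈ t → z ∈ p → z = 0 := fun z h h' => (Submodule.disjoint_def.1 hc.disjoint) z h h'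
  have mem_u : ∀ x y : g, cpl x y ∈ compactForm t p htp hpp ↔ x ∈ t ∧ y ∈ p := by
    intro x y
    constructor
    · rintro ⟨x', hx', y', hy', h⟩
      obtain ⟨rfl, rfl⟩ := cpl_inj h
      exact ⟨hx', hy'⟩
    · rintro ⟨hx, hy⟩
      exact ⟨x, hx, y, hy, rfl⟩
  have center : ∀ x : g, (∀ y : g, ⁅x, y⁆ = 0) → x = 0 := by
    intro x hx
    refine (LieAlgebra.IsKilling.killingForm_nondegenerate ℝ g).1 x fun y => ?_
    have : LieAlgebra.ad ℝ g x = 0 := LinearMap.ext hx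
    rw [killingForm_apply_apply, this]
    simp
  refine ⟨hc, compactForm t p htp hpp, ⟨?_, ?_⟩, ?_, fun x => ?_, fun x => ?_⟩
  · rw [Submodule.disjoint_def]
    rintro _ ⟨x, hx, y, hy, rfl⟩ ⟨_, ⟨x', hx', y', hy', rfl⟩, h⟩
    have h' : Complex.I • cpl x' y' = cpl x y := h
    rw [I_smul_cpl] at h'
    obtain ⟨rfl, rfl⟩ := cpl_inj h'
    rw [inter _ hx (p.neg_mem hy'), inter _ hx' hy]
    simp [cpl]
  · rw [codisjoint_iff, eq_top_iff]
    intro z _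
    obtain ⟨x, y, rfl⟩ := exists_cpl z
    obtain ⟨a, ha, b, hb, rfl⟩ := split x
    obtain ⟨c, hc, d, hd, rfl⟩ := split y
    refine Submodule.mem_sup.2 ⟨cpl a d, ⟨a, ha, d, hd, rfl⟩, Complex.I • cpl c (-b),
      ⟨_, ⟨c, hc, -b, p.neg_mem hb, rfl⟩, rfl⟩, ?_⟩
    rw [I_smul_cpl]
    simp only [cpl, TensorProduct.tmul_add, neg_neg]
    abel
  · have hsmul : ∀ (r : ℝ) (z : ℂ ⊗[ℝ] g), r • z = (r : ℂ) • z := fun r z =>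
      (algebraMap_smul ℂ r z).symm
    -- On `x + i y` this form takes the value `κ(y, y) - κ(x, x)`, which is positive for nonzero `x
    -- + i y` with `x ∈ t`, `y ∈ p`; invariance is inherited from the complex Killing form.
    let B : LinearMap.BilinForm ℝ (ℂ ⊗[ℝ] g) :=
      LinearMap.mk₂ ℝ (fun z w => -(killingForm ℂ (ℂ ⊗[ℝ] g) z w).re)
        (by intro a b c; simp only [map_add, LinearMap.add_apply, Complex.add_re]; ring)
        (by
          intro r a b
          rw [hsmul, map_smul, LinearMap.smul_apply, smul_eq_mul, Complex.re_ofReal_mul,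
            smul_eq_mul, mul_neg])
        (by intro a b c; simp only [map_add, Complex.add_re]; ring)
        (by
          intro r a b
          rw [hsmul, map_smul, smul_eq_mul, Complex.re_ofReal_mul, smul_eq_mul, mul_neg])
    have hBdef : ∀ z w, B z w = -(killingForm ℂ (ℂ ⊗[ℝ] g) z w).re := fun _ _ => rfl
    have hB : ∀ x y, B (cpl x y) (cpl x y) = killingForm ℝ g y y - killingForm ℝ g x x := by
      intro x y
      rw [hBdef, killingForm_cpl]
      simp
    refine killingForm_neg_of_invariant
      (B.compl₁₂ (compactForm t p htp hpp).toSubmodule.subtype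
        (compactForm t p htp hpp).toSubmodule.subtype) ?_ ?_ ?_ ?_
    · intro z w
      change B (z : ℂ ⊗[ℝ] g) w = B (w : ℂ ⊗[ℝ] g) z
      rw [hBdef, hBdef, LieModule.traceForm_comm]
    · rintro ⟨_, x, hx, y, hy, rfl⟩ hne
      change 0 < B (cpl x y) (cpl x y)
      rw [hB]
      rcases eq_or_ne x 0 with rfl | hx0
      · rcases eq_or_ne y 0 with rfl | hy0
        · exact absurd (Subtype.ext (by simp [cpl])) hne
        · simpa using hp y hy hy0
      · have h1 := ht x hx hx0
        rcases eq_or_ne y 0 with rfl | hy0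
        · simpa using h1
        · have h2 := hp y hy hy0
          linarith
    · rintro ⟨_, x, hx, y, hy, rfl⟩ h
      -- A central element of `u` is tested against `t` and `i p` separately; together these see all
      -- of `g`, so `x` and `y` are both central in `g`.
      have hcomm : ∀ w : g, ⁅x, w⁆ = 0 ∧ ⁅y, w⁆ = 0 := by
        intro w
        obtain ⟨a, ha, b, hb, rfl⟩ := split w
        have h1 := congrArg Subtype.val (h ⟨cpl a 0, (mem_u _ _).2 ⟨ha, p.zero_mem⟩⟩)
        have h2 := congrArg Subtype.val (h ⟨cpl 0 b, (mem_u _ _).2 ⟨t.zero_mem, hb⟩⟩)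
        change ⁅cpl x y, cpl a 0⁆ = 0 at h1
        change ⁅cpl x y, cpl 0 b⁆ = 0 at h2
        rw [lie_cpl] at h1 h2
        have h1' := cpl_eq_zero h1
        have h2' := cpl_eq_zero h2
        simp only [lie_zero, sub_zero, zero_add, add_zero, zero_sub, neg_eq_zero] at h1' h2'
        rw [lie_add, lie_add, h1'.1, h1'.2, h2'.1, h2'.2, add_zero]
        exact ⟨rfl, rfl⟩
      have e1 := center x fun w => (hcomm w).1
      have e2 := center y fun w => (hcomm w).2
      subst e1 e2
      exact Subtype.ext (by simp [cpl])
    · intro z w v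
      change B ⁅(z : ℂ ⊗[ℝ] g), (w : ℂ ⊗[ℝ] g)⁆ v = - B w ⁅(z : ℂ ⊗[ℝ] g), (v : ℂ ⊗[ℝ] g)⁆
      rw [hBdef, hBdef, killingForm_lie]
      simp
  · rw [tmul_one_eq_cpl, mem_u]
    simp
  · constructor
    · intro hx
      refine ⟨cpl 0 (-x), (mem_u _ _).2 ⟨t.zero_mem, p.neg_mem hx⟩, ?_⟩
      rw [I_smul_cpl, tmul_one_eq_cpl, neg_neg]
    · rintro ⟨_, ⟨x', hx', y', hy', rfl⟩, h⟩
      rw [I_smul_cpl, tmul_one_eq_cpl] at h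
      obtain ⟨rfl, -⟩ := cpl_inj h
      exact p.neg_mem hy'

/-- The signature of the Killing form for a definite decomposition. -/
theorem killingSignature_of_definite [FiniteDimensional ℝ g]
    {t p : Submodule ℝ g} (hc : IsCompl t p)
    (ht : ∀ x ∈ t, x ≠ 0 → killingForm ℝ g x x < 0)
    (hp : ∀ x ∈ p, x ≠ 0 → 0 < killingForm ℝ g x x) :
    killingSignature g = (Module.finrank ℝ p : ℤ) - Module.finrank ℝ t := by
  have hdim := Submodule.finrank_add_eq_of_isCompl hc
  set Q := (killingForm ℝ g).toQuadraticMap with hQ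
  have hQa : ∀ x, Q x = killingForm ℝ g x x := fun x => rfl
  have h1 : Module.finrank ℝ p ≤ sigPos Q := le_sigPos_of_posDef Q fun x hx => by
    simpa [hQa] using hp x x.2 (by simpa using hx)
  have h2 : Module.finrank ℝ t ≤ sigNeg Q := le_sigNeg_of_negDef Q fun x hx => by
    simpa [hQa] using ht x x.2 (by simpa using hx)
  -- The two lower bounds already add up to the dimension, so both are equalities and the radical
  -- vanishes.
  have h3 := QuadraticForm.sigPos_add_sigNeg_add_radical (Q := Q)
  change (sigPos Q : ℤ) - sigNeg Q = _
  omega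

end Complexification

/-! ### Bases of root systems from simple vectors -/

/-- A root system of rank `n` that is parametrized by a subset `R` of a lattice, with `n` elements
of `R` such that all elements of `R` are nonnegative or nonpositive combinations of them, has the
corresponding roots as a base; its Cartan matrix is read off from the root strings. -/
theorem exists_base_of_simple {ι K M N Λ : Type*} [Finite ι] [Field K] [CharZero K]
    [AddCommGroup M] [Module K M] [AddCommGroup N] [Module K N] [AddCommGroup Λ]
    (P : RootPairing ι K M N) [P.IsRootSystem] [P.IsCrystallographic] [P.IsReduced]
    (c : Λ →+ M) (hc : Function.Injective c) (R : Set Λ) (hR : Set.range P.root = c '' R)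
    {n : ℕ} (hdim : Module.finrank K M = n) (S : Fin n → Λ) (hS : ∀ i, S i ∈ R)
    (hpos : ∀ v ∈ R, v ∈ AddSubmonoid.closure (Set.range S) ∨
      -v ∈ AddSubmonoid.closure (Set.range S))
    (A : Matrix (Fin n) (Fin n) ℤ) (hA2 : ∀ i, A i i = 2)
    (hA : ∀ i j, i ≠ j → ∃ a : ℕ, A i j = -a ∧ S i + a • S j ∈ R ∧ S i + (a + 1) • S j ∉ R) :
    ∃ (b : P.Base) (f : Fin n ≃ b.support), (∀ j, P.root (f j) = c (S j)) ∧
      ∀ i j, b.cartanMatrix (f i) (f j) = A i j := by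
  classical
  have hex : ∀ j, ∃ i, P.root i = c (S j) := fun j => by
    have : c (S j) ∈ Set.range P.root := hR ▸ ⟨S j, hS j, rfl⟩
    exact this
  choose r hr using hex
  have hcl : ∀ v ∈ AddSubmonoid.closure (Set.range S),
      c v ∈ AddSubmonoid.closure (P.root '' Set.range r) := by
    intro v hv
    have h1 : c v ∈ (AddSubmonoid.closure (Set.range S)).map (c : Λ →+ M) := ⟨v, hv, rfl⟩
    rw [AddMonoidHom.map_mclosure] at h1
    refine AddSubmonoid.closure_mono ?_ h1
    rintro _ ⟨_, ⟨j, rfl⟩, rfl⟩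
    exact ⟨r j, ⟨j, rfl⟩, hr j⟩
  have hsp : ∀ i, P.root i ∈ AddSubmonoid.closure (P.root '' Set.range r) ∨
      -P.root i ∈ AddSubmonoid.closure (P.root '' Set.range r) := by
    intro i
    have : P.root i ∈ c '' R := hR ▸ ⟨i, rfl⟩
    obtain ⟨v, hv, hvi⟩ := this
    rw [← hvi, ← map_neg]
    exact (hpos v hv).imp (hcl v) (hcl (-v))
  have himg : P.root '' Set.range r = Set.range fun j => P.root (r j) := by
    rw [← Set.range_comp]; rfl
  have hspan : ⊤ ≤ Submodule.span K (Set.range fun j => P.root (r j)) := by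
    rw [← RootPairing.IsRootSystem.span_root_eq_top (P := P), Submodule.span_le]
    have hle : ∀ x ∈ AddSubmonoid.closure (P.root '' Set.range r),
        x ∈ Submodule.span K (Set.range fun j => P.root (r j)) := by
      intro x hx
      rw [← himg]
      exact (AddSubmonoid.closure_le (S := (Submodule.span K _).toAddSubmonoid)).2
        Submodule.subset_span hx
    rintro _ ⟨i, rfl⟩
    rcases hsp i with h | h
    · exact hle _ h
    · exact neg_mem_iff.1 (hle _ h)
  -- Independence is free: `n` vectors that span a space of dimension `n`.
  have hli : LinearIndependent K fun j => P.root (r j) :=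
    linearIndependent_of_top_le_span_of_card_eq_finrank hspan (by simp [hdim])
  have hinj : Function.Injective r := fun i j hij => hli.injective (by simp [hij])
  have hliOn : LinearIndepOn K P.root (Set.range r) := by
    rw [LinearIndepOn, ← linearIndependent_equiv (Equiv.ofInjective r hinj)]
    exact hli
  let b := RootPairing.Base.mk' P (Set.range r) hliOn hsp
  let f : Fin n ≃ b.support :=
    (Equiv.ofInjective r hinj).trans (Set.Finite.subtypeEquivToFinset _)
  have hf : ∀ j, P.root (f j) = c (S j) := hr
  refine ⟨b, f, hf, fun i j => ?_⟩
  rcases eq_or_ne i j with rfl | hij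
  · rw [RootPairing.Base.cartanMatrix_apply_same, hA2]
  · obtain ⟨a, ha, h1, h2⟩ := hA i j hij
    have hne : f i ≠ f j := fun h => hij (f.injective h)
    have hlin := b.linearIndependent_pair_of_ne hne.symm
    -- Root strings are unbroken, so membership at `a` and failure at `a + 1` pin down the top
    -- coefficient. A difference of simple roots is never a root, hence the Cartan integer is minus
    -- this coefficient.
    have hmem : ∀ m : ℕ, m ≤ P.chainTopCoeff (f j) (f i) ↔ S i + m • S j ∈ R := by
      intro m
      rw [← P.root_add_nsmul_mem_range_iff_le_chainTopCoeff hlin, hR, hf, hf, ← map_nsmul,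
        ← map_add, hc.mem_set_image]
    rw [RootPairing.Base.cartanMatrix_eq_neg_chainTopCoeff b hne, ha]
    have e1 := (hmem a).2 h1
    have e2 := mt (hmem (a + 1)).1 h2
    congr 1
    exact_mod_cast (by omega : P.chainTopCoeff (f j) (f i) = a)

/-! ### Determining all roots from a spanning set of eigenvectors. -/

section Roots

open LieAlgebra LieAlgebra.IsKilling

/-- If nonzero functionals have common eigenvectors that span a Lie algebra together with a Cartan
subalgebra, then they are all the roots. -/
theorem range_root_eq {L : Type*} [LieRing L] [LieAlgebra ℂ L] [FiniteDimensional ℂ L]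
    [IsKilling ℂ L] (H : LieSubalgebra ℂ L) [H.IsCartanSubalgebra] (R : Set (Module.Dual ℂ H))
    (h0 : ∀ φ ∈ R, φ ≠ 0 ∧ ∃ v : L, v ≠ 0 ∧ ∀ x : H, ⁅x, v⁆ = φ x • v)
    (hspan : H.toSubmodule ⊔
      Submodule.span ℂ {v : L | ∃ φ ∈ R, ∀ x : H, ⁅x, v⁆ = φ x • v} = ⊤) :
    Set.range (rootSystem H).root = R := by
  have hev : ∀ (φ : Module.Dual ℂ H) (v : L), (∀ x : H, ⁅x, v⁆ = φ x • v) →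
      v ∈ rootSpace H φ := by
    intro φ v hv
    refine (LieModule.mem_genWeightSpace _ _ _).2 fun x => ⟨1, ?_⟩
    simp [hv x]
  apply Set.Subset.antisymm
  · rintro _ ⟨⟨χ, hχ⟩, rfl⟩
    -- Zero is added to account for `H` itself, which lies in the zero root space.
    let s : Set (H → ℂ) := {0} ∪ (fun φ : Module.Dual ℂ H => (φ : H → ℂ)) '' R
    have hs : ⨆ α ∈ s, rootSpace H α = ⊤ := by
      rw [← LieSubmodule.toSubmodule_eq_top, eq_top_iff, ← hspan, sup_le_iff]
      have hle : ∀ α ∈ s, (rootSpace H α).toSubmodule ≤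
          (⨆ α ∈ s, rootSpace H α).toSubmodule := fun α hα => by
        rw [LieSubmodule.toSubmodule_le_toSubmodule]
        exact le_biSup (fun α => rootSpace H α) hα
      constructor
      · refine le_trans ?_ (hle 0 (Or.inl rfl))
        have := toLieSubmodule_le_rootSpace_zero ℂ L H
        exact this
      · rw [Submodule.span_le]
        rintro v ⟨φ, hφ, hv⟩
        exact hle φ (Or.inr ⟨φ, hφ, rfl⟩) (hev φ v hv)
    -- Weight spaces are independent: a nonzero one cannot lie outside a family whose sum is
    -- everything.
    have hmem : (χ : H → ℂ) ∈ s :=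
      (LieModule.iSupIndep_genWeightSpace ℂ H L).mem_of_biSup_eq_top hs χ.genWeightSpace_ne_bot
    rcases hmem with h | ⟨φ, hφ, h⟩
    · have hne : χ.IsNonZero := by simpa using hχ
      exact absurd h hne
    · have : φ = (rootSystem H).root ⟨χ, hχ⟩ := by
        ext x
        exact congrFun h x
      rwa [← this]
  · intro φ hφ
    obtain ⟨hne, v, hv0, hv⟩ := h0 φ hφ
    have hbot : rootSpace H φ ≠ ⊥ := by
      intro h
      have := hev φ v hv
      rw [h, LieSubmodule.mem_bot] at this
      exact hv0 this
    let χ : LieModule.Weight ℂ H L := ⟨φ, hbot⟩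
    have hχ : χ.IsNonZero := by
      intro h
      exact hne (LinearMap.ext fun x => congrFun h x)
    refine ⟨⟨χ, by simpa using hχ⟩, ?_⟩
    ext x
    rfl

end Roots

/-! ### Tori given by commuting elements, their complexifications and their weights. -/

section Torus

variable {g : Type*} [LieRing g] [LieAlgebra ℝ g] {n : ℕ} {h : Fin n → g}

theorem lieSpan_range_eq_span (hcomm : ∀ i j, ⁅h i, h j⁆ = 0) :
    (LieSubalgebra.lieSpan ℝ g (Set.range h)).toSubmodule = Submodule.span ℝ (Set.range h) := by
  apply LieSubalgebra.coe_lieSpan_eq_span_of_forall_lie_eq_zero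
  rintro _ ⟨i, rfl⟩ _ ⟨j, rfl⟩
  exact hcomm i j

theorem lie_eq_zero_of_mem_lieSpan (hcomm : ∀ i j, ⁅h i, h j⁆ = 0) :
    ∀ x ∈ LieSubalgebra.lieSpan ℝ g (Set.range h),
      ∀ y ∈ LieSubalgebra.lieSpan ℝ g (Set.range h), ⁅x, y⁆ = 0 := by
  intro x hx y hy
  have := (LieSubalgebra.isLieAbelian_lieSpan_iff (R := ℝ) (s := Set.range h)).2 (by
    rintro _ ⟨i, rfl⟩ _ ⟨j, rfl⟩
    exact hcomm i j)
  exact congrArg Subtype.val (this.trivial ⟨x, hx⟩ ⟨y, hy⟩)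

/-- Commuting elements with centralizer equal to their span generate a maximal abelian
subalgebra. -/
theorem isMaximalAbelian_lieSpan (hcomm : ∀ i j, ⁅h i, h j⁆ = 0)
    (hcent : ∀ x : g, (∀ k, ⁅h k, x⁆ = 0) → x ∈ Submodule.span ℝ (Set.range h)) :
    IsMaximalAbelian (LieSubalgebra.lieSpan ℝ g (Set.range h)) := by
  refine ⟨lie_eq_zero_of_mem_lieSpan hcomm, fun c hc hle x hx => ?_⟩
  rw [← LieSubalgebra.mem_toSubmodule, lieSpan_range_eq_span hcomm]
  exact hcent x fun k => hc _ (hle (LieSubalgebra.subset_lieSpan ⟨k, rfl⟩)) _ hx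

theorem cpl_mem_complexify {k : LieSubalgebra ℝ g} {x y : g} :
    cpl x y ∈ complexify k ↔ x ∈ k ∧ y ∈ k := by
  constructor
  · intro hz
    have key : ∀ z ∈ complexify k, ∃ x ∈ k, ∃ y ∈ k, z = cpl x y := by
      intro z hz
      change z ∈ k.toSubmodule.baseChange ℂ at hz
      rw [Submodule.baseChange_eq_span] at hz
      induction hz using Submodule.span_induction with
      | zero => exact ⟨0, k.zero_mem, 0, k.zero_mem, by simp [cpl]⟩
      | add z w _ _ hz hw =>
        obtain ⟨x, hx, y, hy, rfl⟩ := hz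
        obtain ⟨x', hx', y', hy', rfl⟩ := hw
        exact ⟨x + x', k.add_mem hx hx', y + y', k.add_mem hy hy', by
          simp only [cpl, TensorProduct.tmul_add]; abel⟩
      | smul c z _ hz =>
        obtain ⟨x, hx, y, hy, rfl⟩ := hz
        refine ⟨c.re • x - c.im • y, k.sub_mem (k.smul_mem _ hx) (k.smul_mem _ hy),
          c.re • y + c.im • x, k.add_mem (k.smul_mem _ hy) (k.smul_mem _ hx), ?_⟩
        have hc : ∀ w : ℂ ⊗[ℝ] g, c • w = c.re • w + c.im • (Complex.I • w) := by
          intro w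
          conv_lhs => rw [← Complex.re_add_im c]
          rw [add_smul, mul_smul]
          exact congrArg₂ (· + ·) (algebraMap_smul ℂ c.re w)
            (algebraMap_smul ℂ c.im (Complex.I • w))
        rw [hc, I_smul_cpl]
        simp only [cpl, TensorProduct.tmul_add, TensorProduct.tmul_sub, TensorProduct.tmul_smul,
          TensorProduct.tmul_neg, smul_add, smul_neg]
        abel
      | mem z hz =>
        obtain ⟨x, hx, rfl⟩ := hz
        exact ⟨x, hx, 0, k.zero_mem, tmul_one_eq_cpl x⟩
    obtain ⟨x', hx', y', hy', e⟩ := key _ hz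
    obtain ⟨rfl, rfl⟩ := cpl_inj e
    exact ⟨hx', hy'⟩
  · rintro ⟨hx, hy⟩
    exact (complexify k).add_mem (tmul_mem_complexify hx)
      (Submodule.tmul_mem_baseChange_of_mem Complex.I hy)

/-- The complexification of a self-centralizing torus of semisimple elements is a Cartan
subalgebra. -/
theorem isCartanSubalgebra_complexify_lieSpan (hcomm : ∀ i j, ⁅h i, h j⁆ = 0)
    (hcent : ∀ x : g, (∀ k, ⁅h k, x⁆ = 0) → x ∈ Submodule.span ℝ (Set.range h))
    (hss : ∀ (k) (x : g), ⁅h k, ⁅h k, x⁆⁆ = 0 → ⁅h k, x⁆ = 0) :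
    (complexify (LieSubalgebra.lieSpan ℝ g (Set.range h))).IsCartanSubalgebra := by
  set k := LieSubalgebra.lieSpan ℝ g (Set.range h) with hk
  have hmem : ∀ i, h i ∈ k := fun i => LieSubalgebra.subset_lieSpan ⟨i, rfl⟩
  have hab : ∀ x ∈ k, ∀ y ∈ k, ⁅x, y⁆ = 0 := lie_eq_zero_of_mem_lieSpan hcomm
  have habC : ∀ z ∈ complexify k, ∀ w ∈ complexify k, ⁅z, w⁆ = 0 := by
    intro z hz w hw
    obtain ⟨x, y, rfl⟩ := exists_cpl z
    obtain ⟨x', y', rfl⟩ := exists_cpl w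
    obtain ⟨hx, hy⟩ := cpl_mem_complexify.1 hz
    obtain ⟨hx', hy'⟩ := cpl_mem_complexify.1 hw
    rw [lie_cpl, hab _ hx _ hx', hab _ hx _ hy', hab _ hy _ hx', hab _ hy _ hy']
    simp [cpl]
  have : IsLieAbelian (complexify k) :=
    ⟨fun z w => Subtype.ext (habC z z.2 w w.2)⟩
  refine ⟨inferInstance, ?_⟩
  refine le_antisymm ?_ (LieSubalgebra.le_normalizer _)
  intro z hz
  rw [LieSubalgebra.mem_normalizer_iff'] at hz
  obtain ⟨x, y, rfl⟩ := exists_cpl z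
  have h1 : ∀ i, ⁅h i, x⁆ = 0 ∧ ⁅h i, y⁆ = 0 := by
    intro i
    have hi : cpl (h i) 0 ∈ complexify k := cpl_mem_complexify.2 ⟨hmem i, k.zero_mem⟩
    -- For `z` in the normalizer, `[h_i, z]` lies in the abelian subalgebra, so `[h_i, [h_i, z]] =
    -- 0`. Semisimplicity improves this to `[h_i, z] = 0`, and the centralizer is the torus.
    have h2 := habC _ hi _ (hz _ hi)
    rw [lie_cpl, lie_cpl] at h2
    have h3 := cpl_eq_zero h2
    simp only [zero_lie, sub_zero, add_zero] at h3
    exact ⟨hss i x h3.1, hss i y h3.2⟩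
  have hsub := lieSpan_range_eq_span hcomm
  rw [cpl_mem_complexify, ← LieSubalgebra.mem_toSubmodule, ← LieSubalgebra.mem_toSubmodule, hsub]
  exact ⟨hcent x fun i => (h1 i).1, hcent y fun i => (h1 i).2⟩

/-- The coordinates `w ↦ ∑ w_k h_k` on the complexified torus, as a linear map. -/
def torusMap (h : Fin n → g) :
    (Fin n → ℂ) →ₗ[ℂ] complexify (LieSubalgebra.lieSpan ℝ g (Set.range h)) :=
  Fintype.linearCombination ℂ fun k =>
    ⟨(1 : ℂ) ⊗ₜ[ℝ] h k, tmul_mem_complexify (LieSubalgebra.subset_lieSpan ⟨k, rfl⟩)⟩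

theorem torusMap_apply (w : Fin n → ℂ) : torusMap h w = ∑ k, w k •
    (⟨(1 : ℂ) ⊗ₜ[ℝ] h k, tmul_mem_complexify (LieSubalgebra.subset_lieSpan ⟨k, rfl⟩)⟩ :
      complexify (LieSubalgebra.lieSpan ℝ g (Set.range h))) := rfl

theorem coe_torusMap (w : Fin n → ℂ) :
    (torusMap h w : ℂ ⊗[ℝ] g) = ∑ k, w k • ((1 : ℂ) ⊗ₜ[ℝ] h k) := by
  rw [torusMap_apply]
  exact map_sum (complexify (LieSubalgebra.lieSpan ℝ g (Set.range h))).toSubmodule.subtype _ _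

/-- Real and imaginary parts of the coefficients decouple, so both halves reduce to the real basis
property of the `h_k`. -/
theorem torusMap_bijective (hcomm : ∀ i j, ⁅h i, h j⁆ = 0) (hli : LinearIndependent ℝ h) :
    Function.Bijective (torusMap h) := by
  have hcoe : ∀ w : Fin n → ℂ, (torusMap h w : ℂ ⊗[ℝ] g) =
      cpl (∑ k, (w k).re • h k) (∑ k, (w k).im • h k) := by
    intro w
    rw [coe_torusMap, cpl, TensorProduct.tmul_sum, TensorProduct.tmul_sum, ← Finset.sum_add_distrib]
    refine Finset.sum_congr rfl fun k _ => ?_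
    rw [TensorProduct.tmul_smul, TensorProduct.tmul_smul, TensorProduct.smul_tmul',
      TensorProduct.smul_tmul', TensorProduct.smul_tmul', ← TensorProduct.add_tmul]
    congr 1
    apply Complex.ext <;> simp
  constructor
  · rw [← LinearMap.ker_eq_bot, LinearMap.ker_eq_bot']
    intro w hw
    have h0 := hcoe w
    rw [hw] at h0
    obtain ⟨h1, h2⟩ := cpl_eq_zero h0.symm
    have h1' := Fintype.linearIndependent_iff.1 hli _ h1
    have h2' := Fintype.linearIndependent_iff.1 hli _ h2
    exact funext fun k => Complex.ext (h1' k) (h2' k)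
  · rintro ⟨z, hz⟩
    obtain ⟨x, y, rfl⟩ := exists_cpl z
    obtain ⟨hx, hy⟩ := cpl_mem_complexify.1 hz
    rw [← LieSubalgebra.mem_toSubmodule, lieSpan_range_eq_span hcomm,
      Submodule.mem_span_range_iff_exists_fun] at hx hy
    obtain ⟨a, rfl⟩ := hx
    obtain ⟨b, rfl⟩ := hy
    exact ⟨fun k => ⟨a k, b k⟩, Subtype.ext (hcoe _)⟩

/-- The coordinates `w ↦ ∑ w_k h_k` on the complexified torus. -/
def torusEquiv (hcomm : ∀ i j, ⁅h i, h j⁆ = 0) (hli : LinearIndependent ℝ h) :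
    (Fin n → ℂ) ≃ₗ[ℂ] complexify (LieSubalgebra.lieSpan ℝ g (Set.range h)) :=
  LinearEquiv.ofBijective (torusMap h) (torusMap_bijective hcomm hli)

/-- The functional `∑ w_k h_k ↦ ∑ u_k v_k w_k` on the complexified torus. -/
def torusWeight (hcomm : ∀ i j, ⁅h i, h j⁆ = 0) (hli : LinearIndependent ℝ h) (u : Fin n → ℂ) :
    (Fin n → ℤ) →+ Module.Dual ℂ (complexify (LieSubalgebra.lieSpan ℝ g (Set.range h))) where
  toFun v := (∑ k, (u k * v k) • LinearMap.proj k) ∘ₗ (torusEquiv hcomm hli).symm.toLinearMap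
  map_zero' := by simp
  map_add' v v' := by
    ext x
    simp [mul_add, add_mul, Finset.sum_add_distrib]

theorem torusWeight_apply (hcomm : ∀ i j, ⁅h i, h j⁆ = 0) (hli : LinearIndependent ℝ h)
    (u : Fin n → ℂ) (v : Fin n → ℤ) (w : Fin n → ℂ) :
    torusWeight hcomm hli u v (torusMap h w) = ∑ k, u k * v k * w k := by
  have : (torusEquiv hcomm hli).symm (torusMap h w) = w :=
    (torusEquiv hcomm hli).symm_apply_apply w
  simp [torusWeight, this]

/-- This is what permits all root combinatorics to be done on integer vectors `v`, with the factors
`i/2` and `1/2` hidden in the scale `u`. -/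
theorem torusWeight_injective (hcomm : ∀ i j, ⁅h i, h j⁆ = 0) (hli : LinearIndependent ℝ h)
    {u : Fin n → ℂ} (hu : ∀ k, u k ≠ 0) : Function.Injective (torusWeight hcomm hli u) := by
  intro v v' hvv
  ext k
  have h1 := LinearMap.congr_fun hvv (torusMap h (Pi.single k 1))
  rw [torusWeight_apply, torusWeight_apply, Finset.sum_eq_single k, Finset.sum_eq_single k] at h1
  · simpa [hu k] using h1
  all_goals simp +contextual

theorem finrank_complexify_lieSpan (hcomm : ∀ i j, ⁅h i, h j⁆ = 0) (hli : LinearIndependent ℝ h) :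
    Module.finrank ℂ (complexify (LieSubalgebra.lieSpan ℝ g (Set.range h))) = n := by
  rw [← (torusEquiv hcomm hli).finrank_eq]
  simp

/-- A common real invariant plane `⟨X, Y⟩` gives a common complex eigenvector `X + i Y`. -/
theorem lie_cpl_eq_torusWeight_smul (hcomm : ∀ i j, ⁅h i, h j⁆ = 0) (hli : LinearIndependent ℝ h)
    {u : Fin n → ℂ} {v : Fin n → ℤ} {X Y : g}
    (hX : ∀ k, ⁅h k, X⁆ = (u k * v k).re • X - (u k * v k).im • Y)
    (hY : ∀ k, ⁅h k, Y⁆ = (u k * v k).im • X + (u k * v k).re • Y)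
    (x : complexify (LieSubalgebra.lieSpan ℝ g (Set.range h))) :
    ⁅(x : ℂ ⊗[ℝ] g), cpl X Y⁆ = torusWeight hcomm hli u v x • cpl X Y := by
  obtain ⟨w, rfl⟩ := (torusMap_bijective hcomm hli).2 x
  rw [torusWeight_apply, coe_torusMap, Finset.sum_smul, sum_lie]
  refine Finset.sum_congr rfl fun k _ => ?_
  have hsl : ⁅w k • (1 : ℂ) ⊗ₜ[ℝ] h k, cpl X Y⁆ = w k • ⁅(1 : ℂ) ⊗ₜ[ℝ] h k, cpl X Y⁆ :=
    LieModule.smul_lie (R := ℂ) (L := ℂ ⊗[ℝ] g) (M := ℂ ⊗[ℝ] g) _ _ _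
  rw [hsl, tmul_one_eq_cpl, lie_cpl, zero_lie, zero_lie, sub_zero, add_zero, hX, hY,
    mul_comm _ (w k), mul_smul]
  congr 1
  have hc : ∀ (c : ℂ) (z : ℂ ⊗[ℝ] g), c • z = c.re • z + c.im • (Complex.I • z) := by
    intro c z
    conv_lhs => rw [← Complex.re_add_im c]
    rw [add_smul, mul_smul]
    exact congrArg₂ (· + ·) (algebraMap_smul ℂ c.re z) (algebraMap_smul ℂ c.im (Complex.I • z))
  rw [hc (u k * v k), I_smul_cpl]
  simp only [cpl, TensorProduct.tmul_add, TensorProduct.tmul_sub, TensorProduct.tmul_smul,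
    TensorProduct.tmul_neg, smul_add, smul_neg]
  abel

end Torus

/-! ### Coordinates on the octonions -/

namespace Octonion

@[simp] theorem zero_fst : (0 : Octonion).1 = 0 := rfl
@[simp] theorem zero_snd : (0 : Octonion).2 = 0 := rfl
@[simp] theorem neg_fst (x : Octonion) : (-x).1 = -x.1 := rfl
@[simp] theorem neg_snd (x : Octonion) : (-x).2 = -x.2 := rfl
@[simp] theorem sub_fst (x y : Octonion) : (x - y).1 = x.1 - y.1 := rfl
@[simp] theorem sub_snd (x y : Octonion) : (x - y).2 = x.2 - y.2 := rfl

@[simp] theorem e_fst_re (i : Fin 8) : (e i).1.re = if i = 0 then 1 else 0 := by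
  fin_cases i <;> rfl
@[simp] theorem e_fst_imI (i : Fin 8) : (e i).1.imI = if i = 1 then 1 else 0 := by
  fin_cases i <;> rfl
@[simp] theorem e_fst_imJ (i : Fin 8) : (e i).1.imJ = if i = 2 then 1 else 0 := by
  fin_cases i <;> rfl
@[simp] theorem e_fst_imK (i : Fin 8) : (e i).1.imK = if i = 3 then 1 else 0 := by
  fin_cases i <;> rfl
@[simp] theorem e_snd_re (i : Fin 8) : (e i).2.re = if i = 4 then 1 else 0 := by
  fin_cases i <;> rfl
@[simp] theorem e_snd_imI (i : Fin 8) : (e i).2.imI = if i = 5 then 1 else 0 := by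
  fin_cases i <;> rfl
@[simp] theorem e_snd_imJ (i : Fin 8) : (e i).2.imJ = if i = 6 then 1 else 0 := by
  fin_cases i <;> rfl
@[simp] theorem e_snd_imK (i : Fin 8) : (e i).2.imK = if i = 7 then 1 else 0 := by
  fin_cases i <;> rfl

theorem star_star' (x : Octonion) : star (star x) = x := by
  apply ext' <;> simp

theorem q_e_e (i j : Fin 8) : q (e i) (e j) = if i = j then 2 else 0 := by
  fin_cases i <;> fin_cases j <;> simp [q_eq]

/-- The factor `1/2` compensates for the polar form, for which `q(e_i, e_i) = 2`. -/
theorem sum_e (x : Octonion) : x = ∑ i, (1 / 2 * q (e i) x) • e i := by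
  rw [Fin.sum_univ_eight]
  apply ext' <;> simp [q_eq]

theorem eq_of_q {x y : Octonion} (h : ∀ i, q (e i) x = q (e i) y) : x = y := by
  rw [sum_e x, sum_e y]
  simp only [h]

theorem linearMap_ext {M : Type*} [AddCommGroup M] [Module ℝ M] {f g : Octonion →ₗ[ℝ] M}
    (h : ∀ i, f (e i) = g (e i)) : f = g := by
  ext x
  rw [sum_e x, map_sum, map_sum]
  simp only [map_smul, h]

/-- The coordinates with respect to the basis `e`. -/
def coordEquiv : Octonion ≃ₗ[ℝ] (Fin 8 → ℝ) where
  toFun x i := 1 / 2 * q (e i) x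
  map_add' x y := by ext i; simp; ring
  map_smul' r x := by ext i; simp; ring
  invFun c := ∑ i, c i • e i
  left_inv x := (sum_e x).symm
  right_inv c := by
    ext i
    simp [q_e_e]
    ring

theorem finrank_octonion : Module.finrank ℝ Octonion = 8 := by
  rw [coordEquiv.finrank_eq]; simp

theorem pmul_e_zero_left (x : Octonion) : pmul (e 0) x = star x := by
  apply ext' <;> simp [pmul_apply]

theorem pmul_e_zero_right (x : Octonion) : pmul x (e 0) = star x := by
  apply ext' <;> simp [pmul_apply]

theorem star_neg' (x : Octonion) : star (-x) = -star x := by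
  apply ext' <;> simp

end Octonion

/-! ### Local triality -/

open Octonion

/-- An element of the triality algebra is determined by its first component. -/
theorem tri_eq_zero {d : Fin 3 → Module.End ℝ Octonion} (hd : d ∈ tri) (h0 : d 0 = 0) : d = 0 := by
  obtain ⟨hs, ht⟩ := hd
  simp only [h0, LinearMap.zero_apply] at ht
  -- Setting `x = 1` or `y = 1` in `0 = d₁(x) * y + x * d₂(y)` expresses everything by `a`: in
  -- octonion terms `d₁(x) = a x` and `d₂(y) = -y a`.
  set a := d 1 (e 0) with ha
  have h2 : ∀ y, d 2 y = -star (pmul a y) := by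
    intro y
    have h := ht (e 0) y
    rw [pmul_e_zero_left, ← ha] at h
    have h' := eq_neg_of_add_eq_zero_right h.symm
    rw [← star_star' (d 2 y), h', star_neg']
  have h1 : ∀ x, d 1 x = star (pmul x a) := by
    intro x
    have h := ht x (e 0)
    rw [pmul_e_zero_right, h2, pmul_e_zero_right, star_star', map_neg] at h
    have h' := eq_neg_of_add_eq_zero_left h.symm
    rw [← star_star' (d 1 x), h', neg_neg]
  -- Unfolded, this reads `(x̄ ā) ȳ = x̄ (ā ȳ)`: the conjugate of `a` lies in the middle nucleus of
  -- the octonions, which is `ℝ`. Skewness of `d₁` then kills the real part.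
  have hassoc : ∀ x y, pmul (star (pmul x a)) y = pmul x (star (pmul a y)) := by
    intro x y
    have h := ht x y
    rw [h1, h2, map_neg, ← sub_eq_add_neg] at h
    exact sub_eq_zero.1 h.symm
  have k0 : a.1.re = 0 := by
    have h := hs 1 (e 0) (e 0)
    rw [← ha] at h
    simp [q_eq] at h
    linarith
  have key : a = 0 := by
    -- Three associators of basis elements suffice to annihilate all seven imaginary coordinates.
    have c1 := hassoc (e 1) (e 2)
    have c2 := hassoc (e 4) (e 1)
    have c3 := hassoc (e 2) (e 4)
    have l1 := congrArg (fun z : Octonion => z.2.re) c1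
    have l2 := congrArg (fun z : Octonion => z.2.imI) c1
    have l3 := congrArg (fun z : Octonion => z.2.imJ) c1
    have l4 := congrArg (fun z : Octonion => z.2.imK) c1
    have l5 := congrArg (fun z : Octonion => z.2.imJ) c2
    have l6 := congrArg (fun z : Octonion => z.2.imK) c2
    have l7 := congrArg (fun z : Octonion => z.2.imK) c3
    simp [pmul_apply] at l1 l2 l3 l4 l5 l6 l7
    apply ext' <;> simp <;> linarith
  funext i
  fin_cases i
  · exact h0
  · ext x
    simp [h1, key, pmul_apply]
    apply ext' <;> simp
  · ext x
    simp [h2, key]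
    apply ext' <;> simp

theorem tri_ext {d d' : Fin 3 → Module.End ℝ Octonion} (hd : d ∈ tri) (hd' : d' ∈ tri)
    (h0 : d 0 = d' 0) : d = d' :=
  sub_eq_zero.1 (tri_eq_zero (tri.sub_mem hd hd') (sub_eq_zero.2 h0))

theorem tri_lie {d d' : Fin 3 → Module.End ℝ Octonion} (hd : d ∈ tri) (hd' : d' ∈ tri) :
    (fun i => ⁅d i, d' i⁆) ∈ tri := by
  refine ⟨fun i x y => ?_, fun x y => ?_⟩
  · have h1 := hd.1 i (d' i x) y
    have h2 := hd'.1 i x (d i y)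
    have h3 := hd'.1 i (d i x) y
    have h4 := hd.1 i x (d' i y)
    simp only [LieRing.of_associative_ring_bracket, LinearMap.sub_apply, Module.End.mul_apply,
      map_sub]
    linarith
  · simp only [LieRing.of_associative_ring_bracket, LinearMap.sub_apply, Module.End.mul_apply,
      hd.2, hd'.2, map_add, map_sub]
    abel

/-- By local triality only the first components need comparison, where this is the usual
equivariance of `σ` under the skew map `d₀`. -/
theorem lie_t {d : Fin 3 → Module.End ℝ Octonion} (hd : d ∈ tri) (x y : Octonion) :
    (fun i => ⁅d i, t x y i⁆) = t (d 0 x) y + t x (d 0 y) := by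
  refine tri_ext (tri_lie hd (t_mem x y)) (tri.add_mem (t_mem _ _) (t_mem _ _)) ?_
  ext z
  have h1 := hd.1 0 x z
  have h2 := hd.1 0 y z
  have h1' : q x (d 0 z) = - q (d 0 x) z := by linarith
  have h2' : q y (d 0 z) = - q (d 0 y) z := by linarith
  simp only [LieRing.of_associative_ring_bracket, LinearMap.sub_apply, Module.End.mul_apply,
    Pi.add_apply, LinearMap.add_apply, t_zero_apply, map_sub, map_smul, h1', h2']
  module

/-- The bilinear map `(x, y) ↦ t_{x,y}` with values in the triality algebra. -/
def tBil : Octonion →ₗ[ℝ] Octonion →ₗ[ℝ] tri :=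
  LinearMap.mk₂ ℝ (fun x y => ⟨t x y, t_mem x y⟩)
    (fun x y z => Subtype.ext (tri_ext (t_mem _ _) (tri.add_mem (t_mem _ _) (t_mem _ _)) (by
      ext w; simp [t_zero_apply]; module)))
    (fun r x y => Subtype.ext (tri_ext (t_mem _ _) (tri.smul_mem _ (t_mem _ _)) (by
      ext w; simp [t_zero_apply]; module)))
    (fun x y z => Subtype.ext (tri_ext (t_mem _ _) (tri.add_mem (t_mem _ _) (t_mem _ _)) (by
      ext w; simp [t_zero_apply]; module)))
    (fun r x y => Subtype.ext (tri_ext (t_mem _ _) (tri.smul_mem _ (t_mem _ _)) (by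
      ext w; simp [t_zero_apply]; module)))

theorem coe_tBil (x y : Octonion) : (tBil x y : Fin 3 → Module.End ℝ Octonion) = t x y := rfl

theorem tBil_skew (x y : Octonion) : tBil x y = - tBil y x :=
  Subtype.ext (tri_ext (t_mem _ _) (tri.neg_mem (t_mem _ _)) (by
    ext w; simp [coe_tBil, t_zero_apply]))

theorem tBil_self (x : Octonion) : tBil x x = 0 :=
  Subtype.ext (tri_ext (t_mem _ _) tri.zero_mem (by
    ext w; simp [coe_tBil, t_zero_apply]))

/-- The triality algebra is spanned by the `t_{e_a, e_b}`. -/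
theorem tri_eq_sum (d : tri) : d = (1 / 8 : ℝ) • ∑ a, ∑ b, q (e b) (d.1 0 (e a)) • tBil (e a) (e b) := by
  refine Subtype.ext (tri_ext d.2 (Subtype.prop _) ?_)
  refine linearMap_ext fun j => eq_of_q fun k => ?_
  -- Skewness makes the two terms of `σ` contribute equally. Each of the two contractions with
  -- `q(e_i, e_i) = 2` gives another factor two, so the constant is `1/8`.
  have hs : ∀ a, q (e k) (d.1 0 (e a)) = - q (e a) (d.1 0 (e k)) := by
    intro a
    have := d.2.1 0 (e k) (e a)
    rw [q_comm (d.1 0 (e k))] at this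
    linarith
  have hsum : ((((1 / 8 : ℝ) • ∑ a, ∑ b, q (e b) (d.1 0 (e a)) • tBil (e a) (e b) : tri)) :
      Fin 3 → Module.End ℝ Octonion) 0 (e j)
      = (1 / 8 : ℝ) • ∑ a, ∑ b, q (e b) (d.1 0 (e a)) • t (e a) (e b) 0 (e j) := by
    simp [Finset.sum_apply, LinearMap.sum_apply, coe_tBil]
  rw [hsum]
  simp only [t_zero_apply, map_smul, map_sum, map_sub, q_e_e, smul_eq_mul, mul_sub,
    Finset.sum_sub_distrib]
  simp [mul_ite, ite_mul, Finset.sum_ite_eq, Finset.sum_ite_eq']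
  have := hs j
  linarith

/-- The coordinates of the triality algebra. -/
def triCoord : tri →ₗ[ℝ] ({p : Fin 8 × Fin 8 // p.1 < p.2} → ℝ) where
  toFun d p := q (e p.1.2) (d.1 0 (e p.1.1))
  map_add' d d' := by ext p; simp
  map_smul' r d := by ext p; simp

theorem triCoord_bijective : Function.Bijective triCoord := by
  constructor
  · rw [← LinearMap.ker_eq_bot, LinearMap.ker_eq_bot']
    intro d hd
    have h1 : ∀ a b, a < b → q (e b) (d.1 0 (e a)) = 0 := fun a b hab =>
      congrFun hd ⟨(a, b), hab⟩
    have h2 : ∀ a b, q (e b) (d.1 0 (e a)) = 0 := by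
      intro a b
      have hs := d.2.1 0 (e b) (e a)
      rw [q_comm (d.1 0 (e b))] at hs
      rcases lt_trichotomy a b with h | rfl | h
      · exact h1 a b h
      · linarith
      · have := h1 b a h
        linarith
    rw [tri_eq_sum d]
    simp [h2]
  · intro f
    -- The `(a, b)` coordinate of `t_{e_a, e_b}` is `q(e_b, 2 e_b) = 4`, and its other coordinates
    -- above the diagonal vanish.
    refine ⟨∑ p : {p : Fin 8 × Fin 8 // p.1 < p.2}, (1 / 4 * f p) • tBil (e p.1.1) (e p.1.2), ?_⟩
    ext ⟨⟨a, b⟩, hab⟩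
    have hsum : triCoord (∑ p : {p : Fin 8 × Fin 8 // p.1 < p.2},
        (1 / 4 * f p) • tBil (e p.1.1) (e p.1.2)) ⟨(a, b), hab⟩
        = ∑ p : {p : Fin 8 × Fin 8 // p.1 < p.2},
          (1 / 4 * f p) * q (e b) (t (e p.1.1) (e p.1.2) 0 (e a)) := by
      rw [map_sum, Finset.sum_apply]
      refine Finset.sum_congr rfl fun p _ => ?_
      rw [map_smul]
      rfl
    rw [hsum, Finset.sum_eq_single ⟨(a, b), hab⟩]
    · have hne : b ≠ a := ne_of_gt hab
      simp [t_zero_apply, q_e_e, hne]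
      ring
    · rintro ⟨⟨a', b'⟩, hab'⟩ - hne
      have hab1 : a < b := hab
      have hab2 : a' < b' := hab'
      have hne' : ¬ (a' = a ∧ b' = b) := fun h => hne (by simp [h.1, h.2])
      simp only [t_zero_apply, map_sub, map_smul, q_e_e, smul_eq_mul]
      by_cases h1 : a' = a
      · have h2 : ¬ b = b' := fun h => hne' ⟨h1, h.symm⟩
        have h3 : ¬ b' = a := fun h => by subst h1; exact absurd h (ne_of_gt hab2)
        simp [h2, h3]
      · by_cases h4 : b' = a
        · have h5 : ¬ b = a' := fun h => by
            subst h h4; exact lt_asymm hab1 hab2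
          simp [h1, h5]
        · simp [h1, h4]
    · simp

theorem finrank_tri : Module.finrank ℝ tri = 28 := by
  rw [(LinearEquiv.ofBijective triCoord triCoord_bijective).finrank_eq, Module.finrank_fintype_fun_eq_card]
  decide

section

open Octonion

/-! ### The derivation algebra -/

namespace Albert

@[simp] theorem zero_fst (i) : (0 : Albert).1 i = 0 := rfl
@[simp] theorem zero_snd (i) : (0 : Albert).2 i = 0 := rfl
@[simp] theorem neg_fst (x : Albert) (i) : (-x).1 i = -x.1 i := rfl
@[simp] theorem neg_snd (x : Albert) (i) : (-x).2 i = -x.2 i := rfl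

/-- Splitting relative to `i` lets the cyclic multiplication rules apply without fixing `i`. -/
theorem fin3_cases {p : Fin 3 → Prop} (i : Fin 3) (h0 : p i) (h1 : p (i + 1)) (h2 : p (i + 2)) :
    ∀ j, p j := by
  intro j
  fin_cases i <;> fin_cases j <;> assumption

@[simp] theorem ne1 (i : Fin 3) : i + 1 ≠ i := by fin_cases i <;> decide
@[simp] theorem ne2 (i : Fin 3) : i + 2 ≠ i := by fin_cases i <;> decide
@[simp] theorem ne3 (i : Fin 3) : i + 1 ≠ i + 2 := by fin_cases i <;> decide
@[simp] theorem ne1' (i : Fin 3) : i ≠ i + 1 := (ne1 i).symm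
@[simp] theorem ne2' (i : Fin 3) : i ≠ i + 2 := (ne2 i).symm
@[simp] theorem ne3' (i : Fin 3) : i + 2 ≠ i + 1 := (ne3 i).symm

/-- The embeddings `ι_i` as linear maps. -/
def iotaL (i : Fin 3) : Octonion →ₗ[ℝ] Albert where
  toFun := iota i
  map_add' x y := ext' (fun j => by simp) (fun j => by simp [Pi.single_add])
  map_smul' r x := ext' (fun j => by simp) (fun j => by simp [Pi.single_smul])

theorem L_E_fst (i : Fin 3) (x : Albert) (j : Fin 3) :
    (L (E i) x).1 j = if j = i then x.1 j else 0 := by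
  rw [L_fst]; simp [Pi.single_apply]

theorem L_E_snd_self (i : Fin 3) (x : Albert) : (L (E i) x).2 i = 0 := by
  rw [L_snd]; simp

theorem L_E_snd_add_one (i : Fin 3) (x : Albert) :
    (L (E i) x).2 (i + 1) = (1 / 2 : ℝ) • x.2 (i + 1) := by
  rw [L_snd]; simp [f11, f12]

theorem L_E_snd_add_two (i : Fin 3) (x : Albert) :
    (L (E i) x).2 (i + 2) = (1 / 2 : ℝ) • x.2 (i + 2) := by
  rw [L_snd]; simp [f21, f22]

theorem L_iota_iota_self (i : Fin 3) (x y : Octonion) :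
    L (iota i x) (iota i y) = (2 * q x y) • (E (i + 1) + E (i + 2)) := by
  refine ext' (fin3_cases i ?_ ?_ ?_) (fin3_cases i ?_ ?_ ?_) <;>
    simp [L_fst, L_snd, f11, f12, f21, f22]

theorem L_iota_iota (i : Fin 3) (x y : Octonion) :
    L (iota (i + 1) x) (iota (i + 2) y) = iota i (pmul x y) := by
  refine ext' (fin3_cases i ?_ ?_ ?_) (fin3_cases i ?_ ?_ ?_) <;>
    simp [L_fst, L_snd, f11, f12, f21, f22]

theorem der_apply_L {d : Module.End ℝ Albert} (hd : d ∈ Der) (x y : Albert) :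
    d (L x y) = L (d x) y + L x (d y) := hd x y

/-- A derivation that kills the idempotents is given by a triality triple. -/
theorem der_eq_rhoEnd {d : Module.End ℝ Albert} (hd : d ∈ Der) (hE : ∀ i, d (E i) = 0) :
    ∃ τ ∈ tri, d = rhoEnd τ := by
  -- A derivation killing the idempotents commutes with their multiplications, hence preserves the
  -- Peirce space `ι_i(pO)`, the joint eigenspace on which `E_i`, `E_{i+1}`, `E_{i+2}` act by `0`,
  -- `1/2`, `1/2`.
  have hv : ∀ i x j, L (E j) (d (iota i x)) = d (L (E j) (iota i x)) := by
    intro i x j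
    rw [der_apply_L hd, hE, map_zero, LinearMap.zero_apply, zero_add]
  have e0 : ∀ i x, L (E i) (iota i x) = 0 := by
    intro i x
    refine ext' (fin3_cases i ?_ ?_ ?_) (fin3_cases i ?_ ?_ ?_) <;>
      simp [L_fst, L_snd, f11, f12, f21, f22]
  have e2 : ∀ i x, L (E (i + 2)) (iota i x) = (1 / 2 : ℝ) • iota i x := by
    intro i x
    refine ext' (fin3_cases i ?_ ?_ ?_) (fin3_cases i ?_ ?_ ?_) <;>
      simp [L_fst, L_snd, f11, f12, f21, f22]
  have hI : ∀ i x, d (iota i x) = iota i ((d (iota i x)).2 i) := by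
    intro i x
    have h0 := hv i x i
    have h1 := hv i x (i + 1)
    have h2 := hv i x (i + 2)
    rw [e0, map_zero] at h0
    rw [L_E_iota, map_smul] at h1
    rw [e2, map_smul] at h2
    have a0 := congrArg (fun z : Albert => z.1 i) h0
    have a1 := congrArg (fun z : Albert => z.1 (i + 1)) h1
    have a2 := congrArg (fun z : Albert => z.1 (i + 2)) h2
    simp [L_E_fst] at a0 a1 a2
    have b1 := congrArg (fun z : Albert => z.2 (i + 1)) h0
    have b2 := congrArg (fun z : Albert => z.2 (i + 2)) h0
    simp [L_E_snd_add_one, L_E_snd_add_two] at b1 b2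
    refine ext' (fin3_cases i ?_ ?_ ?_) (fin3_cases i ?_ ?_ ?_)
    · simp [a0]
    · simp; linarith
    · simp; linarith
    · simp
    · simp [b1]
    · simp [b2]
  let τ : Fin 3 → Module.End ℝ Octonion := fun i =>
    { toFun := fun x => (d (iotaL i x)).2 i
      map_add' := fun x y => by rw [map_add, map_add, add_snd]
      map_smul' := fun r x => by rw [map_smul, map_smul, smul_snd, RingHom.id_apply] }
  have hτ : ∀ i x, d (iota i x) = iota i (τ i x) := hI
  refine ⟨τ, ⟨fun i x y => ?_, fun x y => ?_⟩, ?_⟩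
  · have h := der_apply_L hd (iota i x) (iota i y)
    rw [L_iota_iota_self, map_smul, map_add, hE, hE, hτ, hτ, L_iota_iota_self, L_iota_iota_self]
      at h
    have h1 := congrArg (fun z : Albert => z.1 (i + 1)) h
    simp at h1
    linarith
  · have h := der_apply_L hd (iota (0 + 1) x) (iota (0 + 2) y)
    rw [L_iota_iota, hτ, hτ, hτ, L_iota_iota, L_iota_iota] at h
    have h1 := congrArg (fun z : Albert => z.2 0) h
    simpa using h1
  · ext x
    conv_lhs => rw [decomp x]
    simp only [map_add, map_smul, hE, hτ, smul_zero, zero_add]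
    refine ext' (fun j => by simp) (fun j => ?_)
    fin_cases j <;> simp

theorem der_E_fst {d : Module.End ℝ Albert} (hd : d ∈ Der) (i j : Fin 3) : (d (E i)).1 j = 0 := by
  have h := der_apply_L hd (E i) (E i)
  rw [L_E_E, L_comm (d (E i))] at h
  have hj := congrArg (fun w : Albert => w.1 j) h
  simp only [add_fst, L_E_fst] at hj
  by_cases hij : j = i
  · simp [hij] at hj
    rwa [hij]
  · simpa [hij] using hj

/-- Every derivation of the Albert algebra is the sum of one given by a triality triple and one
of the form `∑ ρ(ι_i(u_i))`. -/
theorem exists_der_eq {d : Module.End ℝ Albert} (hd : d ∈ Der) :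
    ∃ τ ∈ tri, ∃ u, d = rhoEnd τ + rhoIotaEnd u := by
  -- The derivation `ρ(ι_i(u_i))` sends `E_{i+1}` to `ι_i(u_i)/2` and `E_{i+2}` to the opposite, so
  -- the factor two makes the two derivations agree on the idempotents.
  let u : Fin 3 → Octonion := fun i => (2 : ℝ) • (d (E (i + 1))).2 i
  have hself : ∀ i, (d (E i)).2 i = 0 := by
    intro i
    have h := der_apply_L hd (E i) (E i)
    rw [L_E_E, L_comm (d (E i))] at h
    have hi := congrArg (fun w : Albert => w.2 i) h
    simpa [L_E_snd_self] using hi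
  -- Differentiating `E_{i+1} E_{i+2} = 0` and taking the `ι_i` component, on which both idempotents
  -- act by `1/2`.
  have hneg : ∀ i, (d (E (i + 2))).2 i = - (d (E (i + 1))).2 i := by
    intro i
    have h0 : L (E (i + 1)) (E (i + 2)) = 0 := by
      refine ext' (fin3_cases i ?_ ?_ ?_) (fin3_cases i ?_ ?_ ?_) <;>
        simp [L_fst, L_snd]
    have h := der_apply_L hd (E (i + 1)) (E (i + 2))
    rw [h0, map_zero, L_comm (d (E (i + 1)))] at h
    have hi := congrArg (fun w : Albert => w.2 i) h
    have e1 := L_E_snd_add_one (i + 2) (d (E (i + 1)))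
    have e2 := L_E_snd_add_two (i + 1) (d (E (i + 2)))
    rw [f21] at e1
    rw [f12] at e2
    simp only [zero_snd, add_snd, e1, e2] at hi
    have h3 : (d (E (i + 1))).2 i + (d (E (i + 2))).2 i = 0 := by
      have := congrArg (fun z => (2 : ℝ) • z) hi
      simpa [smul_smul] using this.symm
    exact eq_neg_of_add_eq_zero_right h3
  have hd' : d - rhoIotaEnd u ∈ Der := Der.sub_mem hd (rhoIotaEnd_mem u)
  have hE : ∀ i, (d - rhoIotaEnd u) (E i) = 0 := by
    intro i
    refine ext' (fun j => ?_) (fin3_cases i ?_ ?_ ?_)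
    · simp [der_E_fst hd, rhoIotaEnd_fst]
    · simp [hself, rhoIotaEnd_snd]
    · have := hneg (i + 1)
      rw [f11, f12] at this
      simp [rhoIotaEnd_snd, u, f11, f12, this, smul_smul]
    · simp [rhoIotaEnd_snd, u, f21, f22, smul_smul]
  obtain ⟨τ, hτ, h⟩ := der_eq_rhoEnd hd' hE
  exact ⟨τ, hτ, u, by rw [← h]; abel⟩

/-- The derivation `∑ ρ(ι_i(u_i))`. -/
def iotaDer : (Fin 3 → Octonion) →ₗ[ℝ] Der where
  toFun u := ⟨rhoIotaEnd u, rhoIotaEnd_mem u⟩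
  map_add' u v := Subtype.ext (LinearMap.ext fun x => by
    change rhoIotaEnd (u + v) x = rhoIotaEnd u x + rhoIotaEnd v x
    refine ext' (fun i => ?_) (fun i => ?_)
    · simp only [add_fst, rhoIotaEnd_fst, Pi.add_apply, map_add, LinearMap.add_apply]; ring
    · simp only [add_snd, rhoIotaEnd_snd, Pi.add_apply, map_add, LinearMap.add_apply]; module)
  map_smul' r u := Subtype.ext (LinearMap.ext fun x => by
    change rhoIotaEnd (r • u) x = r • rhoIotaEnd u x
    refine ext' (fun i => ?_) (fun i => ?_)
    · simp only [smul_fst, rhoIotaEnd_fst, Pi.smul_apply, map_smul, LinearMap.smul_apply,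
        smul_eq_mul]; ring
    · simp only [smul_snd, rhoIotaEnd_snd, Pi.smul_apply, map_smul, LinearMap.smul_apply]; module)

theorem coe_iotaDer (u : Fin 3 → Octonion) :
    (iotaDer u : Module.End ℝ Albert) = rhoIotaEnd u := rfl

theorem coe_rho (τ : tri) : (rho τ : Module.End ℝ Albert) = rhoEnd τ := rfl

theorem rho_add_iotaDer_eq_zero {τ : tri} {u : Fin 3 → Octonion} (h : rho τ + iotaDer u = 0) :
    τ = 0 ∧ u = 0 := by
  have h' : rhoEnd τ + rhoIotaEnd u = 0 := congrArg Subtype.val h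
  have hu : u = 0 := by
    funext i
    have h1 := congrArg (fun z : Albert => z.2 i) (LinearMap.congr_fun h' (E (i + 1)))
    simpa [rhoIotaEnd_snd] using h1
  subst hu
  rw [map_zero, add_zero] at h
  refine ⟨Subtype.ext (funext fun i => LinearMap.ext fun x => ?_), rfl⟩
  have h1 : rhoEnd τ = 0 := congrArg Subtype.val h
  have h2 := congrArg (fun z : Albert => z.2 i) (LinearMap.congr_fun h1 (iota i x))
  simpa using h2

/-- The parametrization of the derivation algebra. -/
def derEquiv : (tri × (Fin 3 → Octonion)) ≃ₗ[ℝ] Der :=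
  LinearEquiv.ofBijective (rho.coprod iotaDer) <| by
    constructor
    · rw [← LinearMap.ker_eq_bot, LinearMap.ker_eq_bot']
      rintro ⟨τ, u⟩ h
      exact Prod.ext (rho_add_iotaDer_eq_zero h).1 (rho_add_iotaDer_eq_zero h).2
    · rintro ⟨d, hd⟩
      obtain ⟨τ, hτ, u, rfl⟩ := exists_der_eq hd
      exact ⟨(⟨τ, hτ⟩, u), rfl⟩

theorem derEquiv_apply (τ : tri) (u : Fin 3 → Octonion) : derEquiv (τ, u) = rho τ + iotaDer u := rfl

theorem finrank_der : Module.finrank ℝ Der = 52 := by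
  rw [← derEquiv.finrank_eq, Module.finrank_prod, finrank_tri, Module.finrank_pi_fintype]
  simp [finrank_octonion]

theorem finrank_A0 : Module.finrank ℝ A0 = 26 := by
  have h1 : Module.finrank ℝ Albert = 27 := by
    change Module.finrank ℝ ((Fin 3 → ℝ) × (Fin 3 → Octonion)) = 27
    rw [Module.finrank_prod, Module.finrank_pi_fintype, Module.finrank_pi_fintype]
    simp [finrank_octonion]
  have h2 := LinearMap.finrank_range_add_finrank_ker tr
  have h3 : LinearMap.range tr = ⊤ := by
    rw [LinearMap.range_eq_top]
    intro r
    exact ⟨r • E 0, by rw [map_smul, tr_apply]; simp⟩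
  rw [h3, finrank_top, Module.finrank_self, h1] at h2
  change 1 + Module.finrank ℝ A0 = 27 at h2
  omega

end Albert

end

section

open Octonion Albert

/-! ### Brackets in `Der(A) ⊕ A₀` -/

/-- The element of the Albert algebra with given components. -/
def Albert.of (a : Fin 3 → ℝ) (u : Fin 3 → Octonion) : Albert := (a, u)

@[simp] theorem Albert.of_fst (a : Fin 3 → ℝ) (u : Fin 3 → Octonion) : (Albert.of a u).1 = a := rfl
@[simp] theorem Albert.of_snd (a : Fin 3 → ℝ) (u : Fin 3 → Octonion) : (Albert.of a u).2 = u := rfl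

namespace LieE

/-- The element `ρ(τ)`. -/
def triE : tri →ₗ[ℝ] LieE := ofDer ∘ₗ rho

/-- The element `∑ ρ(ι_i(u_i))` of `Der(A)`. -/
def derE : (Fin 3 → Octonion) →ₗ[ℝ] LieE := ofDer ∘ₗ iotaDer

/-- The element `∑ ι_i(u_i)` of `A₀`. -/
def offE : (Fin 3 → Octonion) →ₗ[ℝ] LieE where
  toFun u := ofA0 ⟨Albert.of 0 u, by change tr _ = 0; simp [tr_apply]⟩
  map_add' u v := by
    rw [← map_add]
    exact congrArg ofA0 (Subtype.ext (Albert.ext' (fun i => (add_zero 0).symm) (fun i => rfl)))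
  map_smul' r u := by
    rw [← map_smul]
    exact congrArg ofA0 (Subtype.ext (Albert.ext' (fun i => (mul_zero r).symm) (fun i => rfl)))

/-- The diagonal elements `y (E₂ - E₀) + z (E₀ - E₁)` of `A₀`. -/
def diagE (y z : ℝ) : LieE := y • h 4 + z • h 5

/-- The bracket formulas below are verified on the faithful representation, where they become
operator identities on the Albert algebra. -/
theorem ext_toEnd {a b : LieE} (h : ∀ x, toEnd a x = toEnd b x) : a = b :=
  toEnd_injective (LinearMap.ext h)

theorem toEnd_triE (τ : tri) : toEnd (triE τ) = rhoEnd τ := by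
  rw [toEnd_apply]
  change rhoEnd τ + L ((0 : A0) : Albert) = _
  simp

theorem toEnd_derE (u : Fin 3 → Octonion) : toEnd (derE u) = rhoIotaEnd u := by
  rw [toEnd_apply]
  change rhoIotaEnd u + L ((0 : A0) : Albert) = _
  simp

theorem toEnd_offE (u : Fin 3 → Octonion) : toEnd (offE u) = L (Albert.of 0 u) := by
  rw [toEnd_apply]
  change 0 + L (Albert.of 0 u) = _
  simp

theorem toEnd_h4 : toEnd (h 4) = L (E 2 - E 0) := by
  rw [toEnd_apply]
  change 0 + L (E 2 - E 0) = _
  simp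

theorem toEnd_h5 : toEnd (h 5) = L (E 0 - E 1) := by
  rw [toEnd_apply]
  change 0 + L (E 0 - E 1) = _
  simp

theorem toEnd_diagE (y z : ℝ) : toEnd (diagE y z) = L (Albert.of ![z - y, -z, y] 0) := by
  rw [diagE, map_add, map_smul, map_smul, toEnd_h4, toEnd_h5, ← map_smul, ← map_smul, ← map_add]
  congr 1
  refine Albert.ext' (fun i => ?_) (fun i => ?_)
  · fin_cases i <;> simp <;> ring
  · fin_cases i <;> simp

/-- The linear form on diagonal elements by which they act on the `i`-th off-diagonal part. -/
def lam (i : Fin 3) (y z : ℝ) : ℝ := ![-(y + z) / 2, (2 * y - z) / 2, (2 * z - y) / 2] i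

theorem lam_eq (i : Fin 3) (y z : ℝ) :
    lam i y z = 1 / 2 * (![z - y, -z, y] (i + 1) - ![z - y, -z, y] (i + 2)) := by
  fin_cases i <;> simp [lam] <;> ring

theorem triE_lie_triE (τ σ : tri) : ⁅triE τ, triE σ⁆ = triE ⟨_, tri_lie τ.2 σ.2⟩ := by
  apply ext_toEnd
  intro x
  simp only [toEnd_lie, toEnd_triE, LieRing.of_associative_ring_bracket, LinearMap.sub_apply,
    Module.End.mul_apply]
  exact Albert.ext' (fun i => by simp) (fun i => by simp)

theorem triE_lie_tBil (τ : tri) (x y : Octonion) :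
    ⁅triE τ, triE (tBil x y)⁆ = triE (tBil (τ.1 0 x) y) + triE (tBil x (τ.1 0 y)) := by
  rw [triE_lie_triE, ← map_add]
  exact congrArg triE (Subtype.ext (lie_t τ.2 x y))

theorem triE_lie_derE (τ : tri) (u : Fin 3 → Octonion) :
    ⁅triE τ, derE u⁆ = derE fun i => τ.1 i (u i) := by
  apply ext_toEnd
  intro x
  simp only [toEnd_lie, toEnd_triE, toEnd_derE, LieRing.of_associative_ring_bracket,
    LinearMap.sub_apply, Module.End.mul_apply]
  refine Albert.ext' (fun i => ?_) (fun i => ?_)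
  · have h1 := τ.2.1 (i + 1) (u (i + 1)) (x.2 (i + 1))
    have h2 := τ.2.1 (i + 2) (u (i + 2)) (x.2 (i + 2))
    simp only [Albert.sub_fst, rhoEnd_fst, rhoIotaEnd_fst, rhoEnd_snd]
    linarith
  · have h1 := tri_cyclic τ.2 i (u (i + 1)) (x.2 (i + 2))
    have h2 := tri_cyclic τ.2 i (x.2 (i + 1)) (u (i + 2))
    simp only [Albert.sub_snd, rhoEnd_snd, rhoIotaEnd_snd, map_add, map_sub, map_smul, rhoEnd_fst, h1, h2]
    module

theorem triE_lie_offE (τ : tri) (u : Fin 3 → Octonion) :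
    ⁅triE τ, offE u⁆ = offE fun i => τ.1 i (u i) := by
  apply toEnd_injective
  rw [toEnd_lie, toEnd_triE, toEnd_offE, toEnd_offE]
  have := der_L (rho τ) (Albert.of 0 u)
  rw [coe_rho] at this
  exact this

/-- In the general formula for `[l_x, l_y]` the triality part vanishes, as a diagonal element has no
octonion entries. With the companion `diagE_lie_derE`, the same scalar governs both directions,
which makes `derE ± offE` on a single `ι_i` an eigenvector. -/
theorem diagE_lie_offE (y z : ℝ) (u : Fin 3 → Octonion) :
    ⁅diagE y z, offE u⁆ = derE fun i => (-lam i y z) • u i := by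
  apply toEnd_injective
  rw [toEnd_lie, toEnd_diagE, toEnd_offE, toEnd_derE, lie_L]
  have h0 : ∀ (d : Fin 3 → Module.End ℝ Octonion), d = 0 → rhoEnd d = 0 := by
    rintro _ rfl
    exact LinearMap.ext fun x => Albert.ext' (fun i => by simp) (fun i => by simp)
  rw [h0, zero_add]
  · congr 1
    funext i
    simp [lam_eq]
  · funext i
    ext w
    fin_cases i <;> simp [t_zero_apply, t_one_apply, t_two_apply]

theorem diagE_lie_derE (y z : ℝ) (u : Fin 3 → Octonion) :
    ⁅diagE y z, derE u⁆ = offE fun i => (-lam i y z) • u i := by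
  apply toEnd_injective
  rw [toEnd_lie, toEnd_diagE, toEnd_derE, toEnd_offE]
  have := der_L (iotaDer u) (Albert.of ![z - y, -z, y] 0)
  rw [← lie_skew, ← coe_iotaDer, this, ← map_neg]
  congr 1
  refine Albert.ext' (fun i => ?_) (fun i => ?_)
  · simp [coe_iotaDer, rhoIotaEnd_fst]
  · simp only [Albert.neg_snd, coe_iotaDer, rhoIotaEnd_snd, lam_eq]
    simp

theorem diagE_lie_triE (y z : ℝ) (τ : tri) : ⁅diagE y z, triE τ⁆ = 0 := by
  apply toEnd_injective
  rw [toEnd_lie, toEnd_diagE, toEnd_triE, map_zero]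
  have := der_L (rho τ) (Albert.of ![z - y, -z, y] 0)
  rw [← lie_skew, ← coe_rho, this, ← map_neg, coe_rho]
  have h0 : -rhoEnd τ (Albert.of ![z - y, -z, y] 0) = 0 :=
    Albert.ext' (fun i => by simp) (fun i => by simp)
  rw [h0, map_zero]

theorem diagE_lie_diagE (y z y' z' : ℝ) : ⁅diagE y z, diagE y' z'⁆ = 0 := by
  apply ext_toEnd
  intro x
  simp only [toEnd_lie, toEnd_diagE, LieRing.of_associative_ring_bracket,
    LinearMap.sub_apply, Module.End.mul_apply]
  refine Albert.ext' (fun i => ?_) (fun i => ?_)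
  · fin_cases i <;> simp [L_fst] <;> ring
  · fin_cases i <;> simp [L_snd, smul_smul, mul_comm]

theorem exists_eq_diagE_add_offE (x : A0) : ∃ y z u, ofA0 x = diagE y z + offE u := by
  obtain ⟨x, hx⟩ := x
  have hx' : tr x = 0 := hx
  rw [tr_apply] at hx'
  refine ⟨x.1 2, -x.1 1, x.2, ?_⟩
  apply toEnd_injective
  rw [map_add, toEnd_diagE, toEnd_offE, ← map_add, toEnd_apply]
  change 0 + L x = _
  rw [zero_add]
  congr 1
  refine Albert.ext' (fun i => ?_) (fun i => ?_)
  · fin_cases i <;> simp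
    linarith
  · simp

/-- Every element is the sum of its four components. -/
theorem exists_eq (a : LieE) : ∃ τ v y z u, a = triE τ + derE v + (diagE y z + offE u) := by
  obtain ⟨d, x⟩ := a
  obtain ⟨⟨τ, v⟩, h1⟩ := derEquiv.surjective d
  obtain ⟨y, z, u, h2⟩ := exists_eq_diagE_add_offE x
  refine ⟨τ, v, y, z, u, ?_⟩
  rw [← h2, ← h1, derEquiv_apply]
  change _ = ofDer (rho τ) + ofDer (iotaDer v) + _
  rw [← map_add]
  exact Prod.ext (add_zero _).symm (zero_add _).symm

theorem eq_zero_of_components {τ : tri} {v : Fin 3 → Octonion} {y z : ℝ} {u : Fin 3 → Octonion}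
    (h : triE τ + derE v + (diagE y z + offE u) = 0) :
    τ = 0 ∧ v = 0 ∧ y = 0 ∧ z = 0 ∧ u = 0 := by
  have h1 : rho τ + iotaDer v + ((y • 0 + z • 0) + 0) = 0 := congrArg Prod.fst h
  rw [smul_zero, smul_zero, add_zero, add_zero, add_zero] at h1
  obtain ⟨h2, h3⟩ := rho_add_iotaDer_eq_zero h1
  subst h2 h3
  have h4 := congrArg toEnd h
  rw [map_add, map_add, map_add, toEnd_diagE, toEnd_offE, (map_zero triE), (map_zero derE), map_zero toEnd, add_zero,
    zero_add, ← map_add] at h4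
  -- Evaluation at the unit recovers an element of `A₀` from its multiplication operator.
  have h5 := LinearMap.congr_fun h4 1
  rw [L_one] at h5
  have e1 := congrArg (fun w : Albert => w.1 1) h5
  have e2 := congrArg (fun w : Albert => w.1 2) h5
  simp at e1 e2
  refine ⟨rfl, rfl, e2, e1, funext fun i => ?_⟩
  have e3 := congrArg (fun w : Albert => w.2 i) h5
  simpa using e3

theorem components_inj {τ τ' : tri} {v v' : Fin 3 → Octonion} {y z y' z' : ℝ}
    {u u' : Fin 3 → Octonion}
    (h : triE τ + derE v + (diagE y z + offE u) = triE τ' + derE v' + (diagE y' z' + offE u')) :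
    τ = τ' ∧ v = v' ∧ y = y' ∧ z = z' ∧ u = u' := by
  have h' : triE (τ - τ') + derE (v - v') + (diagE (y - y') (z - z') + offE (u - u')) = 0 := by
    rw [← sub_eq_zero.2 h]
    simp only [map_sub, diagE]
    module
  obtain ⟨h1, h2, h3, h4, h5⟩ := eq_zero_of_components h'
  exact ⟨sub_eq_zero.1 h1, sub_eq_zero.1 h2, sub_eq_zero.1 h3, sub_eq_zero.1 h4, sub_eq_zero.1 h5⟩

theorem diagE_smul (r y z : ℝ) : r • diagE y z = diagE (r * y) (r * z) := by
  simp only [diagE]; module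

theorem diagE_zero : diagE 0 0 = 0 := by simp [diagE]

theorem mem_tSub {a : LieE} : a ∈ tSub ↔ a.2 = 0 := Iff.rfl
theorem mem_pSub {a : LieE} : a ∈ pSub ↔ a.1 = 0 := Iff.rfl

theorem triE_mem (τ : tri) : triE τ ∈ tSub := rfl
theorem derE_mem (v : Fin 3 → Octonion) : derE v ∈ tSub := rfl
theorem h4_mem : h 4 ∈ pSub := rfl
theorem h5_mem : h 5 ∈ pSub := rfl
theorem diagE_mem (y z : ℝ) : diagE y z ∈ pSub :=
  pSub.add_mem (pSub.smul_mem _ h4_mem) (pSub.smul_mem _ h5_mem)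

theorem exists_eq_of_mem_tSub {a : LieE} (ha : a ∈ tSub) : ∃ τ v, a = triE τ + derE v := by
  obtain ⟨d, x⟩ := a
  have hx : x = 0 := ha
  obtain ⟨⟨τ, v⟩, h1⟩ := derEquiv.surjective d
  refine ⟨τ, v, ?_⟩
  rw [← h1, hx, derEquiv_apply]
  change _ = ofDer (rho τ) + ofDer (iotaDer v)
  rw [← map_add]
  rfl

theorem exists_eq_of_mem_pSub {a : LieE} (ha : a ∈ pSub) : ∃ y z u, a = diagE y z + offE u := by
  obtain ⟨d, x⟩ := a
  have hd : d = 0 := ha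
  subst hd
  exact exists_eq_diagE_add_offE x

theorem isCompl_tSub_pSub : IsCompl tSub.toSubmodule pSub := by
  constructor
  · rw [Submodule.disjoint_def]
    intro a h1 h2
    exact Prod.ext h2 h1
  · rw [codisjoint_iff, eq_top_iff]
    rintro ⟨d, x⟩ -
    exact Submodule.mem_sup.2 ⟨(d, 0), rfl, (0, x), rfl, Prod.ext (add_zero _) (zero_add _)⟩

theorem finrank_tSub : Module.finrank ℝ tSub = 52 := by
  rw [← finrank_der]
  refine (LinearEquiv.finrank_eq (LinearEquiv.ofBijective
    (ofDer.codRestrict tSub.toSubmodule fun d => rfl) ⟨?_, ?_⟩)).symm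
  · intro d d' h
    exact congrArg (fun a : tSub => a.1.1) h
  · rintro ⟨⟨d, x⟩, hx⟩
    exact ⟨d, Subtype.ext (Prod.ext rfl (Eq.symm hx))⟩

theorem finrank_pSub : Module.finrank ℝ pSub = 26 := by
  rw [← finrank_A0]
  refine (LinearEquiv.finrank_eq (LinearEquiv.ofBijective
    (ofA0.codRestrict pSub fun d => rfl) ⟨?_, ?_⟩)).symm
  · intro d d' h
    exact congrArg (fun a : pSub => a.1.2) h
  · rintro ⟨⟨d, x⟩, hx⟩
    exact ⟨x, Subtype.ext (Prod.ext (Eq.symm hx) rfl)⟩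

theorem tSub_lie_pSub {a b : LieE} (ha : a ∈ tSub) (hb : b ∈ pSub) : ⁅a, b⁆ ∈ pSub := by
  have ha' : a.2 = 0 := ha
  have hb' : b.1 = 0 := hb
  change ⁅a.1, b.1⁆ + (⟨⁅L a.2, L b.2⁆, lie_L_mem a.2 b.2⟩ : Der) = 0
  rw [hb', lie_zero, zero_add]
  apply Subtype.ext
  simp [ha']

theorem pSub_lie_pSub {a b : LieE} (ha : a ∈ pSub) (hb : b ∈ pSub) : ⁅a, b⁆ ∈ tSub := by
  have ha' : a.1 = 0 := ha
  have hb' : b.1 = 0 := hb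
  change act a.1 b.2 - act b.1 a.2 = 0
  rw [ha', hb']
  apply Subtype.ext
  simp [act]

end LieE

end

section

open Octonion Albert

/-! ### The torus -/

namespace LieE

/-- The octonions `1, j, l, jl`. -/
def ev (m : Fin 4) : Octonion := e (![0, 2, 4, 6] m)

/-- The octonions `i, k, il, kl`. -/
def od (m : Fin 4) : Octonion := e (![1, 3, 5, 7] m)

theorem eq_of_q_ev_od {x y : Octonion} (h1 : ∀ m, q (ev m) x = q (ev m) y)
    (h2 : ∀ m, q (od m) x = q (od m) y) : x = y := by
  refine eq_of_q fun i => ?_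
  fin_cases i
  exacts [h1 0, h2 0, h1 1, h2 1, h1 2, h2 2, h1 3, h2 3]

theorem linearMap_ext_ev_od {M : Type*} [AddCommGroup M] [Module ℝ M] {f g : Octonion →ₗ[ℝ] M}
    (h1 : ∀ m, f (ev m) = g (ev m)) (h2 : ∀ m, f (od m) = g (od m)) : f = g := by
  refine linearMap_ext fun i => ?_
  fin_cases i
  exacts [h1 0, h2 0, h1 1, h2 1, h1 2, h2 2, h1 3, h2 3]

theorem q_ev_ev (m n : Fin 4) : q (ev m) (ev n) = if m = n then 2 else 0 := by
  simp only [ev, q_e_e]; fin_cases m <;> fin_cases n <;> rfl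

theorem q_od_od (m n : Fin 4) : q (od m) (od n) = if m = n then 2 else 0 := by
  simp only [od, q_e_e]; fin_cases m <;> fin_cases n <;> rfl

theorem q_ev_od (m n : Fin 4) : q (ev m) (od n) = 0 := by
  simp only [ev, od, q_e_e]; fin_cases m <;> fin_cases n <;> rfl

theorem q_od_ev (m n : Fin 4) : q (od m) (ev n) = 0 := by rw [q_comm, q_ev_od]

/-- The triality triples of `h₁, …, h₄`. -/
def tau (k : Fin 4) : tri := (1 / 2 : ℝ) • tBil (ev k) (od k)

/-- Twice the weights of the torus on the three copies of the octonions. -/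
def wt : Fin 3 → Fin 4 → Fin 4 → ℤ :=
  ![fun m k => if m = k then 2 else 0,
    ![![-1, -1, -1, 1], ![1, 1, -1, 1], ![1, -1, 1, 1], ![-1, 1, 1, 1]],
    ![![-1, 1, 1, -1], ![-1, 1, -1, 1], ![-1, -1, 1, 1], ![1, 1, 1, 1]]]

/-- In all three representations `h_m` really rotates the `m`-th plane, so the torus has no nonzero
fixed vector. -/
theorem wt_self_ne_zero (i : Fin 3) (m : Fin 4) : wt i m m ≠ 0 := by
  revert i m; decide

theorem tau_zero_ev (k m : Fin 4) : (tau k).1 0 (ev m) = (1 / 2 * wt 0 m k : ℝ) • od m := by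
  change (1 / 2 : ℝ) • t (ev k) (od k) 0 (ev m) = _
  rw [t_zero_apply, q_ev_ev, q_od_ev]
  by_cases h : m = k
  · simp [h, wt]
  · simp [h, Ne.symm h, wt]

theorem tau_zero_od (k m : Fin 4) : (tau k).1 0 (od m) = -(1 / 2 * wt 0 m k : ℝ) • ev m := by
  change (1 / 2 : ℝ) • t (ev k) (od k) 0 (od m) = _
  rw [t_zero_apply, q_od_od, q_ev_od]
  by_cases h : m = k
  · simp [h, wt]
  · simp [h, Ne.symm h, wt]

/-- The planes `⟨ev m, od m⟩` chosen for the vector representation remain stable in the two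
half-spin representations; the sign table `wt` is confirmed by direct multiplication. -/
theorem tau_one_ev (k m : Fin 4) : (tau k).1 1 (ev m) = (1 / 2 * wt 1 m k : ℝ) • od m := by
  change (1 / 2 : ℝ) • t (ev k) (od k) 1 (ev m) = _
  rw [t_one_apply, q_ev_od]
  fin_cases k <;> fin_cases m <;> refine ext' ?_ ?_ ?_ ?_ ?_ ?_ ?_ ?_ <;>
    simp [ev, od, wt, pmul_0, pmul_1, pmul_2, pmul_3, pmul_4, pmul_5, pmul_6, pmul_7]

theorem tau_two_ev (k m : Fin 4) : (tau k).1 2 (ev m) = (1 / 2 * wt 2 m k : ℝ) • od m := by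
  change (1 / 2 : ℝ) • t (ev k) (od k) 2 (ev m) = _
  rw [t_two_apply, q_ev_od]
  fin_cases k <;> fin_cases m <;> refine ext' ?_ ?_ ?_ ?_ ?_ ?_ ?_ ?_ <;>
    simp [ev, od, wt, pmul_0, pmul_1, pmul_2, pmul_3, pmul_4, pmul_5, pmul_6, pmul_7]

theorem tau_one_od (k m : Fin 4) : (tau k).1 1 (od m) = -(1 / 2 * wt 1 m k : ℝ) • ev m := by
  change (1 / 2 : ℝ) • t (ev k) (od k) 1 (od m) = _
  rw [t_one_apply, q_ev_od]
  fin_cases k <;> fin_cases m <;> refine ext' ?_ ?_ ?_ ?_ ?_ ?_ ?_ ?_ <;>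
    simp [ev, od, wt, pmul_0, pmul_1, pmul_2, pmul_3, pmul_4, pmul_5, pmul_6, pmul_7]

theorem tau_two_od (k m : Fin 4) : (tau k).1 2 (od m) = -(1 / 2 * wt 2 m k : ℝ) • ev m := by
  change (1 / 2 : ℝ) • t (ev k) (od k) 2 (od m) = _
  rw [t_two_apply, q_ev_od]
  fin_cases k <;> fin_cases m <;> refine ext' ?_ ?_ ?_ ?_ ?_ ?_ ?_ ?_ <;>
    simp [ev, od, wt, pmul_0, pmul_1, pmul_2, pmul_3, pmul_4, pmul_5, pmul_6, pmul_7]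

theorem tau_ev (i : Fin 3) (k m : Fin 4) :
    (tau k).1 i (ev m) = (1 / 2 * wt i m k : ℝ) • od m := by
  fin_cases i
  exacts [tau_zero_ev k m, tau_one_ev k m, tau_two_ev k m]

theorem tau_od (i : Fin 3) (k m : Fin 4) :
    (tau k).1 i (od m) = -(1 / 2 * wt i m k : ℝ) • ev m := by
  fin_cases i
  exacts [tau_zero_od k m, tau_one_od k m, tau_two_od k m]

end LieE

end

/-! ### Commutativity, independence and centralizer of the torus. -/

section

open Octonion Albert

namespace LieE

/-- Equivariance of `t` leaves multiples of `t_{od k, od k}` and `t_{ev k, ev k}`, and `t_{x,x} =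
0`. -/
theorem tau_lie_tau (j k : Fin 4) : ⁅triE (tau j), triE (tau k)⁆ = 0 := by
  have h1 : triE (tau k) = (1 / 2 : ℝ) • triE (tBil (ev k) (od k)) := by rw [tau, map_smul]
  rw [h1, lie_smul, triE_lie_tBil, tau_ev, tau_od]
  simp [tBil_self]

theorem h_castAdd (k : Fin 4) : h (k.castAdd 2) = triE (tau k) := by
  have : triE (tau k) = ofDer ((1 / 2 : ℝ) • rho (tBil (ev k) (od k))) := by
    change ofDer (rho ((1 / 2 : ℝ) • tBil (ev k) (od k))) = _
    rw [rho.map_smul]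
  rw [this]
  fin_cases k <;> rfl

theorem h_natAdd (k : Fin 2) : h (k.natAdd 4) = diagE (![1, 0] k) (![0, 1] k) := by
  fin_cases k
  · change h 4 = (1 : ℝ) • h 4 + (0 : ℝ) • h 5
    rw [zero_smul, add_zero, one_smul]
  · change h 5 = (0 : ℝ) • h 4 + (1 : ℝ) • h 5
    rw [zero_smul, zero_add, one_smul]

theorem h_comm (i j : Fin 6) : ⁅h i, h j⁆ = 0 := by
  have hd : ∀ y z τ, ⁅triE τ, diagE y z⁆ = 0 := fun y z τ => by
    rw [← lie_skew, diagE_lie_triE, neg_zero]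
  refine Fin.addCases (m := 4) (n := 2) (fun i => ?_) (fun i => ?_) i <;>
    refine Fin.addCases (m := 4) (n := 2) (fun j => ?_) (fun j => ?_) j
  · rw [h_castAdd, h_castAdd, tau_lie_tau]
  · rw [h_castAdd, h_natAdd, hd]
  · rw [h_castAdd, h_natAdd, diagE_lie_triE]
  · rw [h_natAdd, h_natAdd, diagE_lie_diagE]

theorem sum_tau_zero_ev (c : Fin 4 → ℝ) (m : Fin 4) :
    (∑ k, c k • tau k : tri).1 0 (ev m) = c m • od m := by
  have h1 : (∑ k, c k • tau k : tri).1 0 (ev m) = ∑ k, c k • (tau k).1 0 (ev m) := by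
    simp [Finset.sum_apply]
  rw [h1, Finset.sum_eq_single m]
  · simp [tau_ev, wt]
  · intro k _ hk
    simp [tau_ev, wt, hk.symm]
  · simp

theorem sum_tau_zero_od (c : Fin 4 → ℝ) (m : Fin 4) :
    (∑ k, c k • tau k : tri).1 0 (od m) = -c m • ev m := by
  have h1 : (∑ k, c k • tau k : tri).1 0 (od m) = ∑ k, c k • (tau k).1 0 (od m) := by
    simp [Finset.sum_apply]
  rw [h1, Finset.sum_eq_single m]
  · simp [tau_od, wt]
  · intro k _ hk
    simp [tau_od, wt, hk.symm]
  · simp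

theorem sum_tau_eq_zero {c : Fin 4 → ℝ} (h : ∑ k, c k • tau k = 0) : c = 0 := by
  funext m
  have h1 := sum_tau_zero_ev c m
  rw [h] at h1
  have h2 := congrArg (q (od m)) h1
  simpa [q_od_od] using h2.symm

theorem sum_h (w : Fin 6 → ℝ) : ∑ k, w k • h k =
    triE (∑ k : Fin 4, w (k.castAdd 2) • tau k) + diagE (w 4) (w 5) := by
  rw [Fin.sum_univ_add (a := 4) (b := 2), map_sum]
  simp only [h_castAdd, map_smul]
  rw [Fin.sum_univ_two]
  rfl

theorem linearIndependent_h : LinearIndependent ℝ h := by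
  rw [Fintype.linearIndependent_iff]
  intro w hw
  rw [sum_h] at hw
  have h0 : triE (∑ k : Fin 4, w (k.castAdd 2) • tau k) + derE 0
      + (diagE (w 4) (w 5) + offE 0) = 0 := by
    rw [map_zero, map_zero, add_zero, add_zero, hw]
  obtain ⟨h1, -, h2, h3, -⟩ := eq_zero_of_components h0
  have h4 := sum_tau_eq_zero h1
  refine Fin.addCases (m := 4) (n := 2) (fun i => congrFun h4 i) (fun i => ?_)
  fin_cases i
  exacts [h2, h3]

/-- A vector that is killed by the torus vanishes. -/
theorem eq_zero_of_tau {i : Fin 3} {x : Octonion} (hx : ∀ k, (tau k).1 i x = 0) : x = 0 := by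
  have hw : ∀ m, (wt i m m : ℝ) ≠ 0 := fun m => Int.cast_ne_zero.2 (wt_self_ne_zero i m)
  refine eq_of_q_ev_od (fun m => ?_) (fun m => ?_)
  · have h1 := (tau m).2.1 i (od m) x
    rw [hx, map_zero, add_zero, tau_od, map_smul, LinearMap.smul_apply, smul_eq_mul] at h1
    rw [map_zero]
    refine (mul_eq_zero.1 h1).resolve_left ?_
    simp [hw m]
  · have h1 := (tau m).2.1 i (ev m) x
    rw [hx, map_zero, add_zero, tau_ev, map_smul, LinearMap.smul_apply, smul_eq_mul] at h1
    rw [map_zero]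
    refine (mul_eq_zero.1 h1).resolve_left ?_
    simp [hw m]

/-- A triality triple that commutes with the torus lies in the torus. -/
theorem tri_eq_sum_tau {d : tri} (hd : ∀ k, ⁅triE (tau k), triE d⁆ = 0) :
    ∃ c : Fin 4 → ℝ, d = ∑ k, c k • tau k := by
  have hcomm : ∀ k x, (tau k).1 0 (d.1 0 x) = d.1 0 ((tau k).1 0 x) := by
    intro k x
    have h0 := hd k
    rw [triE_lie_triE] at h0
    have h1 : (⟨_, tri_lie (tau k).2 d.2⟩ : tri) = 0 := by
      refine (eq_zero_of_components (v := 0) (y := 0) (z := 0) (u := 0) ?_).1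
      rw [h0, map_zero, map_zero, diagE_zero]
      simp
    have h2 := LinearMap.congr_fun (congrFun (congrArg Subtype.val h1) 0) x
    simp only [LieRing.of_associative_ring_bracket] at h2
    exact sub_eq_zero.1 h2
  let c : Fin 4 → ℝ := fun m => 1 / 2 * q (od m) (d.1 0 (ev m))
  have hskew := d.2.1 0
  have hev : ∀ m, d.1 0 (ev m) = c m • od m := by
    intro m
    refine eq_of_q_ev_od (fun n => ?_) (fun n => ?_)
    · rw [map_smul, q_ev_od, smul_zero]
      by_cases hn : m = n
      · subst hn
        have := hskew (ev m) (ev m)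
        rw [q_comm] at this
        linarith
      · have h1 := congrArg (q (od n)) (hcomm n (ev m))
        rw [tau_ev] at h1
        have h2 := (tau n).2.1 0 (od n) (d.1 0 (ev m))
        rw [tau_od] at h2
        simp [wt, hn] at h1 h2
        linarith
    · rw [map_smul, q_od_od]
      by_cases hn : n = m
      · subst hn
        simp only [c, if_true, smul_eq_mul]
        ring
      · have h1 := congrArg (q (ev n)) (hcomm n (ev m))
        rw [tau_ev] at h1
        have h2 := (tau n).2.1 0 (ev n) (d.1 0 (ev m))
        rw [tau_ev] at h2
        simp [wt, hn, Ne.symm hn] at h1 h2 ⊢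
        linarith
  have hod : ∀ m, d.1 0 (od m) = -c m • ev m := by
    intro m
    have h1 := hcomm m (ev m)
    rw [hev, map_smul, tau_ev, tau_od] at h1
    simpa [wt] using h1.symm
  refine ⟨c, Subtype.ext (tri_ext d.2 (∑ k, c k • tau k : tri).2 ?_)⟩
  refine linearMap_ext_ev_od (fun m => ?_) (fun m => ?_)
  · rw [sum_tau_zero_ev, hev]
  · rw [sum_tau_zero_od, hod]

/-- The centralizer of `h₁, …, h₄`. -/
theorem exists_eq_of_tau_lie {a : LieE} (ha : ∀ k, ⁅triE (tau k), a⁆ = 0) :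
    ∃ (c : Fin 4 → ℝ) (y z : ℝ), a = triE (∑ k, c k • tau k) + diagE y z := by
  obtain ⟨τ, v, y, z, u, rfl⟩ := exists_eq a
  have hd : ∀ k, ⁅triE (tau k), diagE y z⁆ = 0 := fun k => by
    rw [← lie_skew, diagE_lie_triE, neg_zero]
  have key : ∀ k, ⁅triE (tau k), triE τ⁆ = 0 ∧ (∀ i, (tau k).1 i (v i) = 0) ∧
      ∀ i, (tau k).1 i (u i) = 0 := by
    intro k
    have h1 := ha k
    rw [lie_add, lie_add, lie_add, triE_lie_triE, triE_lie_derE, triE_lie_offE, hd] at h1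
    nth_rewrite 1 [← diagE_zero] at h1
    obtain ⟨h2, h3, -, -, h4⟩ := eq_zero_of_components h1
    refine ⟨?_, congrFun h3, congrFun h4⟩
    rw [triE_lie_triE, h2, map_zero]
  obtain ⟨c, rfl⟩ := tri_eq_sum_tau fun k => (key k).1
  have hv : v = 0 := funext fun i => eq_zero_of_tau fun k => (key k).2.1 i
  have hu : u = 0 := funext fun i => eq_zero_of_tau fun k => (key k).2.2 i
  exact ⟨c, y, z, by rw [hv, hu, map_zero, map_zero, add_zero, add_zero]⟩

theorem triE_sum_add_diagE (c : Fin 4 → ℝ) (y z : ℝ) :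
    triE (∑ k, c k • tau k) + diagE y z =
      ∑ k, (Fin.append c ![y, z] : Fin (4 + 2) → ℝ) k • (h : Fin (4 + 2) → LieE) k := by
  have := sum_h (Fin.append c ![y, z] : Fin (4 + 2) → ℝ)
  rw [this]
  simp only [Fin.append_left]
  rfl

theorem mem_span_of_h_lie {a : LieE} (ha : ∀ k, ⁅h k, a⁆ = 0) :
    a ∈ Submodule.span ℝ (Set.range h) := by
  obtain ⟨c, y, z, rfl⟩ := exists_eq_of_tau_lie fun k => by rw [← h_castAdd]; exact ha _
  rw [triE_sum_add_diagE]
  exact Submodule.sum_mem _ fun k _ => Submodule.smul_mem _ _ (Submodule.subset_span ⟨k, rfl⟩)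

end LieE

end

section

open Octonion Albert

/-! ### The Killing form -/

namespace Albert

/-- The trace form `tr(xy)`. -/
def trForm : LinearMap.BilinForm ℝ Albert := L.compr₂ tr

theorem trForm_apply (x y : Albert) : trForm x y = tr (L x y) := rfl

theorem trForm_comm (x y : Albert) : trForm x y = trForm y x := by
  rw [trForm_apply, trForm_apply, L_comm]

theorem trForm_self (x : Albert) : trForm x x = x.1 0 ^ 2 + x.1 1 ^ 2 + x.1 2 ^ 2 +
    8 * (Octonion.norm (x.2 0) + Octonion.norm (x.2 1) + Octonion.norm (x.2 2)) := by
  have hq : ∀ u : Octonion, q u u = 2 * Octonion.norm u := fun u => by rw [q_eq, norm_eq]; ring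
  simp only [trForm_apply, tr_apply, L_fst, Fin.isValue, zero_add, Fin.reduceAdd, hq]
  ring

theorem norm_nonneg' (u : Octonion) : 0 ≤ Octonion.norm u :=
  add_nonneg Quaternion.normSq_nonneg Quaternion.normSq_nonneg

theorem norm_pos {u : Octonion} (h : u ≠ 0) : 0 < Octonion.norm u := by
  refine lt_of_le_of_ne (norm_nonneg' u) fun h0 => h ?_
  have h0 := h0.symm
  rw [Octonion.norm, add_eq_zero_iff_of_nonneg Quaternion.normSq_nonneg Quaternion.normSq_nonneg,
    Quaternion.normSq_eq_zero, Quaternion.normSq_eq_zero] at h0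
  exact Prod.ext h0.1 h0.2

theorem trForm_pos (x : Albert) (hx : x ≠ 0) : 0 < trForm x x := by
  have n0 := norm_nonneg' (x.2 0)
  have n1 := norm_nonneg' (x.2 1)
  have n2 := norm_nonneg' (x.2 2)
  rw [trForm_self]
  refine lt_of_le_of_ne (by positivity) fun h => hx ?_
  have s0 := sq_nonneg (x.1 0)
  have s1 := sq_nonneg (x.1 1)
  have s2 := sq_nonneg (x.1 2)
  have hz : ∀ u : Octonion, Octonion.norm u = 0 → u = 0 := fun u hu => by
    by_contra h0
    exact (norm_pos h0).ne' hu
  refine ext' (fun i => ?_) (fun i => ?_)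
  · refine pow_eq_zero_iff (n := 2) two_ne_zero |>.1 ?_
    fin_cases i <;> simp only [Fin.zero_eta, Fin.mk_one, Fin.reduceFinMk] <;> linarith
  · refine hz _ ?_
    fin_cases i <;> simp only [Fin.zero_eta, Fin.mk_one, Fin.reduceFinMk] <;> linarith

end Albert

namespace LieE

/-- The trace vanishes on the image of a derivation; apply this to the product `x y`. -/
theorem trForm_toEnd_of_mem_tSub {a : LieE} (ha : a ∈ tSub) (x y : Albert) :
    trForm (toEnd a x) y = -1 * trForm x (toEnd a y) := by
  have e : toEnd a = (a.1 : Module.End ℝ Albert) := by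
    rw [toEnd_apply, mem_tSub.1 ha, Submodule.coe_zero, map_zero, add_zero]
  have h1 := tr_der a.1 (L x y)
  rw [der_apply_L a.1.2, map_add] at h1
  rw [e]
  simp only [trForm_apply]
  linarith

theorem trForm_toEnd_of_mem_pSub {a : LieE} (ha : a ∈ pSub) (x y : Albert) :
    trForm (toEnd a x) y = 1 * trForm x (toEnd a y) := by
  have e : toEnd a = L a.2 := by
    rw [toEnd_apply, mem_pSub.1 ha]
    exact zero_add _
  rw [e]
  simp only [trForm_apply]
  rw [L_comm a.2 x, tr_assoc, one_mul]

/-- The trace form of the representation on the Albert algebra. -/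
def repForm : LinearMap.BilinForm ℝ LieE :=
  (LinearMap.mul ℝ (Module.End ℝ Albert)).compr₂ (LinearMap.trace ℝ Albert) |>.compl₁₂ toEnd toEnd

theorem repForm_apply (a b : LieE) :
    repForm a b = LinearMap.trace ℝ Albert (toEnd a * toEnd b) := rfl

theorem repForm_comm (a b : LieE) : repForm a b = repForm b a := by
  rw [repForm_apply, repForm_apply, LinearMap.trace_mul_comm]

theorem repForm_lie (x y z : LieE) : repForm ⁅x, y⁆ z = -repForm y ⁅x, z⁆ := by
  simp only [repForm_apply, toEnd_lie, LieRing.of_associative_ring_bracket, sub_mul, mul_sub,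
    map_sub]
  rw [← mul_assoc (toEnd y) (toEnd z), LinearMap.trace_mul_comm ℝ (toEnd y * toEnd z)]
  simp only [mul_assoc]
  ring

theorem repForm_neg_of_mem_tSub {a : LieE} (ha : a ∈ tSub) (h0 : a ≠ 0) : repForm a a < 0 := by
  have := trace_sq_pos trForm trForm_comm trForm_pos (ε := -1) (by norm_num)
    (trForm_toEnd_of_mem_tSub ha) fun h => h0 (toEnd_injective (h.trans (map_zero _).symm))
  rw [repForm_apply]
  change LinearMap.trace ℝ Albert (toEnd a ∘ₗ toEnd a) < 0
  linarith

theorem repForm_pos_of_mem_pSub {a : LieE} (ha : a ∈ pSub) (h0 : a ≠ 0) : 0 < repForm a a := by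
  have := trace_sq_pos trForm trForm_comm trForm_pos (ε := 1) (by norm_num)
    (trForm_toEnd_of_mem_pSub ha) fun h => h0 (toEnd_injective (h.trans (map_zero _).symm))
  rw [repForm_apply]
  change 0 < LinearMap.trace ℝ Albert (toEnd a ∘ₗ toEnd a)
  linarith

/-- The projection onto `t`. -/
def projT : LieE →ₗ[ℝ] LieE := ofDer ∘ₗ LinearMap.fst ℝ Der A0

/-- The projection onto `p`. -/
def projP : LieE →ₗ[ℝ] LieE := ofA0 ∘ₗ LinearMap.snd ℝ Der A0

theorem projT_mem (a : LieE) : projT a ∈ tSub := rfl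
theorem projP_mem (a : LieE) : projP a ∈ pSub := rfl
theorem projT_add_projP (a : LieE) : projT a + projP a = a :=
  Prod.ext (add_zero _) (zero_add _)
theorem projT_of_mem {a : LieE} (h : a ∈ tSub) : projT a = a := Prod.ext rfl (Eq.symm h)
theorem projP_of_mem {a : LieE} (h : a ∈ pSub) : projP a = a := Prod.ext (Eq.symm h) rfl
theorem projP_of_mem_tSub {a : LieE} (h : a ∈ tSub) : projP a = 0 := Prod.ext rfl h
theorem projT_of_mem_pSub {a : LieE} (h : a ∈ pSub) : projT a = 0 := Prod.ext h rfl

theorem proj_lie_of_mem_tSub {x : LieE} (hx : x ∈ tSub) (y : LieE) :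
    projT ⁅x, y⁆ = ⁅x, projT y⁆ ∧ projP ⁅x, y⁆ = ⁅x, projP y⁆ := by
  have h1 : ⁅x, projT y⁆ ∈ tSub := tSub.lie_mem hx (projT_mem y)
  have h2 := tSub_lie_pSub hx (projP_mem y)
  have h : ⁅x, y⁆ = ⁅x, projT y⁆ + ⁅x, projP y⁆ := by rw [← lie_add, projT_add_projP]
  rw [h, map_add, map_add, projT_of_mem h1, projT_of_mem_pSub h2, projP_of_mem_tSub h1,
    projP_of_mem h2, add_zero, zero_add]
  exact ⟨rfl, rfl⟩

theorem proj_lie_of_mem_pSub {x : LieE} (hx : x ∈ pSub) (y : LieE) :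
    projT ⁅x, y⁆ = ⁅x, projP y⁆ ∧ projP ⁅x, y⁆ = ⁅x, projT y⁆ := by
  have h1 : ⁅x, projT y⁆ ∈ pSub := by
    rw [← lie_skew]; exact pSub.neg_mem (tSub_lie_pSub (projT_mem y) hx)
  have h2 := pSub_lie_pSub hx (projP_mem y)
  have h : ⁅x, y⁆ = ⁅x, projT y⁆ + ⁅x, projP y⁆ := by rw [← lie_add, projT_add_projP]
  rw [h, map_add, map_add, projT_of_mem h2, projT_of_mem_pSub h1, projP_of_mem_tSub h2,
    projP_of_mem h1, add_zero, zero_add]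
  exact ⟨rfl, rfl⟩

/-- The inner product for which `t` acts by skew and `p` by symmetric transformations. -/
def innerForm : LinearMap.BilinForm ℝ LieE :=
  repForm.compl₁₂ projP projP - repForm.compl₁₂ projT projT

theorem innerForm_apply (a b : LieE) :
    innerForm a b = repForm (projP a) (projP b) - repForm (projT a) (projT b) := rfl

theorem innerForm_comm (a b : LieE) : innerForm a b = innerForm b a := by
  rw [innerForm_apply, innerForm_apply, repForm_comm, repForm_comm (projT a)]

theorem innerForm_pos (a : LieE) (ha : a ≠ 0) : 0 < innerForm a a := by
  rw [innerForm_apply]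
  by_cases h1 : projT a = 0
  · have h2 : projP a ≠ 0 := fun h2 => ha (by rw [← projT_add_projP a, h1, h2, add_zero])
    have := repForm_pos_of_mem_pSub (projP_mem a) h2
    rw [h1, map_zero]
    linarith
  · have h3 := repForm_neg_of_mem_tSub (projT_mem a) h1
    by_cases h2 : projP a = 0
    · rw [h2, map_zero]
      linarith
    · have := repForm_pos_of_mem_pSub (projP_mem a) h2
      linarith

theorem innerForm_lie_of_mem_tSub {x : LieE} (hx : x ∈ tSub) (y z : LieE) :
    innerForm ⁅x, y⁆ z = -1 * innerForm y ⁅x, z⁆ := by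
  obtain ⟨h1, h2⟩ := proj_lie_of_mem_tSub hx y
  obtain ⟨h3, h4⟩ := proj_lie_of_mem_tSub hx z
  rw [innerForm_apply, innerForm_apply, h1, h2, h3, h4, repForm_lie, repForm_lie]
  ring

/-- For `x ∈ p` the operator `ad x` exchanges `t` and `p`, so the opposite signs on the two parts
turn the skewness of `repForm` into symmetry. -/
theorem innerForm_lie_of_mem_pSub {x : LieE} (hx : x ∈ pSub) (y z : LieE) :
    innerForm ⁅x, y⁆ z = 1 * innerForm y ⁅x, z⁆ := by
  obtain ⟨h1, h2⟩ := proj_lie_of_mem_pSub hx y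
  obtain ⟨h3, h4⟩ := proj_lie_of_mem_pSub hx z
  rw [innerForm_apply, innerForm_apply, h1, h2, h3, h4, repForm_lie, repForm_lie]
  ring

/-- An element of the centralizer of the torus that commutes with `ρ(ι_i(u))` vanishes. -/
theorem torus_eq_zero {τ : tri} {y z : ℝ} (h : ∀ u, ⁅triE τ + diagE y z, derE u⁆ = 0) :
    triE τ + diagE y z = 0 := by
  have key : ∀ u : Fin 3 → Octonion, (∀ i, τ.1 i (u i) = 0) ∧ ∀ i, -lam i y z • u i = 0 := by
    intro u
    have h1 := h u
    rw [add_lie, triE_lie_derE, diagE_lie_derE] at h1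
    have h2 := eq_zero_of_components (τ := 0) (v := fun i => τ.1 i (u i)) (y := 0) (z := 0)
      (u := fun i => -lam i y z • u i) (by rw [diagE_zero, map_zero, zero_add, zero_add, h1])
    exact ⟨congrFun h2.2.1, congrFun h2.2.2.2.2⟩
  -- Commuting with `ρ(ι₀(x))` for all `x` kills the first component, and triality the others. The
  -- diagonal part is killed since `lam 1` and `lam 2` are independent.
  have h0 : τ = 0 := Subtype.ext <| tri_eq_zero τ.2 <| LinearMap.ext fun x =>
    (key fun _ => x).1 0
  have hl : ∀ i, lam i y z = 0 := by
    intro i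
    have := (key fun _ => e 0).2 i
    have h3 := congrArg (q (e 0)) this
    simpa [q_e_e] using h3
  have l1 := hl 1
  have l2 := hl 2
  simp [lam] at l1 l2
  have hy : y = 0 := by linarith
  have hz : z = 0 := by linarith
  rw [h0, hy, hz, diagE_zero, map_zero, add_zero]

/-- A central element lies in the centralizer of the torus, where only torus and diagonal parts
survive. -/
theorem center_eq_zero (a : LieE) (ha : ∀ b : LieE, ⁅a, b⁆ = 0) : a = 0 := by
  obtain ⟨c, y, z, rfl⟩ := exists_eq_of_tau_lie (a := a) fun k => by rw [← lie_skew, ha, neg_zero]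
  exact torus_eq_zero fun u => ha _

theorem killingForm_neg_of_mem_tSub (x : LieE) (hx : x ∈ tSub) (h0 : x ≠ 0) :
    killingForm ℝ LieE x x < 0 := by
  have := killingForm_pos innerForm innerForm_comm innerForm_pos center_eq_zero (ε := -1)
    (by norm_num) h0 (innerForm_lie_of_mem_tSub hx)
  linarith

theorem killingForm_pos_of_mem_pSub (x : LieE) (hx : x ∈ pSub) (h0 : x ≠ 0) :
    0 < killingForm ℝ LieE x x := by
  have := killingForm_pos innerForm innerForm_comm innerForm_pos center_eq_zero (ε := 1)
    (by norm_num) h0 (innerForm_lie_of_mem_pSub hx)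
  linarith

theorem mem_tSub_or_mem_pSub_h (k : Fin 6) : h k ∈ tSub ∨ h k ∈ pSub := by
  refine Fin.addCases (m := 4) (n := 2) (fun i => ?_) (fun i => ?_) k
  · rw [h_castAdd]; exact Or.inl (triE_mem _)
  · rw [h_natAdd]; exact Or.inr (diagE_mem _ _)

/-- The elements `h_k` act semisimply. -/
theorem h_lie_eq_zero (k : Fin 6) (x : LieE) (hx : ⁅h k, ⁅h k, x⁆⁆ = 0) : ⁅h k, x⁆ = 0 := by
  by_contra h0
  -- For the inner product, `|[h_k, x]|² = ±⟨x, [h_k, [h_k, x]]⟩ = 0`.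
  have h1 := innerForm_pos _ h0
  rcases mem_tSub_or_mem_pSub_h k with hk | hk
  · rw [innerForm_lie_of_mem_tSub hk, hx, map_zero] at h1
    linarith
  · rw [innerForm_lie_of_mem_pSub hk, hx, map_zero] at h1
    linarith

instance : LieAlgebra.IsKilling ℝ LieE := by
  refine isKilling_of_forall fun x hx => ?_
  by_contra h0
  -- Subtracting the two equations cancels the mixed term, so `κ` takes the same value on both
  -- projections. The signs on `t` and `p` are opposite, hence both projections vanish;
  -- orthogonality of `t` and `p` is not needed.
  have hxT : killingForm ℝ LieE x (projT x) = 0 := hx _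
  have hxP : killingForm ℝ LieE x (projP x) = 0 := hx _
  rw [← projT_add_projP x, map_add, LinearMap.add_apply, projT_add_projP] at hxT hxP
  rw [LieModule.traceForm_comm ℝ LieE LieE (projP x) (projT x)] at hxT
  by_cases h1 : projT x = 0
  · have h2 : projP x ≠ 0 := fun h2 => h0 (by rw [← projT_add_projP x, h1, h2, add_zero])
    have h3 := killingForm_pos_of_mem_pSub _ (projP_mem x) h2
    rw [h1, map_zero, LinearMap.zero_apply] at hxP
    linarith
  · have h3 := killingForm_neg_of_mem_tSub _ (projT_mem x) h1
    by_cases h2 : projP x = 0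
    · rw [h2, map_zero] at hxT
      linarith
    · have h4 := killingForm_pos_of_mem_pSub _ (projP_mem x) h2
      linarith

theorem isCartanDecomposition : IsCartanDecomposition tSub pSub :=
  isCartanDecomposition_of_definite isCompl_tSub_pSub
    (fun _ hx _ hy => tSub_lie_pSub hx hy) (fun _ hx _ hy => pSub_lie_pSub hx hy)
    killingForm_neg_of_mem_tSub killingForm_pos_of_mem_pSub

theorem killingSignature_eq : killingSignature LieE = -26 := by
  rw [killingSignature_of_definite isCompl_tSub_pSub killingForm_neg_of_mem_tSub
    killingForm_pos_of_mem_pSub, finrank_pSub]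
  have : Module.finrank ℝ tSub.toSubmodule = 52 := finrank_tSub
  rw [this]
  norm_num

theorem center_tSub_eq_zero (a : tSub) (ha : ∀ b : tSub, ⁅a, b⁆ = 0) : a = 0 := by
  have ha' : ∀ b ∈ tSub, ⁅(a : LieE), b⁆ = 0 := fun b hb => congrArg Subtype.val (ha ⟨b, hb⟩)
  obtain ⟨c, y, z, e⟩ := exists_eq_of_tau_lie (a := a) fun k => by
    rw [← lie_skew, ha' _ (triE_mem _), neg_zero]
  refine Subtype.ext ?_
  rw [e]
  refine torus_eq_zero fun u => ?_
  rw [← e]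
  exact ha' _ (derE_mem u)

theorem isCompactLie_tSub : IsCompactLie tSub := by
  refine killingForm_neg_of_invariant
    ((-repForm).compl₁₂ tSub.toSubmodule.subtype tSub.toSubmodule.subtype) (fun x y => ?_)
    (fun x hx => ?_) center_tSub_eq_zero fun x y z => ?_
  · exact congrArg Neg.neg (repForm_comm _ _)
  · have := repForm_neg_of_mem_tSub x.2 fun h => hx (Subtype.ext h)
    exact neg_pos.2 this
  · exact congrArg Neg.neg (repForm_lie _ _ _)

instance : LieAlgebra.IsKilling ℝ tSub :=
  isKilling_of_forall fun x hx => by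
    by_contra h0
    have := isCompactLie_tSub x h0
    rw [hx] at this
    exact lt_irrefl _ this

end LieE

end

/-! ### Roots from real planes -/

section Planes

open LieAlgebra.IsKilling

variable {g : Type*} [LieRing g] [LieAlgebra ℝ g] [FiniteDimensional ℝ g] {n : ℕ} {h : Fin n → g}

/-- If a Lie algebra is spanned by a torus and common invariant real planes `⟨X_t, Y_t⟩`, then the
roots of the complexification are the eigenvalues on the vectors `X_t + i Y_t`. -/
theorem range_root_eq_of_planes (hcomm : ∀ i j, ⁅h i, h j⁆ = 0) (hli : LinearIndependent ℝ h)
    [LieAlgebra.IsKilling ℂ (ℂ ⊗[ℝ] g)]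
    [(complexify (LieSubalgebra.lieSpan ℝ g (Set.range h))).IsCartanSubalgebra]
    {T : Type*} {X Y : T → g} {u : Fin n → ℂ} (hu : ∀ k, u k ≠ 0) {v : T → Fin n → ℤ}
    (hX : ∀ t k, ⁅h k, X t⁆ = (u k * v t k).re • X t - (u k * v t k).im • Y t)
    (hY : ∀ t k, ⁅h k, Y t⁆ = (u k * v t k).im • X t + (u k * v t k).re • Y t)
    (hne : ∀ t, X t ≠ 0) (hv : ∀ t, v t ≠ 0) (hinv : ∀ t, ∃ t', X t' = X t ∧ Y t' = -Y t)
    (hspan : Submodule.span ℝ (Set.range h ∪ (Set.range X ∪ Set.range Y)) = ⊤) :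
    Set.range (rootSystem (complexify (LieSubalgebra.lieSpan ℝ g (Set.range h)))).root =
      torusWeight hcomm hli u '' Set.range v := by
  have hw := fun t => lie_cpl_eq_torusWeight_smul hcomm hli (hX t) (hY t)
  refine range_root_eq _ _ ?_ ?_
  · rintro _ ⟨_, ⟨t, rfl⟩, rfl⟩
    refine ⟨fun h0 => hv t ?_, cpl (X t) (Y t), fun h0 => hne t (cpl_eq_zero h0).1, hw t⟩
    exact torusWeight_injective hcomm hli hu (h0.trans (map_zero _).symm)
  · set W := (complexify (LieSubalgebra.lieSpan ℝ g (Set.range h))).toSubmodule ⊔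
      Submodule.span ℂ {z : ℂ ⊗[ℝ] g | ∃ φ ∈ torusWeight hcomm hli u '' Set.range v,
        ∀ x : complexify (LieSubalgebra.lieSpan ℝ g (Set.range h)), ⁅x, z⁆ = φ x • z} with hW
    have hc : ∀ t, cpl (X t) (Y t) ∈ W := fun t =>
      (le_sup_right : _ ≤ W) (Submodule.subset_span ⟨_, ⟨_, ⟨t, rfl⟩, rfl⟩, hw t⟩)
    -- It is enough to show that `W` contains all real vectors.
    let W' : Submodule ℝ g := (W.restrictScalars ℝ).comap (TensorProduct.mk ℝ ℂ g 1)
    have hW' : ∀ x, x ∈ W' ↔ (1 : ℂ) ⊗ₜ[ℝ] x ∈ W := fun x => Iff.rfl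
    have hle : Submodule.span ℝ (Set.range h ∪ (Set.range X ∪ Set.range Y)) ≤ W' := by
      have hXY : ∀ t, X t ∈ W' ∧ Y t ∈ W' := by
        intro t
        -- The conjugate index supplies `X - i Y`, so `X` and `Y` separately lie in the complex
        -- span.
        obtain ⟨t', h1, h2⟩ := hinv t
        have a1 := hc t
        have a2 := hc t'
        rw [h1, h2] at a2
        constructor
        · have e : (1 : ℂ) ⊗ₜ[ℝ] X t = (1 / 2 : ℂ) • (cpl (X t) (Y t) + cpl (X t) (-Y t)) := by
            simp only [cpl, TensorProduct.tmul_neg]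
            module
          rw [hW', e]
          exact W.smul_mem _ (W.add_mem a1 a2)
        · have e : (1 : ℂ) ⊗ₜ[ℝ] Y t =
              (-Complex.I / 2 : ℂ) • (cpl (X t) (Y t) - cpl (X t) (-Y t)) := by
            have e1 : Complex.I ⊗ₜ[ℝ] Y t = Complex.I • ((1 : ℂ) ⊗ₜ[ℝ] Y t) := by
              rw [TensorProduct.smul_tmul', smul_eq_mul, mul_one]
            have e2 : -Complex.I / 2 * (2 * Complex.I) = 1 := by
              linear_combination -Complex.I_mul_I
            have e3 : cpl (X t) (Y t) - cpl (X t) (-Y t) =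
                (2 * Complex.I) • ((1 : ℂ) ⊗ₜ[ℝ] Y t) := by
              simp only [cpl, TensorProduct.tmul_neg, e1]
              module
            rw [e3, smul_smul, e2, one_smul]
          rw [hW', e]
          exact W.smul_mem _ (W.sub_mem a1 a2)
      rw [Submodule.span_le]
      rintro x (⟨k, rfl⟩ | ⟨t, rfl⟩ | ⟨t, rfl⟩)
      · exact (le_sup_left : _ ≤ W)
          (tmul_mem_complexify (LieSubalgebra.subset_lieSpan ⟨k, rfl⟩))
      · exact (hXY t).1
      · exact (hXY t).2
    rw [hspan] at hle
    rw [eq_top_iff]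
    intro z _
    obtain ⟨x, y, rfl⟩ := exists_cpl z
    have hy : Complex.I ⊗ₜ[ℝ] y ∈ W := by
      have e1 : Complex.I ⊗ₜ[ℝ] y = Complex.I • ((1 : ℂ) ⊗ₜ[ℝ] y) := by
        rw [TensorProduct.smul_tmul', smul_eq_mul, mul_one]
      rw [e1]
      exact W.smul_mem _ (hle (Submodule.mem_top : y ∈ ⊤))
    exact W.add_mem (hle (Submodule.mem_top : x ∈ ⊤)) hy

end Planes

/-- Nonnegative integral combinations lie in the generated submonoid. -/
theorem sum_zsmul_mem_closure {Λ : Type*} [AddCommGroup Λ] {n : ℕ} (S : Fin n → Λ) {c : Fin n → ℤ}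
    (hc : ∀ j, 0 ≤ c j) : ∑ j, c j • S j ∈ AddSubmonoid.closure (Set.range S) := by
  refine sum_mem fun j _ => ?_
  obtain ⟨m, hm⟩ := Int.eq_ofNat_of_zero_le (hc j)
  rw [hm, natCast_zsmul]
  exact nsmul_mem (AddSubmonoid.subset_closure (Set.mem_range_self j)) m

section

open Octonion Albert

/-! ### The root vectors -/

namespace LieE

/-- The element `ρ(ι_i(x))`. -/
def derS (i : Fin 3) : Octonion →ₗ[ℝ] LieE := derE ∘ₗ LinearMap.single ℝ (fun _ => Octonion) i

/-- The element `ι_i(x)` of `A₀`. -/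
def offS (i : Fin 3) : Octonion →ₗ[ℝ] LieE := offE ∘ₗ LinearMap.single ℝ (fun _ => Octonion) i

theorem map_single (i : Fin 3) (f : Fin 3 → Octonion →ₗ[ℝ] Octonion) (x : Octonion) :
    (fun j => f j ((Pi.single i x : Fin 3 → Octonion) j)) = Pi.single i (f i x) := by
  funext j
  by_cases hj : j = i
  · subst hj; simp
  · simp [hj]

theorem triE_lie_derS (τ : tri) (i : Fin 3) (x : Octonion) :
    ⁅triE τ, derS i x⁆ = derS i (τ.1 i x) := by
  refine (triE_lie_derE τ (Pi.single i x)).trans ?_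
  rw [map_single]; rfl

theorem triE_lie_offS (τ : tri) (i : Fin 3) (x : Octonion) :
    ⁅triE τ, offS i x⁆ = offS i (τ.1 i x) := by
  refine (triE_lie_offE τ (Pi.single i x)).trans ?_
  rw [map_single]; rfl

theorem diagE_lie_derS (y z : ℝ) (i : Fin 3) (x : Octonion) :
    ⁅diagE y z, derS i x⁆ = -lam i y z • offS i x := by
  refine (diagE_lie_derE y z (Pi.single i x)).trans ?_
  rw [← map_smul]
  exact congrArg offE (map_single i (fun i => -lam i y z • LinearMap.id) x)

theorem diagE_lie_offS (y z : ℝ) (i : Fin 3) (x : Octonion) :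
    ⁅diagE y z, offS i x⁆ = -lam i y z • derS i x := by
  refine (diagE_lie_offE y z (Pi.single i x)).trans ?_
  rw [← map_smul]
  exact congrArg derE (map_single i (fun i => -lam i y z • LinearMap.id) x)

theorem derE_eq_sum (v : Fin 3 → Octonion) : derE v = ∑ i, derS i (v i) := by
  conv_lhs => rw [← LinearMap.sum_single_apply (fun _ : Fin 3 => Octonion) v, map_sum]
  rfl

theorem offE_eq_sum (v : Fin 3 → Octonion) : offE v = ∑ i, offS i (v i) := by
  conv_lhs => rw [← LinearMap.sum_single_apply (fun _ : Fin 3 => Octonion) v, map_sum]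
  rfl

/-- The parametrization `x ↦ ρ(ι_i(x)) + s ι_i(x)` of the restricted root spaces. -/
def rootS (i : Fin 3) (s : ℤˣ) : Octonion →ₗ[ℝ] LieE := derS i + ((s : ℤ) : ℝ) • offS i

theorem rootS_apply (i : Fin 3) (s : ℤˣ) (x : Octonion) :
    rootS i s x = derS i x + ((s : ℤ) : ℝ) • offS i x := rfl

theorem triE_lie_rootS (τ : tri) (i : Fin 3) (s : ℤˣ) (x : Octonion) :
    ⁅triE τ, rootS i s x⁆ = rootS i s (τ.1 i x) := by
  rw [rootS_apply, lie_add, lie_smul, triE_lie_derS, triE_lie_offS]; rfl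

theorem unit_sq (s : ℤˣ) : ((s : ℤ) : ℝ) * ((s : ℤ) : ℝ) = 1 := by
  rw [← Int.cast_mul, ← Units.val_mul, Int.units_mul_self]; simp

/-- The diagonal element swaps the two summands with a common factor `-lam`, and `s² = 1` makes the
combination with sign `s` an eigenvector. -/
theorem diagE_lie_rootS (y z : ℝ) (i : Fin 3) (s : ℤˣ) (x : Octonion) :
    ⁅diagE y z, rootS i s x⁆ = (-(s : ℤ) * lam i y z : ℝ) • rootS i s x := by
  rw [rootS_apply, lie_add, lie_smul, diagE_lie_derS, diagE_lie_offS, smul_add, smul_smul,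
    smul_smul, add_comm]
  congr 2
  · ring
  · linear_combination lam i y z * unit_sq s

theorem derS_injective (i : Fin 3) : Function.Injective (derS i) := by
  rw [← LinearMap.ker_eq_bot, LinearMap.ker_eq_bot']
  intro x hx
  have h := eq_zero_of_components (τ := 0) (v := Pi.single i x) (y := 0) (z := 0) (u := 0) (by
    rw [diagE_zero, map_zero, map_zero, add_zero, add_zero, zero_add]; exact hx)
  simpa using congrFun h.2.1 i

theorem rootS_injective (i : Fin 3) (s : ℤˣ) : Function.Injective (rootS i s) := by
  rw [← LinearMap.ker_eq_bot, LinearMap.ker_eq_bot']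
  intro x hx
  have h := eq_zero_of_components (τ := 0) (v := Pi.single i x) (y := 0) (z := 0)
    (u := ((s : ℤ) : ℝ) • Pi.single i x) (by
    rw [diagE_zero, map_zero, zero_add, zero_add, map_smul]; exact hx)
  simpa using congrFun h.2.1 i

theorem ev_ne_zero (m : Fin 4) : ev m ≠ 0 := fun h => by
  have := q_ev_ev m m
  rw [h] at this
  simp at this

/-- The first real root vector in `ρ(tri)`. -/
def triX (j k : Fin 4) (a b : ℤˣ) : LieE :=
  triE (tBil (ev j) (ev k)) - ((a : ℤ) * (b : ℤ) : ℝ) • triE (tBil (od j) (od k))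

/-- The second real root vector in `ρ(tri)`. -/
def triY (j k : Fin 4) (a b : ℤˣ) : LieE :=
  -(((a : ℤ) : ℝ) • triE (tBil (od j) (ev k)) + ((b : ℤ) : ℝ) • triE (tBil (ev j) (od k)))

/-- Twice the weights `± w_j ± w_k`. -/
def triWt (j k : Fin 4) (a b : ℤˣ) (m : Fin 4) : ℤ := a * wt 0 j m + b * wt 0 k m

theorem tau_lie_tBil (m : Fin 4) (x y : Octonion) : ⁅triE (tau m), triE (tBil x y)⁆ =
    triE (tBil ((tau m).1 0 x) y) + triE (tBil x ((tau m).1 0 y)) := triE_lie_tBil _ _ _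

/-- Behind the real formulas, `triX + i triY` is the complexified `t_{x,y}` with `x = ev j - i a od
j` and `y = ev k - i b od k`. These are eigenvectors of the torus with doubled weights `a * wt 0 j`
and `b * wt 0 k`, and the weights add. -/
theorem tau_lie_triX (j k : Fin 4) (a b : ℤˣ) (m : Fin 4) :
    ⁅triE (tau m), triX j k a b⁆ = -(1 / 2 * triWt j k a b m : ℝ) • triY j k a b := by
  have ha := unit_sq a
  have hb := unit_sq b
  simp only [triX, triY, lie_sub, lie_smul, tau_lie_tBil, tau_ev, tau_od, map_smul, LinearMap.smul_apply,
    triWt]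
  push_cast
  generalize triE (tBil (od j) (ev k)) = A
  generalize triE (tBil (ev j) (od k)) = B
  generalize ((a : ℤ) : ℝ) = a at *
  generalize ((b : ℤ) : ℝ) = b at *
  have hA : A = (a * a) • A := by rw [ha, one_smul]
  have hB : B = (b * b) • B := by rw [hb, one_smul]
  linear_combination (norm := module) (1 / 2 * (wt 0 j m : ℝ)) • hA + (1 / 2 * (wt 0 k m : ℝ)) • hB

theorem tau_lie_triY (j k : Fin 4) (a b : ℤˣ) (m : Fin 4) :
    ⁅triE (tau m), triY j k a b⁆ = (1 / 2 * triWt j k a b m : ℝ) • triX j k a b := by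
  have ha := unit_sq a
  have hb := unit_sq b
  simp only [triX, triY, lie_neg, lie_add, lie_smul, tau_lie_tBil, tau_ev, tau_od, map_smul, LinearMap.smul_apply,
    triWt]
  push_cast
  generalize triE (tBil (od j) (od k)) = A
  generalize triE (tBil (ev j) (ev k)) = B
  generalize ((a : ℤ) : ℝ) = a at *
  generalize ((b : ℤ) : ℝ) = b at *
  have hA : A = (a * a) • A := by rw [ha, one_smul]
  have hA' : A = (b * b) • A := by rw [hb, one_smul]
  linear_combination (norm := module) (-1 / 2 * b * (wt 0 j m : ℝ)) • hA + (-1 / 2 * a * (wt 0 k m : ℝ)) • hA'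

/-- The first component maps `ev j` to `2 ev k`: the `od` part contributes nothing there. -/
theorem triX_ne_zero {j k : Fin 4} (hjk : j ≠ k) (a b : ℤˣ) : triX j k a b ≠ 0 := by
  intro h
  have h1 : triX j k a b = triE (tBil (ev j) (ev k)
    - ((a : ℤ) * (b : ℤ) : ℝ) • tBil (od j) (od k)) := by rw [map_sub, map_smul]; rfl
  have h2 := (eq_zero_of_components (τ := tBil (ev j) (ev k)
    - ((a : ℤ) * (b : ℤ) : ℝ) • tBil (od j) (od k)) (v := 0) (y := 0) (z := 0) (u := 0) (by
    rw [diagE_zero, map_zero, map_zero, add_zero, add_zero, ← h1]; simpa using h)).1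
  have h3 := LinearMap.congr_fun (congrFun (congrArg Subtype.val h2) 0) (ev j)
  change t (ev j) (ev k) 0 (ev j) - ((a : ℤ) * (b : ℤ) : ℝ) • t (od j) (od k) 0 (ev j) = 0 at h3
  rw [t_zero_apply, t_zero_apply, q_ev_ev, q_ev_ev, q_od_ev, q_od_ev] at h3
  have h4 := congrArg (q (ev k)) h3
  simp [q_ev_ev, hjk.symm] at h4

theorem triX_neg (j k : Fin 4) (a b : ℤˣ) : triX j k (-a) (-b) = triX j k a b := by
  simp [triX]

theorem triY_neg (j k : Fin 4) (a b : ℤˣ) : triY j k (-a) (-b) = -triY j k a b := by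
  simp only [triY, Units.val_neg, Int.cast_neg]
  module

/-- The derivations in `ρ(tri)` are spanned by the torus and the root vectors. -/
theorem triE_mem_of_triX (W : Submodule ℝ LieE) (h0 : ∀ k, triE (tau k) ∈ W)
    (h1 : ∀ j k a b, j ≠ k → triX j k a b ∈ W ∧ triY j k a b ∈ W) (τ : tri) : triE τ ∈ W := by
  have key : ∀ x y : Octonion, triE (tBil x y) ∈ W := by
    have hs : ∀ x y, triE (tBil x y) ∈ W → triE (tBil y x) ∈ W := fun x y h => by
      rw [tBil_skew, map_neg]; exact W.neg_mem h
    have hee : ∀ j k, triE (tBil (ev j) (ev k)) ∈ W := by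
      intro j k
      by_cases hjk : j = k
      · rw [hjk, tBil_self, map_zero]; exact W.zero_mem
      -- Varying the relative sign separates the two terms of a root vector; the same device yields
      -- the `od`-`od` and mixed elements. Only `t_{ev k, od k}` is missed, and it is a torus
      -- element.
      · have e : triE (tBil (ev j) (ev k)) = (1 / 2 : ℝ) • (triX j k 1 1 + triX j k 1 (-1)) := by
          simp only [triX, Units.val_neg, Units.val_one, Int.cast_neg, Int.cast_one]
          module
        rw [e]
        exact W.smul_mem _ (W.add_mem (h1 _ _ _ _ hjk).1 (h1 _ _ _ _ hjk).1)
    have hoo : ∀ j k, triE (tBil (od j) (od k)) ∈ W := by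
      intro j k
      by_cases hjk : j = k
      · rw [hjk, tBil_self, map_zero]; exact W.zero_mem
      · have e : triE (tBil (od j) (od k)) = (1 / 2 : ℝ) • (triX j k 1 (-1) - triX j k 1 1) := by
          simp only [triX, Units.val_neg, Units.val_one, Int.cast_neg, Int.cast_one]
          module
        rw [e]
        exact W.smul_mem _ (W.sub_mem (h1 _ _ _ _ hjk).1 (h1 _ _ _ _ hjk).1)
    have heo : ∀ j k, triE (tBil (ev j) (od k)) ∈ W := by
      intro j k
      by_cases hjk : j = k
      · have e : triE (tBil (ev j) (od k)) = (2 : ℝ) • triE (tau k) := by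
          rw [tau, map_smul, smul_smul, hjk]; norm_num
        rw [e]
        exact W.smul_mem _ (h0 k)
      · have e : triE (tBil (ev j) (od k)) = (1 / 2 : ℝ) • (triY j k 1 (-1) - triY j k 1 1) := by
          simp only [triY, Units.val_neg, Units.val_one, Int.cast_neg, Int.cast_one]
          module
        rw [e]
        exact W.smul_mem _ (W.sub_mem (h1 _ _ _ _ hjk).2 (h1 _ _ _ _ hjk).2)
    have hlin : ∀ (f : Octonion →ₗ[ℝ] LieE), (∀ m, f (ev m) ∈ W) → (∀ m, f (od m) ∈ W) →
        ∀ x, f x ∈ W := by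
      intro f he ho x
      have : W.mkQ ∘ₗ f = 0 := linearMap_ext_ev_od
        (fun m => (Submodule.Quotient.mk_eq_zero W).2 (he m))
        (fun m => (Submodule.Quotient.mk_eq_zero W).2 (ho m))
      exact (Submodule.Quotient.mk_eq_zero W).1 (LinearMap.congr_fun this x)
    intro x y
    refine hlin (triE ∘ₗ tBil x) (fun m => ?_) (fun m => ?_) y
    · exact hs _ _ (hlin (triE ∘ₗ tBil (ev m)) (fun n => hee m n) (fun n => heo m n) x)
    · exact hs _ _ (hlin (triE ∘ₗ tBil (od m)) (fun n => hs _ _ (heo n m)) (fun n => hoo m n) x)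
  rw [tri_eq_sum τ, map_smul, map_sum]
  refine W.smul_mem _ (W.sum_mem fun a _ => ?_)
  rw [map_sum]
  refine W.sum_mem fun b _ => ?_
  rw [map_smul]
  exact W.smul_mem _ (key _ _)

end LieE

end

section

open Octonion Albert

namespace LieE

/-! ### The roots of type `E₆` -/

/-- Indices of the root vectors in `ρ(tri)`. -/
abbrev TriIndex : Type := {p : Fin 4 × Fin 4 × ℤˣ × ℤˣ // p.1 ≠ p.2.1}

/-- Indices of the root vectors of the complexification of `g`. -/
abbrev RootIndex : Type := TriIndex ⊕ (Fin 3 × Fin 4 × ℤˣ × ℤˣ)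

/-- Twice the restricted roots. -/
def offWt : Fin 3 → Fin 2 → ℤ := ![![1, 1], ![-2, 1], ![1, -2]]

/-- Real parts of root vectors. -/
def rootX : RootIndex → LieE :=
  Sum.elim (fun p => triX p.1.1 p.1.2.1 p.1.2.2.1 p.1.2.2.2) fun p => rootS p.1 p.2.2.2 (ev p.2.1)

/-- Imaginary parts of root vectors. -/
def rootY : RootIndex → LieE :=
  Sum.elim (fun p => triY p.1.1 p.1.2.1 p.1.2.2.1 p.1.2.2.2)
    fun p => (-((p.2.2.1 : ℤ) : ℝ)) • rootS p.1 p.2.2.2 (od p.2.1)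

/-- Twice the roots. -/
def rootWt : RootIndex → Fin 6 → ℤ :=
  Sum.elim (fun p => (Fin.append (triWt p.1.1 p.1.2.1 p.1.2.2.1 p.1.2.2.2) 0 : Fin (4 + 2) → ℤ))
    fun p => (Fin.append (fun k => p.2.2.1 * wt p.1 p.2.1 k) (fun l => p.2.2.2 * offWt p.1 l) :
      Fin (4 + 2) → ℤ)

/-- The scaling of the coordinates. -/
def rootScale : Fin 6 → ℂ :=
  (Fin.append (fun _ => Complex.I / 2) (fun _ => 1 / 2) : Fin (4 + 2) → ℂ)

theorem rootScale_ne_zero (k : Fin 6) : rootScale k ≠ 0 := by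
  refine Fin.addCases (m := 4) (n := 2) (fun i => ?_) (fun i => ?_) k
  · rw [rootScale, Fin.append_left]; simp
  · rw [rootScale, Fin.append_right]; simp

theorem rootScale_castAdd (k : Fin 4) (z : ℤ) : (rootScale (k.castAdd 2) * z).re = 0 ∧
    (rootScale (k.castAdd 2) * z).im = 1 / 2 * z := by
  rw [rootScale, Fin.append_left]; simp

theorem rootScale_natAdd (k : Fin 2) (z : ℤ) : (rootScale (k.natAdd 4) * z).re = 1 / 2 * z ∧
    (rootScale (k.natAdd 4) * z).im = 0 := by
  rw [rootScale, Fin.append_right]; simp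

theorem lam_offWt (i : Fin 3) (l : Fin 2) :
    lam i (![1, 0] l) (![0, 1] l) = -(1 / 2 * offWt i l) := by
  fin_cases i <;> fin_cases l <;> norm_num [lam, offWt]

theorem diagE_lie_triX (y z : ℝ) (j k : Fin 4) (a b : ℤˣ) :
    ⁅diagE y z, triX j k a b⁆ = 0 ∧ ⁅diagE y z, triY j k a b⁆ = 0 := by
  simp [triX, triY, diagE_lie_triE]

/-- Together with `h_lie_rootY` this says that `rootX + i rootY` is a common eigenvector. On `ι_i`
it is the image of `ev m - i a od m`; `h₁, …, h₄` contribute imaginary eigenvalues and `h₅, h₆` real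
ones. -/
theorem h_lie_rootX (t : RootIndex) (k : Fin 6) : ⁅h k, rootX t⁆ =
    (rootScale k * rootWt t k).re • rootX t - (rootScale k * rootWt t k).im • rootY t := by
  refine Fin.addCases (m := 4) (n := 2) (fun k => ?_) (fun k => ?_) k
  · rw [h_castAdd, (rootScale_castAdd _ _).1, (rootScale_castAdd _ _).2, zero_smul, zero_sub]
    rcases t with p | p
    · simp only [rootX, rootY, rootWt, Sum.elim_inl, Fin.append_left, tau_lie_triX]
      module
    · simp only [rootX, rootY, rootWt, Sum.elim_inr, Fin.append_left, triE_lie_rootS, tau_ev,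
        map_smul, smul_smul]
      rw [← neg_smul]
      congr 1
      push_cast
      linear_combination (-1 / 2 * wt p.1 p.2.1 k : ℝ) * unit_sq p.2.2.1
  · rw [h_natAdd, (rootScale_natAdd _ _).1, (rootScale_natAdd _ _).2, zero_smul, sub_zero]
    rcases t with p | p
    · simp only [rootX, rootWt, Sum.elim_inl, Fin.append_right, (diagE_lie_triX _ _ _ _ _ _).1]
      simp
    · simp only [rootX, rootWt, Sum.elim_inr, Fin.append_right, diagE_lie_rootS, lam_offWt]
      congr 1
      push_cast
      ring

theorem h_lie_rootY (t : RootIndex) (k : Fin 6) : ⁅h k, rootY t⁆ =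
    (rootScale k * rootWt t k).im • rootX t + (rootScale k * rootWt t k).re • rootY t := by
  refine Fin.addCases (m := 4) (n := 2) (fun k => ?_) (fun k => ?_) k
  · rw [h_castAdd, (rootScale_castAdd _ _).1, (rootScale_castAdd _ _).2, zero_smul, add_zero]
    rcases t with p | p
    · simp only [rootX, rootY, rootWt, Sum.elim_inl, Fin.append_left, tau_lie_triY]
    · simp only [rootX, rootY, rootWt, Sum.elim_inr, Fin.append_left, lie_smul, triE_lie_rootS,
        tau_od, map_smul, smul_smul]
      congr 1
      push_cast
      ring
  · rw [h_natAdd, (rootScale_natAdd _ _).1, (rootScale_natAdd _ _).2, zero_smul, zero_add]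
    rcases t with p | p
    · simp only [rootY, rootWt, Sum.elim_inl, Fin.append_right, (diagE_lie_triX _ _ _ _ _ _).2]
      simp
    · simp only [rootY, rootWt, Sum.elim_inr, Fin.append_right, lie_smul, diagE_lie_rootS,
        lam_offWt, smul_smul]
      congr 1
      push_cast
      ring

theorem rootX_ne_zero (t : RootIndex) : rootX t ≠ 0 := by
  rcases t with ⟨p, hp⟩ | p
  · exact triX_ne_zero hp _ _
  · exact fun h => ev_ne_zero _ (rootS_injective _ _ (h.trans (map_zero _).symm))

theorem rootWt_ne_zero (t : RootIndex) : rootWt t ≠ 0 := by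
  revert t; decide +kernel

/-- Complex conjugation flips the signs belonging to the compact torus and keeps the sign `s` of the
restricted root. -/
theorem exists_conj (t : RootIndex) : ∃ t', rootX t' = rootX t ∧ rootY t' = -rootY t := by
  rcases t with ⟨⟨j, k, a, b⟩, hp⟩ | ⟨i, m, a, s⟩
  · exact ⟨Sum.inl ⟨⟨j, k, -a, -b⟩, hp⟩, triX_neg _ _ _ _, triY_neg _ _ _ _⟩
  · refine ⟨Sum.inr ⟨i, m, -a, s⟩, rfl, ?_⟩
    simp [rootY]

theorem span_rootX :
    Submodule.span ℝ (Set.range h ∪ (Set.range rootX ∪ Set.range rootY)) = ⊤ := by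
  set W := Submodule.span ℝ (Set.range h ∪ (Set.range rootX ∪ Set.range rootY))
  have hh : ∀ k, h k ∈ W := fun k => Submodule.subset_span (Or.inl ⟨k, rfl⟩)
  have hX : ∀ t, rootX t ∈ W := fun t => Submodule.subset_span (Or.inr (Or.inl ⟨t, rfl⟩))
  have hY : ∀ t, rootY t ∈ W := fun t => Submodule.subset_span (Or.inr (Or.inr ⟨t, rfl⟩))
  have htri : ∀ τ, triE τ ∈ W := triE_mem_of_triX W (fun k => by rw [← h_castAdd]; exact hh _)
    fun j k a b hjk => ⟨hX (Sum.inl ⟨⟨j, k, a, b⟩, hjk⟩), hY (Sum.inl ⟨⟨j, k, a, b⟩, hjk⟩)⟩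
  have hS : ∀ i s x, rootS i s x ∈ W := by
    intro i s x
    have : W.mkQ ∘ₗ rootS i s = 0 := linearMap_ext_ev_od
      (fun m => (Submodule.Quotient.mk_eq_zero W).2 (hX (Sum.inr ⟨i, m, 1, s⟩)))
      (fun m => (Submodule.Quotient.mk_eq_zero W).2 (by
        have := hY (Sum.inr ⟨i, m, -1, s⟩)
        simpa [rootY] using this))
    exact (Submodule.Quotient.mk_eq_zero W).1 (LinearMap.congr_fun this x)
  have hder : ∀ i x, derS i x ∈ W := by
    intro i x
    have e : derS i x = (1 / 2 : ℝ) • (rootS i 1 x + rootS i (-1) x) := by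
      simp only [rootS_apply, Units.val_neg, Units.val_one, Int.cast_neg, Int.cast_one]
      module
    rw [e]
    exact W.smul_mem _ (W.add_mem (hS _ _ _) (hS _ _ _))
  have hoff : ∀ i x, offS i x ∈ W := by
    intro i x
    have e : offS i x = (1 / 2 : ℝ) • (rootS i 1 x - rootS i (-1) x) := by
      simp only [rootS_apply, Units.val_neg, Units.val_one, Int.cast_neg, Int.cast_one]
      module
    rw [e]
    exact W.smul_mem _ (W.sub_mem (hS _ _ _) (hS _ _ _))
  rw [eq_top_iff]
  intro a _
  obtain ⟨τ, v, y, z, u, rfl⟩ := exists_eq a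
  rw [derE_eq_sum, offE_eq_sum]
  exact W.add_mem (W.add_mem (htri τ) (W.sum_mem fun i _ => hder i _))
    (W.add_mem (W.add_mem (W.smul_mem _ (hh 4)) (W.smul_mem _ (hh 5)))
      (W.sum_mem fun i _ => hoff i _))

/-- The simple roots, with coordinates doubled. -/
def simpleWt : Fin 6 → Fin 6 → ℤ :=
  ![![-1, -1, -1, -1, 1, -2], ![-2, 2, 0, 0, 0, 0], ![2, 2, 0, 0, 0, 0], ![0, -2, 2, 0, 0, 0],
    ![0, 0, -2, 2, 0, 0], ![0, 0, 0, -2, 1, 1]]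

/-- The coefficients of a root in terms of the simple roots. -/
def simpleCoeff (v : Fin 6 → ℤ) : Fin 6 → ℤ :=
  -- Solves the linear system for the coefficients: the last two coordinates involve only `α₁` and
  -- `α₆`, after which one proceeds downwards. Here `s` and `r` are the sum and the difference of
  -- the coefficients of `α₃` and `α₂`.
  let a := (v 4 - v 5) / 3
  let f := (2 * v 4 + v 5) / 3
  let e := (v 3 + a + 2 * f) / 2
  let d := (v 2 + a + 2 * e) / 2
  let s := (v 1 + a + 2 * d) / 2
  let r := (v 0 + a) / 2
  ![a, (s - r) / 2, (s + r) / 2, d, e, f]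

/-- A finite check over the 96 indices; it also certifies that the integer divisions in
`simpleCoeff` are exact on roots. -/
theorem rootWt_eq_sum (t : RootIndex) :
    rootWt t = ∑ j, simpleCoeff (rootWt t) j • simpleWt j ∧
    ((∀ j, 0 ≤ simpleCoeff (rootWt t) j) ∨ ∀ j, 0 ≤ -simpleCoeff (rootWt t) j) := by
  revert t; decide +kernel

theorem simpleWt_mem (i : Fin 6) : ∃ t, rootWt t = simpleWt i := by
  revert i; decide +kernel

/-- The Cartan integer is minus the length of the `α_j`-string upwards from `α_i`; both its last
member and the first failure are found by enumeration. -/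
theorem simpleWt_string (i j : Fin 6) (hij : i ≠ j) :
    CartanMatrix.E₆ i j = -((-CartanMatrix.E₆ i j).toNat : ℤ) ∧
    (∃ t, rootWt t = simpleWt i + (-CartanMatrix.E₆ i j).toNat • simpleWt j) ∧
    ¬ ∃ t, rootWt t = simpleWt i + ((-CartanMatrix.E₆ i j).toNat + 1) • simpleWt j := by
  refine ⟨?_, ?_, ?_⟩
  · have := CartanMatrix.E₆_off_diag_nonpos i j hij
    omega
  · revert i j
    have : ∀ i j : Fin 6, i ≠ j →
      ∃ t, rootWt t = simpleWt i + (-CartanMatrix.E₆ i j).toNat • simpleWt j := by decide +kernel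
    exact this
  · revert i j
    have : ∀ i j : Fin 6, i ≠ j →
      ∀ t, rootWt t ≠ simpleWt i + ((-CartanMatrix.E₆ i j).toNat + 1) • simpleWt j := by
      decide +kernel
    exact fun i j hij ⟨t, ht⟩ => this i j hij t ht

end LieE

end

/-! ### The Cartan subalgebra, its roots and the base of type `E₆`. -/

section

open Octonion Albert LieAlgebra.IsKilling

namespace LieE

instance isKilling_complex : LieAlgebra.IsKilling ℂ (ℂ ⊗[ℝ] LieE) := isKilling_complexification

instance isCartanSubalgebra_hSub : (complexify hSub).IsCartanSubalgebra :=
  isCartanSubalgebra_complexify_lieSpan h_comm (fun _ => mem_span_of_h_lie) h_lie_eq_zero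

/-- The functional on the Cartan subalgebra that belongs to a weight. -/
def functional : (Fin 6 → ℤ) →+ Module.Dual ℂ (complexify hSub) :=
  torusWeight h_comm linearIndependent_h rootScale

theorem functional_injective : Function.Injective functional :=
  torusWeight_injective h_comm linearIndependent_h rootScale_ne_zero

theorem range_root : Set.range (rootSystem (complexify hSub)).root =
    functional '' Set.range rootWt :=
  haveI : (complexify (LieSubalgebra.lieSpan ℝ LieE (Set.range h))).IsCartanSubalgebra :=
    isCartanSubalgebra_hSub
  range_root_eq_of_planes h_comm linearIndependent_h rootScale_ne_zero h_lie_rootX h_lie_rootY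
    rootX_ne_zero rootWt_ne_zero exists_conj span_rootX

/-- The function of the coordinates `w_k` that belongs to a weight. -/
def weightFun (v : Fin 6 → ℤ) (w : Fin 6 → ℂ) : ℂ :=
  Complex.I / 2 * ∑ k : Fin 4, v (k.castAdd 2) * w (k.castAdd 2) + 1 / 2 * (v 4 * w 4 + v 5 * w 5)

theorem functional_hPt (v : Fin 6 → ℤ) (w : Fin 6 → ℂ) :
    functional v (hPt w) = weightFun v w := by
  refine (torusWeight_apply h_comm linearIndependent_h rootScale v w).trans ?_
  rw [weightFun, Fin.sum_univ_add (a := 4) (b := 2), Fin.sum_univ_two, Finset.mul_sum]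
  simp only [rootScale, Fin.append_left, Fin.append_right]
  rw [mul_add]
  congr 1
  · exact Finset.sum_congr rfl fun k _ => mul_assoc _ _ _
  · rw [← mul_assoc, ← mul_assoc]; rfl

/-- There is a base of simple roots. -/
theorem exists_base : ∃ (b : (rootSystem (complexify hSub)).Base) (f : Fin 6 ≃ b.support),
    (∀ j, (rootSystem (complexify hSub)).root (f j) =
      functional (simpleWt j)) ∧
      ∀ i j, b.cartanMatrix (f i) (f j) = CartanMatrix.E₆ i j := by
  refine exists_base_of_simple (rootSystem (complexify hSub))
    functional functional_injective (Set.range rootWt)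
    range_root ?_ simpleWt (fun i => simpleWt_mem i) ?_ _ (fun i => CartanMatrix.E₆_diag i)
    fun i j hij => ⟨_, simpleWt_string i j hij⟩
  · rw [Subspace.dual_finrank_eq]
    exact finrank_complexify_lieSpan h_comm linearIndependent_h
  · rintro _ ⟨t, rfl⟩
    obtain ⟨h1, h2⟩ := rootWt_eq_sum t
    rcases h2 with h2 | h2
    · left
      rw [h1]
      exact sum_zsmul_mem_closure _ h2
    · right
      have := sum_zsmul_mem_closure simpleWt h2
      rw [h1, ← Finset.sum_neg_distrib]
      simpa only [neg_smul] using this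

end LieE

end

/-! ### The roots as functions of the coordinates `w_k`. -/

section

open Octonion Albert LieAlgebra.IsKilling

namespace LieE

theorem weightFun_inl (p : TriIndex) : weightFun (rootWt (Sum.inl p)) = fun w =>
    Complex.I * (((p.1.2.2.1 : ℤ) : ℂ) * w (p.1.1.castAdd 2) +
      ((p.1.2.2.2 : ℤ) : ℂ) * w (p.1.2.1.castAdd 2)) := by
  funext w
  have h4 : rootWt (Sum.inl p) 4 = 0 := rfl
  have h5 : rootWt (Sum.inl p) 5 = 0 := rfl
  rw [weightFun, h4, h5]
  simp only [rootWt, Sum.elim_inl, Fin.append_left, triWt, wt, Matrix.cons_val_zero]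
  simp [add_mul, Finset.sum_add_distrib]
  ring

theorem weightFun_inr_zero (m : Fin 4) (a s : ℤˣ) :
    weightFun (rootWt (Sum.inr (0, m, a, s))) = fun w =>
      ((a : ℤ) : ℂ) * Complex.I * w (m.castAdd 2) + ((s : ℤ) : ℂ) * ((w 4 + w 5) / 2) := by
  funext w
  have h4 : rootWt (Sum.inr (0, m, a, s)) 4 = s * 1 := rfl
  have h5 : rootWt (Sum.inr (0, m, a, s)) 5 = s * 1 := rfl
  rw [weightFun, h4, h5]
  simp only [rootWt, Sum.elim_inr, Fin.append_left, wt, Matrix.cons_val_zero]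
  simp
  ring

/-- The index carries `-s` because the table `offWt` contains `(-2, 1)`, the negative of the `2 w₅ -
w₆` used in the list of roots. -/
theorem weightFun_inr_one {m : Fin 4} {a s : ℤˣ} {ε : Fin 4 → ℤˣ}
    (hε : ∀ k, (ε k : ℤ) = a * wt 1 m k) :
    weightFun (rootWt (Sum.inr (1, m, a, -s))) = fun w =>
      1 / 2 * (Complex.I * ∑ j, ((ε j : ℤ) : ℂ) * w (j.castAdd 2) +
        ((s : ℤ) : ℂ) * (2 * w 4 - w 5)) := by
  funext w
  have h4 : rootWt (Sum.inr (1, m, a, -s)) 4 = -s * -2 := rfl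
  have h5 : rootWt (Sum.inr (1, m, a, -s)) 5 = -s * 1 := rfl
  rw [weightFun, h4, h5]
  simp only [rootWt, Sum.elim_inr, Fin.append_left, ← hε]
  push_cast
  ring

theorem weightFun_inr_two {m : Fin 4} {a s : ℤˣ} {ε : Fin 4 → ℤˣ}
    (hε : ∀ k, (ε k : ℤ) = a * wt 2 m k) :
    weightFun (rootWt (Sum.inr (2, m, a, s))) = fun w =>
      1 / 2 * (Complex.I * ∑ j, ((ε j : ℤ) : ℂ) * w (j.castAdd 2) +
        ((s : ℤ) : ℂ) * (w 4 - 2 * w 5)) := by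
  funext w
  have h4 : rootWt (Sum.inr (2, m, a, s)) 4 = s * 1 := rfl
  have h5 : rootWt (Sum.inr (2, m, a, s)) 5 = s * -2 := rfl
  rw [weightFun, h4, h5]
  simp only [rootWt, Sum.elim_inr, Fin.append_left, ← hε]
  push_cast
  ring

/-- The four rows of the table and their negatives exhaust the eight sign vectors of odd parity;
`wt_two_signs` is the even half-spin analogue. -/
theorem wt_one_signs : (∀ (m : Fin 4) (a : ℤˣ), ∃ ε : Fin 4 → ℤˣ, ∏ j, ε j = -1 ∧
    ∀ k, (ε k : ℤ) = a * wt 1 m k) ∧ ∀ ε : Fin 4 → ℤˣ, ∏ j, ε j = -1 →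
      ∃ (m : Fin 4) (a : ℤˣ), ∀ k, (ε k : ℤ) = a * wt 1 m k := by
  constructor <;> decide +kernel

theorem wt_two_signs : (∀ (m : Fin 4) (a : ℤˣ), ∃ ε : Fin 4 → ℤˣ, ∏ j, ε j = 1 ∧
    ∀ k, (ε k : ℤ) = a * wt 2 m k) ∧ ∀ ε : Fin 4 → ℤˣ, ∏ j, ε j = 1 →
      ∃ (m : Fin 4) (a : ℤˣ), ∀ k, (ε k : ℤ) = a * wt 2 m k := by
  constructor <;> decide +kernel

theorem range_weightFun : (Set.range fun t => weightFun (rootWt t)) = rootFunctions := by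
  apply Set.Subset.antisymm
  · rintro _ ⟨t, rfl⟩
    rcases t with ⟨⟨j, k, a, b⟩, hjk⟩ | ⟨i, m, a, s⟩
    · exact Or.inl (Or.inl (Or.inl ⟨j, k, a, b, hjk, weightFun_inl _⟩))
    · fin_cases i
      · exact Or.inl (Or.inl (Or.inr ⟨m, a, s, weightFun_inr_zero m a s⟩))
      · obtain ⟨ε, h1, h2⟩ := wt_one_signs.1 m a
        have := weightFun_inr_one (s := -s) h2
        rw [neg_neg] at this
        exact Or.inl (Or.inr ⟨ε, -s, h1, this⟩)
      · obtain ⟨ε, h1, h2⟩ := wt_two_signs.1 m a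
        exact Or.inr ⟨ε, s, h1, weightFun_inr_two h2⟩
  · rintro φ (((⟨j, k, a, b, hjk, rfl⟩ | ⟨m, a, s, rfl⟩) | ⟨ε, s, h1, rfl⟩) | ⟨ε, s, h1, rfl⟩)
    · exact ⟨Sum.inl ⟨⟨j, k, a, b⟩, hjk⟩, weightFun_inl _⟩
    · exact ⟨_, weightFun_inr_zero m a s⟩
    · obtain ⟨m, a, h2⟩ := wt_one_signs.2 ε h1
      exact ⟨_, weightFun_inr_one h2⟩
    · obtain ⟨m, a, h2⟩ := wt_two_signs.2 ε h1
      exact ⟨_, weightFun_inr_two h2⟩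

theorem range_rootFunction :
    (Set.range fun i => fun w => (rootSystem (complexify hSub)).root i (hPt w)) =
      rootFunctions := by
  rw [← range_weightFun]
  have h1 : (Set.range fun i => fun w => (rootSystem (complexify hSub)).root i (hPt w)) =
      (fun (φ : Module.Dual ℂ (complexify hSub)) w => φ (hPt w)) ''
        Set.range (rootSystem (complexify hSub)).root := by
    rw [← Set.range_comp]; rfl
  rw [h1, range_root, ← Set.range_comp, ← Set.range_comp]
  congr 1
  funext t w
  exact functional_hPt _ _

theorem weightFun_simpleWt (j : Fin 6) (w : Fin 6 → ℂ) :
    weightFun (simpleWt j) w = simpleRoot j w := by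
  rw [weightFun, Fin.sum_univ_four]
  have h0 : Fin.castAdd 2 (0 : Fin 4) = (0 : Fin 6) := rfl
  have h1 : Fin.castAdd 2 (1 : Fin 4) = (1 : Fin 6) := rfl
  have h2 : Fin.castAdd 2 (2 : Fin 4) = (2 : Fin 6) := rfl
  have h3 : Fin.castAdd 2 (3 : Fin 4) = (3 : Fin 6) := rfl
  rw [h0, h1, h2, h3]
  fin_cases j <;> simp [simpleWt, simpleRoot] <;> ring

end LieE

end

section

open Octonion Albert LieAlgebra.IsKilling

namespace LieE

/-! ### The Satake diagram -/

theorem coe_aPt (y z : ℝ) : (aPt y z : LieE) = diagE y z := rfl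

theorem exists_eq_aPt (x : aSub) : ∃ y z, x = aPt y z := by
  obtain ⟨x, hx⟩ := x
  obtain ⟨z, y, hx⟩ := Submodule.mem_span_pair.1 hx
  refine ⟨y, z, Subtype.ext ?_⟩
  rw [coe_aPt, diagE, add_comm]
  exact hx.symm

theorem restrict_functional (v : Fin 6 → ℤ) (y z : ℝ) :
    restrict aSub_le (functional v) (aPt y z) = 1 / 2 * (v 4 * y + v 5 * z) := by
  have h1 := functional_hPt v (Fin.append (0 : Fin 4 → ℂ) ![(y : ℂ), (z : ℂ)])
  have h2 : weightFun v (Fin.append (0 : Fin 4 → ℂ) ![(y : ℂ), (z : ℂ)]) =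
      1 / 2 * (v 4 * y + v 5 * z) := by
    have h4 : (Fin.append (0 : Fin 4 → ℂ) ![(y : ℂ), (z : ℂ)]) (4 : Fin 6) = y := rfl
    have h5 : (Fin.append (0 : Fin 4 → ℂ) ![(y : ℂ), (z : ℂ)]) (5 : Fin 6) = z := rfl
    rw [weightFun, h4, h5]
    simp only [Fin.append_left]
    simp
  rw [← h2, ← h1]
  refine congrArg (functional v) (Subtype.ext ?_)
  refine Eq.trans ?_ (coe_torusMap (h := h) _).symm
  rw [Fin.sum_univ_add (a := 4) (b := 2), Fin.sum_univ_two]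
  simp only [Fin.append_left, Fin.append_right, Pi.zero_apply, zero_smul, Finset.sum_const_zero,
    zero_add]
  change (1 : ℂ) ⊗ₜ[ℝ] (diagE y z) = (y : ℂ) • (1 : ℂ) ⊗ₜ[ℝ] h 4 + (z : ℂ) • (1 : ℂ) ⊗ₜ[ℝ] h 5
  rw [diagE, TensorProduct.tmul_add, TensorProduct.tmul_smul, TensorProduct.tmul_smul,
    ← algebraMap_smul ℂ y, ← algebraMap_smul ℂ z]
  rfl

/-- Restriction to `a` forgets the four compact coordinates and nothing else. -/
theorem restrict_functional_eq_iff (v v' : Fin 6 → ℤ) :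
    restrict aSub_le (functional v) = restrict aSub_le (functional v') ↔
      v 4 = v' 4 ∧ v 5 = v' 5 := by
  constructor
  · intro h
    have h4 := LinearMap.congr_fun h (aPt 1 0)
    have h5 := LinearMap.congr_fun h (aPt 0 1)
    rw [restrict_functional, restrict_functional] at h4 h5
    simp at h4 h5
    exact ⟨h4, h5⟩
  · rintro ⟨h4, h5⟩
    ext x
    obtain ⟨y, z, rfl⟩ := exists_eq_aPt x
    rw [restrict_functional, restrict_functional, h4, h5]

theorem restrict_functional_eq_zero_iff (v : Fin 6 → ℤ) :
    restrict aSub_le (functional v) = 0 ↔ v 4 = 0 ∧ v 5 = 0 := by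
  have h0 : restrict aSub_le (functional 0) = 0 := by
    rw [map_zero]; rfl
  rw [← h0, restrict_functional_eq_iff]
  rfl

section Base

variable {b : (rootSystem (complexify hSub)).Base} {f : Fin 6 ≃ b.support}

theorem isAdaptedBase
    (hf : ∀ j, (rootSystem (complexify hSub)).root (f j) = functional (simpleWt j)) :
    IsAdaptedBase aSub_le b := by
  intro i hi
  set C := AddSubmonoid.closure ((rootSystem (complexify hSub)).root ''
    {j | j ∈ b.support ∧ restrict aSub_le ((rootSystem (complexify hSub)).root j) = 0})
  obtain ⟨_, ⟨t, rfl⟩, ht⟩ : (rootSystem (complexify hSub)).root i ∈ functional '' Set.range rootWt :=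
    range_root ▸ ⟨i, rfl⟩
  rw [← ht, restrict_functional_eq_zero_iff] at hi
  obtain ⟨h1, h2⟩ := rootWt_eq_sum t
  -- The coefficients of `α₁` and `α₆` depend only on the last two coordinates, so a root vanishing
  -- on `a` involves black simple roots only.
  have hc0 : simpleCoeff (rootWt t) 0 = 0 := by simp [simpleCoeff, hi.1, hi.2]
  have hc5 : simpleCoeff (rootWt t) 5 = 0 := by simp [simpleCoeff, hi.1, hi.2]
  have hz : ∀ j : Fin 6, j ≠ 0 → j ≠ 5 → simpleWt j 4 = 0 ∧ simpleWt j 5 = 0 := by decide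
  have hsum : ∀ c : Fin 6 → ℤ, c 0 = 0 → c 5 = 0 → (∀ j, 0 ≤ c j) →
      functional (∑ j, c j • simpleWt j) ∈ C := by
    intro c c0 c5 hc
    rw [map_sum]
    refine sum_mem fun j _ => ?_
    rw [map_zsmul]
    by_cases hj0 : j = 0
    · rw [hj0, c0, zero_zsmul]; exact zero_mem _
    by_cases hj5 : j = 5
    · rw [hj5, c5, zero_zsmul]; exact zero_mem _
    obtain ⟨m, hcm⟩ := Int.eq_ofNat_of_zero_le (hc j)
    rw [hcm, natCast_zsmul, ← hf]
    have hj : restrict aSub_le ((rootSystem (complexify hSub)).root (f j)) = 0 := by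
      rw [hf, restrict_functional_eq_zero_iff]
      exact hz j hj0 hj5
    have hm : (rootSystem (complexify hSub)).root (f j) ∈
        (rootSystem (complexify hSub)).root '' {j | j ∈ b.support ∧
          restrict aSub_le ((rootSystem (complexify hSub)).root j) = 0} :=
      ⟨f j, ⟨(f j).2, hj⟩, rfl⟩
    exact nsmul_mem (AddSubmonoid.subset_closure hm) m
  rw [← ht]
  rcases h2 with h2 | h2
  · left
    rw [h1]
    exact hsum _ hc0 hc5 h2
  · right
    have := hsum (fun j => -simpleCoeff (rootWt t) j) (by simp [hc0]) (by simp [hc5]) h2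
    rw [h1, ← map_neg, ← Finset.sum_neg_distrib]
    simpa only [neg_smul] using this

/-- The last two coordinates vanish for `α₂, …, α₅` and are `(1, -2)` and `(1, 1)` for `α₁` and
`α₆`; being different, these leave no room for an arrow. -/
theorem satakeDiagram_eq
    (hf : ∀ j, (rootSystem (complexify hSub)).root (f j) = functional (simpleWt j))
    (hA : ∀ i j, b.cartanMatrix (f i) (f j) = CartanMatrix.E₆ i j) :
    satakeDiagram aSub_le b f = satakeEIV := by
  have h1 : ∀ i : Fin 6, (simpleWt i 4 = 0 ∧ simpleWt i 5 = 0) ↔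
      i = 1 ∨ i = 2 ∨ i = 3 ∨ i = 4 := by decide
  have h2 : ∀ i j : Fin 6, i ≠ j → ¬ (simpleWt i 4 = 0 ∧ simpleWt i 5 = 0) →
      ¬ (simpleWt i 4 = simpleWt j 4 ∧ simpleWt i 5 = simpleWt j 5) := by decide
  refine SatakeDiagram.ext (Matrix.ext hA) (Set.ext fun i => ?_) ?_
  · change restrict aSub_le _ = 0 ↔ _
    rw [hf, restrict_functional_eq_zero_iff, h1]
    rfl
  · funext i j
    refine propext ⟨?_, False.elim⟩
    rintro ⟨hij, h3, -, h4⟩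
    rw [hf, Ne, restrict_functional_eq_zero_iff] at h3
    rw [hf, hf, restrict_functional_eq_iff] at h4
    exact h2 i j hij h3 h4

end Base

end LieE

end

/-! ### Root systems from an integral form. -/

/-- A finite subset of a lattice with an integral form is a reduced root system, if it is stable
under the reflections. -/
theorem isRootSystemWithBase_of_form {V Λ : Type*} [AddCommGroup V] [Module ℝ V]
    [FiniteDimensional ℝ V] [AddCommGroup Λ] (c : Λ →+ V) (hc : Function.Injective c)
    (R : Set Λ) (hfin : R.Finite) (B : V →ₗ[ℝ] Module.Dual ℝ V) (pr : Λ → Λ → ℤ)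
    (hpr : ∀ v ∈ R, ∀ w ∈ R, B (c v) (c w) = pr v w) (h2 : ∀ v ∈ R, pr v v = 2)
    (hrefl : ∀ v ∈ R, ∀ w ∈ R, w - pr v w • v ∈ R)
    (hred : ∀ v ∈ R, ∀ w ∈ R, pr v w * pr w v = 4 → v = w ∨ v = -w)
    {n : ℕ} (hdim : Module.finrank ℝ V = n) (S : Fin n → Λ) (hS : ∀ i, S i ∈ R)
    (hspan : Submodule.span ℝ (Set.range fun i => c (S i)) = ⊤)
    (hpos : ∀ v ∈ R, v ∈ AddSubmonoid.closure (Set.range S) ∨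
      -v ∈ AddSubmonoid.closure (Set.range S))
    (A : Matrix (Fin n) (Fin n) ℤ) (hA2 : ∀ i, A i i = 2)
    (hA : ∀ i j, i ≠ j → ∃ a : ℕ, A i j = -a ∧ S i + a • S j ∈ R ∧ S i + (a + 1) • S j ∉ R) :
    IsRootSystemWithBase (c '' R) (fun i => c (S i)) A := by
  have hfin' : Finite (c '' R) := (hfin.image c).to_subtype
  have hprR : ∀ φ ψ : c '' R, ∃ v ∈ R, ∃ w ∈ R, φ = c v ∧ ψ = c w ∧
      B φ ψ = pr v w := by
    rintro ⟨_, v, hv, rfl⟩ ⟨_, w, hw, rfl⟩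
    exact ⟨v, hv, w, hw, rfl, rfl, hpr v hv w hw⟩
  let root : c '' R ↪ V := Function.Embedding.subtype _
  have hBB : ∀ φ : c '' R, B φ φ = 2 := by
    rintro ⟨_, v, hv, rfl⟩
    rw [hpr v hv v hv, h2 v hv]
    norm_num
  have hs : ∀ i : c '' R, Set.MapsTo (Module.preReflection (root i)
      ((Module.Dual.eval ℝ V).flip (B i))) (Set.range root) (Set.range root) := by
    rintro ⟨_, v, hv, rfl⟩ _ ⟨⟨_, w, hw, rfl⟩, rfl⟩
    refine ⟨⟨_, _, hrefl v hv w hw, rfl⟩, ?_⟩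
    rw [Module.preReflection_apply]
    change c (w - pr v w • v) = c w - B (c v) (c w) • c v
    rw [hpr v hv w hw, map_sub, map_zsmul, Int.cast_smul_eq_zsmul]
  -- Equal coroots have pairing `2` both ways, so the product is `4` and the roots agree up to sign;
  -- opposite roots would force `2 = -2`.
  have hinj : Function.Injective fun φ : c '' R => B φ := by
    rintro φ ψ hφψ
    obtain ⟨v, hv, w, hw, e1, e2, -⟩ := hprR φ ψ
    have hφψ : B φ = B ψ := hφψ
    have a1 := hBB φ
    have a2 := hBB ψ
    have b1 : B φ ψ = 2 := by rw [hφψ, a2]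
    have b2 : B ψ φ = 2 := by rw [← hφψ, a1]
    rw [e1, e2, hpr v hv w hw] at b1
    rw [e1, e2, hpr w hw v hv] at b2
    have b1 : pr v w = 2 := by exact_mod_cast b1
    have b2 : pr w v = 2 := by exact_mod_cast b2
    rcases hred v hv w hw (by rw [b1, b2]; norm_num) with h | h
    · exact Subtype.ext (by rw [e1, e2, h])
    · rw [e1, e2, h, map_neg, map_neg] at hφψ
      have := congrArg (fun l => l (c w)) hφψ
      simp only [LinearMap.neg_apply, hpr w hw w hw, h2 w hw] at this
      norm_num at this
  let coroot : c '' R ↪ Module.Dual ℝ V := ⟨fun φ => B φ, hinj⟩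
  have hsp : Submodule.span ℝ (Set.range root) = ⊤ := by
    rw [eq_top_iff, ← hspan]
    refine Submodule.span_mono ?_
    rintro _ ⟨i, rfl⟩
    exact ⟨⟨_, S i, hS i, rfl⟩, rfl⟩
  -- Since all roots have `B`-length two, `B φ` itself serves as the coroot of `φ`.
  let P : RootPairing (c '' R) ℝ V (Module.Dual ℝ V) :=
    RootPairing.mk'' (Module.Dual.eval ℝ V) root coroot hBB hs hsp
  have hpair : ∀ i j, P.pairing i j = B j i := fun i j => rfl
  have hint : ∀ i j, ∃ z : ℤ, z = P.pairing i j := by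
    intro i j
    obtain ⟨v, hv, w, hw, -, -, e⟩ := hprR j i
    exact ⟨_, ((hpair i j).trans e).symm⟩
  have hsys : P.IsRootSystem := RootPairing.isRootSystem_mk'' hint
  have hcry : P.IsCrystallographic := ⟨hint⟩
  have hredP : P.IsReduced := by
    refine ⟨fun φ ψ h => ?_⟩
    rw [P.linearIndependent_iff_coxeterWeight_ne_four, not_not, RootPairing.coxeterWeight,
      hpair, hpair] at h
    obtain ⟨v, hv, w, hw, e1, e2, e⟩ := hprR φ ψ
    have e' : B ψ φ = pr w v := by rw [e1, e2, hpr w hw v hv]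
    rw [e, e'] at h
    have h' : pr v w * pr w v = 4 := by
      rw [mul_comm]; exact_mod_cast h
    change (φ : V) = ψ ∨ (φ : V) = -ψ
    rw [e1, e2, ← map_neg]
    exact (hred v hv w hw h').imp (congrArg c) (congrArg c)
  obtain ⟨b, f, hf, hb⟩ := exists_base_of_simple P c hc R
    ((Subtype.range_coe : Set.range (Subtype.val : c '' R → V) = c '' R)) hdim S hS hpos A hA2 hA
  refine ⟨P, rfl, hsys, hcry, hredP, fun _ => rfl, b, f, hf, fun i j => ?_⟩
  rw [← hb]
  exact (b.algebraMap_cartanMatrixIn_apply ℤ (f i) (f j)).symm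

section

open Octonion Albert LieAlgebra.IsKilling

namespace LieE

/-! ### The restricted roots -/

/-- The coordinate `w₅` on `a`. -/
def aFst : Module.Dual ℝ aSub where
  toFun x := ((x : LieE).2 : Albert).1 2
  map_add' _ _ := rfl
  map_smul' _ _ := rfl

/-- The coordinate `w₆` on `a`. -/
def aSnd : Module.Dual ℝ aSub where
  toFun x := -((x : LieE).2 : Albert).1 1
  map_add' x y := neg_add (((x : LieE).2 : Albert).1 1) (((y : LieE).2 : Albert).1 1)
  map_smul' r x := (mul_neg r (((x : LieE).2 : Albert).1 1)).symm

theorem aFst_aPt (y z : ℝ) : aFst (aPt y z) = y := by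
  change (y • (E 2 - E 0) + z • (E 0 - E 1) : Albert).1 2 = y
  simp

theorem aSnd_aPt (y z : ℝ) : aSnd (aPt y z) = z := by
  change -(y • (E 2 - E 0) + z • (E 0 - E 1) : Albert).1 1 = z
  simp

/-- The functional on `a` with coefficients `v / 2`. -/
def aWeight : (Fin 2 → ℤ) →+ Module.Dual ℝ aSub where
  toFun v := (1 / 2 * v 0 : ℝ) • aFst + (1 / 2 * v 1 : ℝ) • aSnd
  map_zero' := by simp
  map_add' v w := by
    simp only [Pi.add_apply]
    push_cast
    module

theorem aWeight_aPt (v : Fin 2 → ℤ) (y z : ℝ) :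
    aWeight v (aPt y z) = 1 / 2 * (v 0 * y + v 1 * z) := by
  change (1 / 2 * v 0 : ℝ) • aFst (aPt y z) + (1 / 2 * v 1 : ℝ) • aSnd (aPt y z) = _
  rw [aFst_aPt, aSnd_aPt, smul_eq_mul, smul_eq_mul]
  ring

theorem aDual_ext {l l' : Module.Dual ℝ aSub} (h : ∀ y z, l (aPt y z) = l' (aPt y z)) : l = l' := by
  ext x
  obtain ⟨y, z, rfl⟩ := exists_eq_aPt x
  exact h y z

theorem aDual_eq (l : Module.Dual ℝ aSub) : l = l (aPt 1 0) • aFst + l (aPt 0 1) • aSnd := by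
  refine aDual_ext fun y z => ?_
  have : aPt y z = y • aPt 1 0 + z • aPt 0 1 := by simp only [aPt]; module
  rw [LinearMap.add_apply, LinearMap.smul_apply, LinearMap.smul_apply, aFst_aPt, aSnd_aPt]
  nth_rewrite 1 [this]
  rw [map_add, map_smul, map_smul, smul_eq_mul, smul_eq_mul, smul_eq_mul, smul_eq_mul]
  ring

theorem aWeight_injective : Function.Injective aWeight := by
  intro v w h
  have h0 := LinearMap.congr_fun h (aPt 1 0)
  have h1 := LinearMap.congr_fun h (aPt 0 1)
  rw [aWeight_aPt, aWeight_aPt] at h0 h1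
  simp at h0 h1
  funext k
  fin_cases k
  exacts [h0, h1]

/-- Twice the restricted roots. -/
def restrictedWt (p : Fin 3 × ℤˣ) (l : Fin 2) : ℤ := p.2 * offWt p.1 l

theorem aWeight_restrictedWt (p : Fin 3 × ℤˣ) (y z : ℝ) :
    aWeight (restrictedWt p) (aPt y z) = -(p.2 : ℤ) * lam p.1 y z := by
  rw [aWeight_aPt]
  obtain ⟨i, s⟩ := p
  simp only [restrictedWt]
  push_cast
  fin_cases i <;> simp [offWt, lam] <;> ring

theorem rootS_mem (p : Fin 3 × ℤˣ) (x : Octonion) :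
    rootS p.1 p.2 x ∈ restrictedRootSpace aSub (aWeight (restrictedWt p)) := by
  intro a
  obtain ⟨y, z, rfl⟩ := exists_eq_aPt a
  rw [coe_aPt, diagE_lie_rootS, aWeight_restrictedWt]

/-- The bracket with `a` kills the torus and diagonal parts, and `v_i + s u_i` is twice the
coefficient of the element along the eigenvectors `rootS i s`. A component whose eigenvalue differs
from `l` must vanish. -/
theorem components_of_mem_restrictedRootSpace {l : Module.Dual ℝ aSub} {τ : tri}
    {v : Fin 3 → Octonion} {y z : ℝ} {u : Fin 3 → Octonion}
    (h : triE τ + derE v + (diagE y z + offE u) ∈ restrictedRootSpace aSub l) :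
    (l ≠ 0 → triE τ + diagE y z = 0) ∧
      ∀ p : Fin 3 × ℤˣ, l ≠ aWeight (restrictedWt p) → v p.1 + ((p.2 : ℤ) : ℝ) • u p.1 = 0 := by
  have key : ∀ y' z', l (aPt y' z') • τ = 0 ∧ l (aPt y' z') * y = 0 ∧ l (aPt y' z') * z = 0 ∧
      ∀ i, -lam i y' z' • u i = l (aPt y' z') • v i ∧ -lam i y' z' • v i = l (aPt y' z') • u i := by
    intro y' z'
    have h1 := h (aPt y' z')
    have h2 : triE 0 + derE (fun i => -lam i y' z' • u i) +
        (diagE 0 0 + offE (fun i => -lam i y' z' • v i)) =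
        triE (l (aPt y' z') • τ) + derE (l (aPt y' z') • v) +
        (diagE (l (aPt y' z') * y) (l (aPt y' z') * z) + offE (l (aPt y' z') • u)) := by
      rw [coe_aPt, lie_add, lie_add, lie_add, diagE_lie_triE, diagE_lie_derE, diagE_lie_diagE,
        diagE_lie_offE] at h1
      rw [map_smul, map_smul, map_smul, ← diagE_smul, map_zero, diagE_zero]
      simp only [smul_add] at h1
      rw [← h1]
      abel
    obtain ⟨a1, a2, a3, a4, a5⟩ := components_inj h2
    exact ⟨a1.symm, a3.symm, a4.symm, fun i => ⟨congrFun a2 i, congrFun a5 i⟩⟩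
  constructor
  · intro hl
    have : ∃ y' z', l (aPt y' z') ≠ 0 := by
      by_contra! hc
      exact hl (aDual_ext fun y z => hc y z)
    obtain ⟨y', z', hc⟩ := this
    obtain ⟨h1, h2, h3, -⟩ := key y' z'
    rw [(smul_eq_zero.1 h1).resolve_left hc, (mul_eq_zero.1 h2).resolve_left hc,
      (mul_eq_zero.1 h3).resolve_left hc, map_zero, diagE_zero, add_zero]
  · rintro p hp
    by_contra h0
    refine hp (aDual_ext fun y' z' => ?_)
    obtain ⟨h1, h2⟩ := (key y' z').2.2.2 p.1
    -- Adding `s` times the second eigenvalue equation to the first diagonalizes the swap of `u` and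
    -- `v`.
    have h3 : (l (aPt y' z') - -(p.2 : ℤ) * lam p.1 y' z') •
        (v p.1 + ((p.2 : ℤ) : ℝ) • u p.1) = 0 := by
      have hs : u p.1 = (((p.2 : ℤ) : ℝ) * ((p.2 : ℤ) : ℝ)) • u p.1 := by rw [unit_sq, one_smul]
      linear_combination (norm := module) -h1 - ((p.2 : ℤ) : ℝ) • h2 - lam p.1 y' z' • hs
    rw [aWeight_restrictedWt]
    exact sub_eq_zero.1 ((smul_eq_zero.1 h3).resolve_right h0)

theorem restrictedWt_injective : Function.Injective restrictedWt := by
  have : ∀ p p', (∀ l, restrictedWt p l = restrictedWt p' l) → p = p' := by decide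
  exact fun p p' h => this p p' (congrFun h)

theorem restrictedRootSpace_eq_range (p : Fin 3 × ℤˣ) :
    restrictedRootSpace aSub (aWeight (restrictedWt p)) = LinearMap.range (rootS p.1 p.2) := by
  apply le_antisymm
  · intro a ha
    obtain ⟨τ, v, y, z, u, rfl⟩ := exists_eq a
    obtain ⟨h1, h2⟩ := components_of_mem_restrictedRootSpace ha
    have hne : aWeight (restrictedWt p) ≠ 0 := fun h0 => by
      have h3 : restrictedWt p = 0 := aWeight_injective (h0.trans (map_zero _).symm)
      have h4 : ∀ p, restrictedWt p 0 ≠ 0 := by decide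
      exact h4 p (congrFun h3 0)
    have h2' : ∀ p', p ≠ p' → v p'.1 + ((p'.2 : ℤ) : ℝ) • u p'.1 = 0 := fun p' hp' =>
      h2 p' fun h3 => hp' (restrictedWt_injective (aWeight_injective h3))
    have hv : v = Pi.single p.1 (v p.1) := by
      funext i
      by_cases hi : i = p.1
      · subst hi; simp
      · rw [Pi.single_eq_of_ne hi]
        have e1 := h2' (i, 1) fun h => hi (congrArg Prod.fst h).symm
        have e2 := h2' (i, -1) fun h => hi (congrArg Prod.fst h).symm
        simp only [Units.val_neg, Units.val_one, Int.cast_neg, Int.cast_one] at e1 e2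
        linear_combination (norm := module) (1 / 2 : ℝ) • e1 + (1 / 2 : ℝ) • e2
    -- On the distinguished index only the component of the opposite sign is known to vanish, which
    -- is the equation of the graph; on the other indices both signs vanish.
    have hu : u = ((p.2 : ℤ) : ℝ) • v := by
      funext i
      rw [Pi.smul_apply]
      by_cases hi : i = p.1
      · subst hi
        have e1 := h2' (p.1, -p.2) fun h => by
          have := congrArg Prod.snd h
          exact (by decide : ∀ s : ℤˣ, s ≠ -s) p.2 this
        simp only [Units.val_neg, Int.cast_neg] at e1
        have hs : u p.1 = (((p.2 : ℤ) : ℝ) * ((p.2 : ℤ) : ℝ)) • u p.1 := by rw [unit_sq, one_smul]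
        linear_combination (norm := module) hs - ((p.2 : ℤ) : ℝ) • e1
      · have e1 := h2' (i, 1) fun h => hi (congrArg Prod.fst h).symm
        have e2 := h2' (i, -1) fun h => hi (congrArg Prod.fst h).symm
        rw [hv, Pi.single_eq_of_ne hi, smul_zero]
        simp only [Units.val_neg, Units.val_one, Int.cast_neg, Int.cast_one] at e1 e2
        linear_combination (norm := module) (1 / 2 : ℝ) • e1 - (1 / 2 : ℝ) • e2
    refine ⟨v p.1, ?_⟩
    have e : triE τ + derE v + (diagE y z + offE u) =
        (triE τ + diagE y z) + (derE v + offE u) := by abel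
    rw [e, h1 hne, zero_add, hu, map_smul, hv]
    simp [rootS_apply, derS, offS]
  · rintro _ ⟨x, rfl⟩
    exact rootS_mem p x

theorem rootMultiplicity_eq (p : Fin 3 × ℤˣ) :
    rootMultiplicity aSub (aWeight (restrictedWt p)) = 8 := by
  rw [rootMultiplicity, restrictedRootSpace_eq_range,
    LinearMap.finrank_range_of_inj (rootS_injective _ _), finrank_octonion]

theorem restrictedRoots_eq : restrictedRoots aSub = aWeight '' Set.range restrictedWt := by
  apply Set.Subset.antisymm
  · rintro l ⟨hl, hne⟩
    obtain ⟨a, ha, ha0⟩ := Submodule.exists_mem_ne_zero_of_ne_bot hne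
    obtain ⟨τ, v, y, z, u, rfl⟩ := exists_eq a
    obtain ⟨h1, h2⟩ := components_of_mem_restrictedRootSpace ha
    by_contra hl'
    have h3 : ∀ p, l ≠ aWeight (restrictedWt p) := fun p hp => hl' ⟨_, ⟨p, rfl⟩, hp.symm⟩
    have huv : ∀ i, v i = 0 ∧ u i = 0 := by
      intro i
      have e1 := h2 (i, 1) (h3 _)
      have e2 := h2 (i, -1) (h3 _)
      simp only [Units.val_neg, Units.val_one, Int.cast_neg, Int.cast_one] at e1 e2
      constructor
      · linear_combination (norm := module) (1 / 2 : ℝ) • e1 + (1 / 2 : ℝ) • e2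
      · linear_combination (norm := module) (1 / 2 : ℝ) • e1 - (1 / 2 : ℝ) • e2
    have hv : v = 0 := funext fun i => (huv i).1
    have hu : u = 0 := funext fun i => (huv i).2
    refine ha0 ?_
    rw [hv, hu, map_zero, map_zero, add_zero, add_zero]
    exact h1 hl
  · rintro _ ⟨_, ⟨p, rfl⟩, rfl⟩
    constructor
    · intro h0
      have h3 : restrictedWt p = 0 := aWeight_injective (h0.trans (map_zero _).symm)
      have h4 : ∀ p, restrictedWt p 0 ≠ 0 := by decide
      exact h4 p (congrFun h3 0)
    · intro h0
      have h1 := rootMultiplicity_eq p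
      rw [rootMultiplicity, h0, finrank_bot] at h1
      norm_num at h1

/-- Twice the simple restricted roots. -/
def simpleRestrictedWt : Fin 2 → Fin 2 → ℤ := ![![1, -2], ![1, 1]]

/-- The normalized invariant form on weights of `a`. -/
def restrictedPairing (v w : Fin 2 → ℤ) : ℤ :=
  (2 * v 0 * w 0 + v 0 * w 1 + v 1 * w 0 + 2 * v 1 * w 1) / 3

/-- The normalized invariant form on the dual of `a`. -/
def dualForm : Module.Dual ℝ aSub →ₗ[ℝ] Module.Dual ℝ (Module.Dual ℝ aSub) :=
  LinearMap.mk₂ ℝ (fun l m => 4 / 3 * (2 * l (aPt 1 0) * m (aPt 1 0) + l (aPt 1 0) * m (aPt 0 1) +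
    l (aPt 0 1) * m (aPt 1 0) + 2 * l (aPt 0 1) * m (aPt 0 1)))
    (fun l l' m => by simp only [LinearMap.add_apply]; ring)
    (fun r l m => by simp only [LinearMap.smul_apply, smul_eq_mul]; ring)
    (fun l m m' => by simp only [LinearMap.add_apply]; ring)
    (fun r l m => by simp only [LinearMap.smul_apply, smul_eq_mul]; ring)

/-- The hypothesis states that the integer division by three is exact. The factor `4/3` in
`dualForm` absorbs the two halves in `aWeight`. -/
theorem dualForm_aWeight {v w : Fin 2 → ℤ} (h : 3 * restrictedPairing v w =
    2 * v 0 * w 0 + v 0 * w 1 + v 1 * w 0 + 2 * v 1 * w 1) :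
    dualForm (aWeight v) (aWeight w) = restrictedPairing v w := by
  have h' : (3 * restrictedPairing v w : ℝ) =
      2 * v 0 * w 0 + v 0 * w 1 + v 1 * w 0 + 2 * v 1 * w 1 := by exact_mod_cast h
  simp only [dualForm, LinearMap.mk₂_apply, aWeight_aPt]
  linear_combination (-1 / 3 : ℝ) * h'

theorem span_simpleRestricted :
    Submodule.span ℝ (Set.range fun i => aWeight (simpleRestrictedWt i)) = ⊤ := by
  rw [eq_top_iff]
  intro l _
  set c := l (aPt 1 0)
  set d := l (aPt 0 1)
  have e : l = (2 / 3 * (c - d)) • aWeight (simpleRestrictedWt 0) +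
      (2 / 3 * (2 * c + d)) • aWeight (simpleRestrictedWt 1) := by
    refine aDual_ext fun y z => ?_
    rw [LinearMap.add_apply, LinearMap.smul_apply, LinearMap.smul_apply, aWeight_aPt, aWeight_aPt,
      aDual_eq l, LinearMap.add_apply, LinearMap.smul_apply, LinearMap.smul_apply, aFst_aPt,
      aSnd_aPt]
    simp [simpleRestrictedWt]
    ring
  rw [e]
  exact Submodule.add_mem _ (Submodule.smul_mem _ _ (Submodule.subset_span ⟨0, rfl⟩))
    (Submodule.smul_mem _ _ (Submodule.subset_span ⟨1, rfl⟩))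

theorem finrank_dual_aSub : Module.finrank ℝ (Module.Dual ℝ aSub) = 2 := by
  have h1 : LinearIndependent ℝ ![aFst, aSnd] := by
    rw [LinearIndependent.pair_iff]
    intro s t h
    have h0 := LinearMap.congr_fun h (aPt 1 0)
    have h1 := LinearMap.congr_fun h (aPt 0 1)
    simp [aFst_aPt, aSnd_aPt] at h0 h1
    exact ⟨h0, h1⟩
  have h2 : ⊤ ≤ Submodule.span ℝ (Set.range ![aFst, aSnd]) := by
    intro l _
    rw [aDual_eq l]
    exact Submodule.add_mem _ (Submodule.smul_mem _ _ (Submodule.subset_span ⟨0, rfl⟩))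
      (Submodule.smul_mem _ _ (Submodule.subset_span ⟨1, rfl⟩))
  rw [Module.finrank_eq_card_basis (Module.Basis.mk h1 h2), Fintype.card_fin]

/-- The coefficients of a restricted root in terms of the simple ones. -/
def simpleRestrictedCoeff (v : Fin 2 → ℤ) : Fin 2 → ℤ := ![(v 0 - v 1) / 3, (2 * v 0 + v 1) / 3]

theorem restrictedWt_eq_sum (p : Fin 3 × ℤˣ) :
    restrictedWt p = ∑ j, simpleRestrictedCoeff (restrictedWt p) j • simpleRestrictedWt j ∧
    ((∀ j, 0 ≤ simpleRestrictedCoeff (restrictedWt p) j) ∨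
      ∀ j, 0 ≤ -simpleRestrictedCoeff (restrictedWt p) j) := by
  revert p; decide +kernel

/-- With six explicit integer vectors, integrality, reflection stability, reducedness and the root
strings are all finite checks. -/
theorem isRootSystemWithBase_restrictedRoots :
    IsRootSystemWithBase (restrictedRoots aSub) (fun i => aWeight (simpleRestrictedWt i))
      !![2, -1; -1, 2] := by
  rw [restrictedRoots_eq]
  have hpr : ∀ p p', 3 * restrictedPairing (restrictedWt p) (restrictedWt p') =
      2 * restrictedWt p 0 * restrictedWt p' 0 + restrictedWt p 0 * restrictedWt p' 1 +
        restrictedWt p 1 * restrictedWt p' 0 + 2 * restrictedWt p 1 * restrictedWt p' 1 := by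
    decide +kernel
  have h2 : ∀ p, restrictedPairing (restrictedWt p) (restrictedWt p) = 2 := by decide +kernel
  have hrefl : ∀ p p', ∃ p'', restrictedWt p'' =
      restrictedWt p' - restrictedPairing (restrictedWt p) (restrictedWt p') • restrictedWt p := by
    decide +kernel
  have hred : ∀ p p', restrictedPairing (restrictedWt p) (restrictedWt p') *
      restrictedPairing (restrictedWt p') (restrictedWt p) = 4 →
      restrictedWt p = restrictedWt p' ∨ restrictedWt p = -restrictedWt p' := by decide +kernel
  have hS : ∀ i, ∃ p, restrictedWt p = simpleRestrictedWt i := by decide +kernel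
  have hA : ∀ i j : Fin 2, i ≠ j →
      (!![2, -1; -1, 2] : Matrix (Fin 2) (Fin 2) ℤ) i j = -((1 : ℕ) : ℤ) := by
    intro i j hij
    fin_cases i <;> fin_cases j <;> first | rfl | exact absurd rfl hij
  have hstr : ∀ i j : Fin 2, i ≠ j →
      (∃ p, restrictedWt p = simpleRestrictedWt i + 1 • simpleRestrictedWt j) ∧
      ∀ p, restrictedWt p ≠ simpleRestrictedWt i + (1 + 1) • simpleRestrictedWt j := by
    decide +kernel
  refine isRootSystemWithBase_of_form aWeight aWeight_injective (Set.range restrictedWt)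
    (Set.finite_range _) dualForm restrictedPairing ?_ ?_ ?_ ?_ finrank_dual_aSub
    simpleRestrictedWt hS span_simpleRestricted ?_ _ (by decide)
    fun i j hij => ⟨1, hA i j hij, (hstr i j hij).1, fun ⟨p, hp⟩ => (hstr i j hij).2 p hp⟩
  · rintro _ ⟨p, rfl⟩ _ ⟨p', rfl⟩
    exact dualForm_aWeight (hpr p p')
  · rintro _ ⟨p, rfl⟩
    exact h2 p
  · rintro _ ⟨p, rfl⟩ _ ⟨p', rfl⟩
    exact hrefl p p'
  · rintro _ ⟨p, rfl⟩ _ ⟨p', rfl⟩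
    exact hred p p'
  · rintro _ ⟨p, rfl⟩
    obtain ⟨h1, h2⟩ := restrictedWt_eq_sum p
    rcases h2 with h2 | h2
    · left
      rw [h1]
      exact sum_zsmul_mem_closure _ h2
    · right
      have := sum_zsmul_mem_closure simpleRestrictedWt h2
      rw [h1, ← Finset.sum_neg_distrib]
      simpa only [neg_smul] using this

end LieE

end

section

open Octonion Albert LieAlgebra.IsKilling

namespace LieE

/-! ### The maximal abelian subspace and the Cartan subalgebra -/

theorem diagE_mem_aSub (y z : ℝ) : diagE y z ∈ aSub := (aPt y z).2

theorem isMaximalAbelianIn_aSub : IsMaximalAbelianIn pSub aSub := by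
  refine ⟨⟨?_, ?_⟩, ?_⟩
  · intro x hx
    obtain ⟨y, z, h⟩ := exists_eq_aPt ⟨x, hx⟩
    have h' : x = diagE y z := congrArg Subtype.val h
    rw [h']
    exact diagE_mem y z
  · intro x hx x' hx'
    obtain ⟨y, z, h⟩ := exists_eq_aPt ⟨x, hx⟩
    obtain ⟨y', z', h'⟩ := exists_eq_aPt ⟨x', hx'⟩
    have h : x = diagE y z := congrArg Subtype.val h
    have h' : x' = diagE y' z' := congrArg Subtype.val h'
    rw [h, h', diagE_lie_diagE]
  · rintro c ⟨hc, hab⟩ hle x hx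
    obtain ⟨y, z, u, rfl⟩ := exists_eq_of_mem_pSub (hc hx)
    -- An element of `p` commuting with `a` is a vector of weight zero. No restricted root is zero,
    -- so its components along the `rootS` vanish and it is diagonal.
    have h1 : triE 0 + derE 0 + (diagE y z + offE u) ∈ restrictedRootSpace aSub 0 := by
      intro a
      rw [map_zero, map_zero, zero_add, zero_add, LinearMap.zero_apply, zero_smul]
      exact hab _ (hle a.2) _ hx
    obtain ⟨-, h2⟩ := components_of_mem_restrictedRootSpace h1
    have hu : u = 0 := by
      funext i
      have h3 := h2 (i, 1) fun h => by
        have h3 : restrictedWt (i, 1) = 0 := aWeight_injective (h.symm.trans (map_zero _).symm)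
        have h4 : ∀ p, restrictedWt p 0 ≠ 0 := by decide
        exact h4 _ (congrFun h3 0)
      simpa using h3
    rw [hu, map_zero, add_zero]
    exact diagE_mem_aSub y z

/-- The generated subalgebra is abelian, hence contained in the centralizer of `h₁, …, h₄`, which
has already been computed. -/
theorem mem_hSub_iff {x : LieE} :
    x ∈ hSub.toSubmodule ↔ ∃ (c : Fin 4 → ℝ) (y z : ℝ), x = triE (∑ k, c k • tau k) + diagE y z := by
  constructor
  · intro hx
    refine exists_eq_of_tau_lie fun k => ?_
    rw [← h_castAdd]
    exact lie_eq_zero_of_mem_lieSpan h_comm _ (h_mem _) _ hx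
  · rintro ⟨c, y, z, rfl⟩
    refine hSub.toSubmodule.add_mem ?_ (aSub_le (diagE_mem_aSub y z))
    rw [map_sum]
    refine Submodule.sum_mem _ fun k _ => ?_
    rw [map_smul, ← h_castAdd]
    exact Submodule.smul_mem _ _ (h_mem _)

theorem hSub_inf_tSub_aux {x : LieE} (hx : x ∈ hSub.toSubmodule ⊓ tSub.toSubmodule) :
    ∃ c : Fin 4 → ℝ, x = triE (∑ k, c k • tau k) := by
  obtain ⟨hx, hx'⟩ := hx
  obtain ⟨c, y, z, rfl⟩ := mem_hSub_iff.1 hx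
  have h1 : diagE y z ∈ tSub := by
    have := tSub.sub_mem hx' (triE_mem (∑ k, c k • tau k))
    rwa [add_sub_cancel_left] at this
  refine ⟨c, ?_⟩
  rw [Submodule.disjoint_def.1 isCompl_tSub_pSub.disjoint _ h1 (diagE_mem y z), add_zero]

theorem hSub_inf_tSub : hSub.toSubmodule ⊓ tSub.toSubmodule =
    Submodule.span ℝ {h 0, h 1, h 2, h 3} := by
  have hr : ({h 0, h 1, h 2, h 3} : Set LieE) = Set.range fun k => triE (tau k) := by
    have : (fun k => triE (tau k)) = fun k : Fin 4 => h (k.castAdd 2) :=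
      funext fun k => (h_castAdd k).symm
    rw [this]
    ext x
    simp only [Set.mem_insert_iff, Set.mem_singleton_iff, Set.mem_range, Fin.exists_fin_succ]
    simp [eq_comm]
  rw [hr]
  apply le_antisymm
  · intro x hx
    obtain ⟨c, rfl⟩ := hSub_inf_tSub_aux hx
    rw [map_sum]
    refine Submodule.sum_mem _ fun k _ => ?_
    rw [map_smul]
    exact Submodule.smul_mem _ _ (Submodule.subset_span ⟨k, rfl⟩)
  · rw [Submodule.span_le]
    rintro _ ⟨k, rfl⟩
    refine ⟨?_, triE_mem _⟩
    change triE (tau k) ∈ hSub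
    rw [← h_castAdd]
    exact h_mem _

theorem hSub_eq_sup : hSub.toSubmodule = aSub ⊔ (hSub.toSubmodule ⊓ tSub.toSubmodule) := by
  apply le_antisymm
  · intro x hx
    obtain ⟨c, y, z, rfl⟩ := mem_hSub_iff.1 hx
    rw [add_comm]
    refine Submodule.add_mem_sup (diagE_mem_aSub y z) ⟨?_, triE_mem _⟩
    exact mem_hSub_iff.2 ⟨c, 0, 0, by rw [diagE_zero, add_zero]⟩
  · exact sup_le aSub_le inf_le_left

theorem isMaximalAbelian_hSub : IsMaximalAbelian hSub :=
  isMaximalAbelian_lieSpan h_comm fun _ => mem_span_of_h_lie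

theorem restrictedRoots_eq_insert (l₁ l₆ : Module.Dual ℝ aSub)
    (h₁ : l₁ = aWeight (simpleRestrictedWt 0)) (h₆ : l₆ = aWeight (simpleRestrictedWt 1)) :
    restrictedRoots aSub = {l₁, l₆, l₁ + l₆, -l₁, -l₆, -(l₁ + l₆)} := by
  have hset : Set.range restrictedWt = {simpleRestrictedWt 0, simpleRestrictedWt 1,
      simpleRestrictedWt 0 + simpleRestrictedWt 1, -simpleRestrictedWt 0, -simpleRestrictedWt 1,
      -(simpleRestrictedWt 0 + simpleRestrictedWt 1)} := by
    have h1 : ∀ p, restrictedWt p = simpleRestrictedWt 0 ∨ restrictedWt p = simpleRestrictedWt 1 ∨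
        restrictedWt p = simpleRestrictedWt 0 + simpleRestrictedWt 1 ∨
        restrictedWt p = -simpleRestrictedWt 0 ∨ restrictedWt p = -simpleRestrictedWt 1 ∨
        restrictedWt p = -(simpleRestrictedWt 0 + simpleRestrictedWt 1) := by decide +kernel
    apply Set.Subset.antisymm
    · rintro _ ⟨p, rfl⟩
      exact h1 p
    · rintro v (rfl | rfl | rfl | rfl | rfl | rfl)
      exacts [⟨(2, 1), by decide⟩, ⟨(0, 1), by decide⟩, ⟨(1, -1), by decide⟩, ⟨(2, -1), by decide⟩,
        ⟨(0, -1), by decide⟩, ⟨(1, 1), by decide⟩]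
  rw [restrictedRoots_eq, hset, h₁, h₆]
  simp only [Set.image_insert_eq, Set.image_singleton, map_add, map_neg]

end LieE

end

section

open Octonion Albert LieAlgebra.IsKilling

namespace LieE

/-! ### The type of `Der(A)` -/

/-- The torus of `Der(A)`. -/
def derTorus (k : Fin 4) : tSub := ⟨triE (tau k), triE_mem _⟩

theorem derTorus_comm (j k : Fin 4) : ⁅derTorus j, derTorus k⁆ = 0 :=
  Subtype.ext (tau_lie_tau j k)

theorem exists_eq_sum_derTorus {a : LieE} (ha : a ∈ tSub) (h0 : ∀ k, ⁅triE (tau k), a⁆ = 0) :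
    ∃ c : Fin 4 → ℝ, a = ∑ k, c k • triE (tau k) := by
  obtain ⟨c, y, z, rfl⟩ := exists_eq_of_tau_lie h0
  have h1 : diagE y z ∈ tSub := by
    have := tSub.sub_mem ha (triE_mem (∑ k, c k • tau k))
    rwa [add_sub_cancel_left] at this
  refine ⟨c, ?_⟩
  rw [Submodule.disjoint_def.1 isCompl_tSub_pSub.disjoint _ h1 (diagE_mem y z), add_zero, map_sum]
  simp only [map_smul]

theorem coe_sum_derTorus (c : Fin 4 → ℝ) :
    ((∑ k, c k • derTorus k : tSub) : LieE) = ∑ k, c k • triE (tau k) := by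
  simp [derTorus]

theorem mem_span_derTorus (a : tSub) (ha : ∀ k, ⁅derTorus k, a⁆ = 0) :
    a ∈ Submodule.span ℝ (Set.range derTorus) := by
  obtain ⟨c, hc⟩ := exists_eq_sum_derTorus a.2 fun k => congrArg Subtype.val (ha k)
  have h1 : a = ∑ k, c k • derTorus k := Subtype.ext (by rw [coe_sum_derTorus, hc])
  rw [h1]
  exact Submodule.sum_mem _ fun k _ => Submodule.smul_mem _ _ (Submodule.subset_span ⟨k, rfl⟩)

theorem linearIndependent_derTorus : LinearIndependent ℝ derTorus := by
  have h1 : LinearIndependent ℝ fun k => (derTorus k : LieE) := by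
    have h2 := linearIndependent_h.comp (Fin.castAdd 2 : Fin 4 → Fin 6) (Fin.castAdd_injective 4 2)
    have h3 : h ∘ (Fin.castAdd 2 : Fin 4 → Fin 6) = fun k => (derTorus k : LieE) :=
      funext h_castAdd
    rwa [h3] at h2
  exact LinearIndependent.of_comp tSub.toSubmodule.subtype h1

theorem derTorus_lie_eq_zero (k : Fin 4) (x : tSub) (hx : ⁅derTorus k, ⁅derTorus k, x⁆⁆ = 0) :
    ⁅derTorus k, x⁆ = 0 := by
  refine Subtype.ext ?_
  have h1 := h_lie_eq_zero (k.castAdd 2) x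
  rw [h_castAdd] at h1
  exact h1 (congrArg Subtype.val hx)

/-- Indices of the root vectors of the complexification of `Der(A)`. -/
abbrev DerRootIndex : Type := TriIndex ⊕ (Fin 3 × Fin 4 × ℤˣ)

theorem triX_mem (j k : Fin 4) (a b : ℤˣ) : triX j k a b ∈ tSub :=
  tSub.sub_mem (triE_mem _) (tSub.smul_mem _ (triE_mem _))

theorem triY_mem (j k : Fin 4) (a b : ℤˣ) : triY j k a b ∈ tSub :=
  tSub.neg_mem (tSub.add_mem (tSub.smul_mem _ (triE_mem _)) (tSub.smul_mem _ (triE_mem _)))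

theorem derS_mem (i : Fin 3) (x : Octonion) : derS i x ∈ tSub := derE_mem _

/-- Real parts of root vectors. -/
def derRootX : DerRootIndex → tSub :=
  Sum.elim (fun p => ⟨triX p.1.1 p.1.2.1 p.1.2.2.1 p.1.2.2.2, triX_mem _ _ _ _⟩)
    fun p => ⟨derS p.1 (ev p.2.1), derS_mem _ _⟩

/-- Imaginary parts of root vectors. -/
def derRootY : DerRootIndex → tSub :=
  Sum.elim (fun p => ⟨triY p.1.1 p.1.2.1 p.1.2.2.1 p.1.2.2.2, triY_mem _ _ _ _⟩)
    fun p => ⟨(-((p.2.2 : ℤ) : ℝ)) • derS p.1 (od p.2.1), tSub.smul_mem _ (derS_mem _ _)⟩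

/-- Twice the roots. -/
def derRootWt : DerRootIndex → Fin 4 → ℤ :=
  Sum.elim (fun p => triWt p.1.1 p.1.2.1 p.1.2.2.1 p.1.2.2.2) fun p k => p.2.2 * wt p.1 p.2.1 k

/-- The scaling of the coordinates. -/
def derScale (_ : Fin 4) : ℂ := Complex.I / 2

theorem derScale_ne_zero (k : Fin 4) : derScale k ≠ 0 := by simp [derScale]

theorem derScale_mul (k : Fin 4) (z : ℤ) :
    (derScale k * z).re = 0 ∧ (derScale k * z).im = 1 / 2 * z := by simp [derScale]

/-- Inside `t` the elements `derS` alone replace `derS + s offS`; the weights of the four compact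
generators are the same. -/
theorem derTorus_lie_derRootX (t : DerRootIndex) (k : Fin 4) : ⁅derTorus k, derRootX t⁆ =
    (derScale k * derRootWt t k).re • derRootX t - (derScale k * derRootWt t k).im • derRootY t := by
  rw [(derScale_mul _ _).1, (derScale_mul _ _).2, zero_smul, zero_sub, ← neg_smul]
  apply Subtype.ext
  rcases t with p | p
  · exact tau_lie_triX _ _ _ _ k
  · change ⁅triE (tau k), derS p.1 (ev p.2.1)⁆ =
      -(1 / 2 * ((p.2.2 * wt p.1 p.2.1 k : ℤ) : ℝ)) • (-((p.2.2 : ℤ) : ℝ)) • derS p.1 (od p.2.1)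
    rw [triE_lie_derS, tau_ev, map_smul, smul_smul]
    congr 1
    push_cast
    linear_combination (-1 / 2 * wt p.1 p.2.1 k : ℝ) * unit_sq p.2.2

theorem derTorus_lie_derRootY (t : DerRootIndex) (k : Fin 4) : ⁅derTorus k, derRootY t⁆ =
    (derScale k * derRootWt t k).im • derRootX t + (derScale k * derRootWt t k).re • derRootY t := by
  rw [(derScale_mul _ _).1, (derScale_mul _ _).2, zero_smul, add_zero]
  apply Subtype.ext
  rcases t with p | p
  · exact tau_lie_triY _ _ _ _ k
  · change ⁅triE (tau k), (-((p.2.2 : ℤ) : ℝ)) • derS p.1 (od p.2.1)⁆ =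
      (1 / 2 * ((p.2.2 * wt p.1 p.2.1 k : ℤ) : ℝ)) • derS p.1 (ev p.2.1)
    rw [lie_smul, triE_lie_derS, tau_od, map_smul, smul_smul]
    congr 1
    push_cast
    ring

theorem derRootX_ne_zero (t : DerRootIndex) : derRootX t ≠ 0 := by
  intro h
  have h' := congrArg Subtype.val h
  rcases t with ⟨p, hp⟩ | p
  · exact triX_ne_zero hp _ _ h'
  · exact ev_ne_zero _ (derS_injective _ (h'.trans (map_zero _).symm))

theorem derRootWt_ne_zero (t : DerRootIndex) : derRootWt t ≠ 0 := by
  revert t; decide +kernel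

theorem exists_conj_der (t : DerRootIndex) :
    ∃ t', derRootX t' = derRootX t ∧ derRootY t' = -derRootY t := by
  rcases t with ⟨⟨j, k, a, b⟩, hp⟩ | ⟨i, m, a⟩
  · exact ⟨Sum.inl ⟨⟨j, k, -a, -b⟩, hp⟩, Subtype.ext (triX_neg _ _ _ _),
      Subtype.ext (triY_neg _ _ _ _)⟩
  · refine ⟨Sum.inr ⟨i, m, -a⟩, rfl, Subtype.ext ?_⟩
    simp [derRootY]

theorem span_derRootX : Submodule.span ℝ
    (Set.range derTorus ∪ (Set.range derRootX ∪ Set.range derRootY)) = ⊤ := by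
  set W := Submodule.span ℝ (Set.range derTorus ∪ (Set.range derRootX ∪ Set.range derRootY))
  let W' : Submodule ℝ LieE := W.map tSub.toSubmodule.subtype
  have hW' : ∀ a : tSub, a ∈ W → (a : LieE) ∈ W' := fun a ha => ⟨a, ha, rfl⟩
  have hh : ∀ k, (derTorus k : LieE) ∈ W' := fun k =>
    hW' _ (Submodule.subset_span (Or.inl ⟨k, rfl⟩))
  have hX : ∀ t, (derRootX t : LieE) ∈ W' := fun t =>
    hW' _ (Submodule.subset_span (Or.inr (Or.inl ⟨t, rfl⟩)))
  have hY : ∀ t, (derRootY t : LieE) ∈ W' := fun t =>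
    hW' _ (Submodule.subset_span (Or.inr (Or.inr ⟨t, rfl⟩)))
  have htri : ∀ τ, triE τ ∈ W' := triE_mem_of_triX W' hh
    fun j k a b hjk => ⟨hX (Sum.inl ⟨⟨j, k, a, b⟩, hjk⟩), hY (Sum.inl ⟨⟨j, k, a, b⟩, hjk⟩)⟩
  have hder : ∀ i x, derS i x ∈ W' := by
    intro i x
    have : W'.mkQ ∘ₗ derS i = 0 := linearMap_ext_ev_od
      (fun m => (Submodule.Quotient.mk_eq_zero W').2 (hX (Sum.inr ⟨i, m, 1⟩)))
      (fun m => (Submodule.Quotient.mk_eq_zero W').2 (by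
        have := hY (Sum.inr ⟨i, m, -1⟩)
        simpa [derRootY] using this))
    exact (Submodule.Quotient.mk_eq_zero W').1 (LinearMap.congr_fun this x)
  rw [eq_top_iff]
  rintro ⟨a, ha⟩ _
  have ha' : a ∈ W' := by
    obtain ⟨τ, v, rfl⟩ := exists_eq_of_mem_tSub ha
    rw [derE_eq_sum]
    exact W'.add_mem (htri τ) (W'.sum_mem fun i _ => hder i _)
  obtain ⟨b, hb, e⟩ := ha'
  have e' : b = ⟨a, ha⟩ := Subtype.ext e
  rwa [← e']

/-- The simple roots of `Der(A)`, with coordinates doubled. -/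
def derSimpleWt : Fin 4 → Fin 4 → ℤ :=
  ![![0, 2, -2, 0], ![0, 0, 2, -2], ![0, 0, 0, 2], ![1, -1, -1, -1]]

/-- The coefficients of a root in terms of the simple roots. -/
def derSimpleCoeff (v : Fin 4 → ℤ) : Fin 4 → ℤ :=
  -- The first coordinate occurs only in the half-integral simple root, so it is the last
  -- coefficient; the others follow from partial sums.
  ![(v 0 + v 1) / 2, (2 * v 0 + v 1 + v 2) / 2, (3 * v 0 + v 1 + v 2 + v 3) / 2, v 0]

theorem derRootWt_eq_sum (t : DerRootIndex) :
    derRootWt t = ∑ j, derSimpleCoeff (derRootWt t) j • derSimpleWt j ∧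
    ((∀ j, 0 ≤ derSimpleCoeff (derRootWt t) j) ∨ ∀ j, 0 ≤ -derSimpleCoeff (derRootWt t) j) := by
  revert t; decide +kernel

theorem derSimpleWt_mem (i : Fin 4) : ∃ t, derRootWt t = derSimpleWt i := by
  revert i; decide +kernel

theorem derSimpleWt_string (i j : Fin 4) (hij : i ≠ j) :
    CartanMatrix.F₄ i j = -((-CartanMatrix.F₄ i j).toNat : ℤ) ∧
    (∃ t, derRootWt t = derSimpleWt i + (-CartanMatrix.F₄ i j).toNat • derSimpleWt j) ∧
    ¬ ∃ t, derRootWt t = derSimpleWt i + ((-CartanMatrix.F₄ i j).toNat + 1) • derSimpleWt j := by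
  refine ⟨?_, ?_, ?_⟩
  · have := CartanMatrix.F₄_off_diag_nonpos i j hij
    omega
  · revert i j
    have : ∀ i j : Fin 4, i ≠ j →
      ∃ t, derRootWt t = derSimpleWt i + (-CartanMatrix.F₄ i j).toNat • derSimpleWt j := by
      decide +kernel
    exact this
  · revert i j
    have : ∀ i j : Fin 4, i ≠ j →
      ∀ t, derRootWt t ≠ derSimpleWt i + ((-CartanMatrix.F₄ i j).toNat + 1) • derSimpleWt j := by
      decide +kernel
    exact fun i j hij ⟨t, ht⟩ => this i j hij t ht

/-- The triality part supplies the 24 long roots and the three copies of `ρ(ι_i(pO))` the 24 short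
ones; the base consists of `ε₂ - ε₃`, `ε₃ - ε₄`, `ε₄` and `(ε₁ - ε₂ - ε₃ - ε₄)/2`. -/
theorem hasCartanType_tSub : HasCartanType (ℂ ⊗[ℝ] tSub) CartanMatrix.F₄ := by
  have hK : LieAlgebra.IsKilling ℂ (ℂ ⊗[ℝ] tSub) := isKilling_complexification
  have hC := isCartanSubalgebra_complexify_lieSpan derTorus_comm mem_span_derTorus
    derTorus_lie_eq_zero
  have hR := range_root_eq_of_planes derTorus_comm linearIndependent_derTorus derScale_ne_zero
    derTorus_lie_derRootX derTorus_lie_derRootY derRootX_ne_zero derRootWt_ne_zero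
    exists_conj_der span_derRootX
  obtain ⟨b, f, -, hf⟩ := exists_base_of_simple _
    (torusWeight derTorus_comm linearIndependent_derTorus derScale)
    (torusWeight_injective derTorus_comm linearIndependent_derTorus derScale_ne_zero)
    (Set.range derRootWt) hR (by
      rw [Subspace.dual_finrank_eq]
      exact finrank_complexify_lieSpan derTorus_comm linearIndependent_derTorus)
    derSimpleWt (fun i => derSimpleWt_mem i) (by
      rintro _ ⟨t, rfl⟩
      obtain ⟨h1, h2⟩ := derRootWt_eq_sum t
      rcases h2 with h2 | h2
      · left
        rw [h1]
        exact sum_zsmul_mem_closure _ h2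
      · right
        have := sum_zsmul_mem_closure derSimpleWt h2
        rw [h1, ← Finset.sum_neg_distrib]
        simpa only [neg_smul] using this)
    CartanMatrix.F₄ (fun i => CartanMatrix.F₄_diag i) fun i j hij => ⟨_, derSimpleWt_string i j hij⟩
  exact ⟨hK, _, hC, b, f, hf⟩

end LieE

end

section

open Octonion Albert

/-! ### Hermitian octonion matrices -/

theorem star_add' (x y : Octonion) : star (x + y) = star x + star y := by
  apply Octonion.ext' <;> simp <;> ring

theorem star_smul'' (r : ℝ) (x : Octonion) : star (r • x) = r • star x := by
  apply Octonion.ext' <;> simp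

theorem toMatrix_add (A A' : Albert) : toMatrix (A + A') = toMatrix A + toMatrix A' := by
  ext i j : 2
  fin_cases i <;> fin_cases j <;> simp [toMatrix, add_smul, star_add']

theorem toMatrix_smul (r : ℝ) (A : Albert) : toMatrix (r • A) = r • toMatrix A := by
  ext i j : 2
  fin_cases i <;> fin_cases j <;> simp [toMatrix, mul_smul, star_smul'', smul_comm r]

theorem two_smul_injective {x y : Octonion} (h : (2 : ℝ) • x = (2 : ℝ) • y) : x = y :=
  smul_right_injective _ (two_ne_zero' ℝ) h

theorem smul_e_zero_injective {r s : ℝ} (h : r • e 0 = s • e 0) : r = s := by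
  have := congrArg (fun x : Octonion => x.1.re) h
  simpa using this

theorem toMatrix_injective : Function.Injective toMatrix := by
  intro A A' h
  have h' : ∀ i j, toMatrix A i j = toMatrix A' i j := fun i j => by rw [h]
  refine Albert.ext' (fun i => ?_) (fun i => ?_)
  · refine smul_e_zero_injective ?_
    fin_cases i
    exacts [h' 0 0, h' 1 1, h' 2 2]
  · refine two_smul_injective ?_
    fin_cases i
    exacts [h' 2 1, h' 0 2, h' 1 0]

theorem star_e_zero : star (e 0) = e 0 := by
  apply Octonion.ext' <;> simp

theorem eq_smul_e_zero {x : Octonion} (h : star x = x) : x = x.1.re • e 0 := by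
  have h1 := congrArg (fun x : Octonion => x.1.imI) h
  have h2 := congrArg (fun x : Octonion => x.1.imJ) h
  have h3 := congrArg (fun x : Octonion => x.1.imK) h
  have h4 := congrArg (fun x : Octonion => x.2.re) h
  have h5 := congrArg (fun x : Octonion => x.2.imI) h
  have h6 := congrArg (fun x : Octonion => x.2.imJ) h
  have h7 := congrArg (fun x : Octonion => x.2.imK) h
  simp at h1 h2 h3 h4 h5 h6 h7
  apply Octonion.ext' <;> simp <;> linarith

theorem range_toMatrix : Set.range toMatrix = hermitian := by
  apply Set.Subset.antisymm
  · rintro _ ⟨A, rfl⟩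
    change Matrix.conjTranspose _ = _
    ext i j : 2
    fin_cases i <;> fin_cases j <;>
      simp [toMatrix, Matrix.conjTranspose_apply, star_smul'', star_star', star_e_zero]
  · intro X hX
    have hX' : ∀ i j, star (X j i) = X i j := fun i j => congrFun (congrFun hX i) j
    -- These are the off-diagonal entries at which `toMatrix` has the octonions unconjugated;
    -- hermitian symmetry fixes the rest, and makes the diagonal real.
    refine ⟨(fun i => (X i i).1.re, fun i => (1 / 2 : ℝ) • ![X 2 1, X 0 2, X 1 0] i), ?_⟩
    ext i j : 2
    fin_cases i <;> fin_cases j <;>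
      simp [toMatrix, star_smul'', smul_smul, hX', ← eq_smul_e_zero (hX' _ _)]

theorem smul_mul_smul'' (r s : ℝ) (x y : Octonion) : (r • x) * (s • y) = (r * s) • (x * y) := by
  apply Octonion.ext' <;> simp <;> ring

theorem e_zero_mul (x : Octonion) : e 0 * x = x := by
  apply Octonion.ext' <;> simp

theorem mul_e_zero (x : Octonion) : x * e 0 = x := by
  apply Octonion.ext' <;> simp

theorem star_mul'' (x y : Octonion) : star (x * y) = star y * star x := by
  apply Octonion.ext' <;> simp

theorem star_mul_add_star_mul (x y : Octonion) : star x * y + star y * x = q x y • e 0 := by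
  apply Octonion.ext' <;> simp [q_eq] <;> ring

theorem mul_star_add_mul_star (x y : Octonion) : x * star y + y * star x = q x y • e 0 := by
  apply Octonion.ext' <;> simp [q_eq] <;> ring

/-- Off the diagonal both sides agree term by term. On the diagonal the symmetrized products
collapse to values of `q` by the polarized norm identities. -/
theorem toMatrix_mul (A A' : Albert) : toMatrix (A * A') =
    (1 / 2 : ℝ) • (toMatrix A * toMatrix A' + toMatrix A' * toMatrix A) := by
  have d1 := fun i => star_mul_add_star_mul (A.2 i) (A'.2 i)
  have d2 := fun i => mul_star_add_mul_star (A.2 i) (A'.2 i)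
  ext i j : 2
  fin_cases i <;> fin_cases j <;>
    simp only [toMatrix, Matrix.mul_apply, Fin.sum_univ_three, mul_def, L_fst, L_snd,
      Matrix.smul_apply, Matrix.add_apply, Matrix.of_apply, Matrix.cons_val, Fin.zero_eta,
      Fin.mk_one, Fin.reduceFinMk, Fin.isValue, Fin.reduceAdd, zero_add, smul_mul_smul'',
      e_zero_mul, mul_e_zero, star_add', star_smul'', pmul_apply, star_mul'', star_star']
  · linear_combination (norm := module) (-2 : ℝ) • d1 2 - (2 : ℝ) • d2 1
  · module
  · module
  · module
  · linear_combination (norm := module) (-2 : ℝ) • d1 0 - (2 : ℝ) • d2 2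
  · module
  · module
  · module
  · linear_combination (norm := module) (-2 : ℝ) • d1 1 - (2 : ℝ) • d2 0

end

end E626

end

theorem mainTheorem1 :
    -- `A₍₁,₁,₁₎(pO)` is the Albert algebra `H₃(O)`
    ((∀ A A' : Albert, toMatrix (A + A') = toMatrix A + toMatrix A') ∧
      (∀ (r : ℝ) (A : Albert), toMatrix (r • A) = r • toMatrix A) ∧
      Function.Injective toMatrix ∧ Set.range toMatrix = hermitian ∧
      ∀ A A' : Albert, toMatrix (A * A') =
        (1 / 2 : ℝ) • (toMatrix A * toMatrix A' + toMatrix A' * toMatrix A)) ∧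
    -- the Cartan decomposition and the signature
    IsCartanDecomposition LieE.tSub LieE.pSub ∧
    (∀ x ∈ LieE.pSub, x ≠ 0 → 0 < killingForm ℝ LieE x x) ∧
    (∀ x ∈ LieE.tSub, x ≠ 0 → killingForm ℝ LieE x x < 0) ∧
    Module.finrank ℝ LieE.tSub = 52 ∧ Module.finrank ℝ LieE.pSub = 26 ∧
    killingSignature LieE = -26 ∧
    HasCartanType (ℂ ⊗[ℝ] LieE.tSub) CartanMatrix.F₄ ∧
    -- the subspace `a` and the Cartan subalgebra `h`
    IsMaximalAbelianIn LieE.pSub LieE.aSub ∧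
    LieE.hSub.toSubmodule = LieE.aSub ⊔ (LieE.hSub.toSubmodule ⊓ LieE.tSub.toSubmodule) ∧
    LieE.hSub.toSubmodule ⊓ LieE.tSub.toSubmodule =
      Submodule.span ℝ {LieE.h 0, LieE.h 1, LieE.h 2, LieE.h 3} ∧
    IsMaximalAbelian LieE.hSub ∧
    ∃ (_ : LieAlgebra.IsKilling ℂ (ℂ ⊗[ℝ] LieE))
      (_ : (complexify LieE.hSub).IsCartanSubalgebra),
      -- the roots
      (Set.range fun i => fun w => (LieAlgebra.IsKilling.rootSystem (complexify LieE.hSub)).root i (hPt w)) =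
        rootFunctions ∧
      -- the adapted basis and the Satake diagram
      ∃ (b : (LieAlgebra.IsKilling.rootSystem (complexify LieE.hSub)).Base) (f : Fin 6 ≃ b.support),
        (∀ j w, (LieAlgebra.IsKilling.rootSystem (complexify LieE.hSub)).root (f j) (hPt w) = simpleRoot j w) ∧
        IsAdaptedBase LieE.aSub_le b ∧
        satakeDiagram LieE.aSub_le b f = satakeEIV ∧
        -- the restricted roots
        ∃ l₁ l₆ : Module.Dual ℝ LieE.aSub,
          (∀ x, (l₁ x : ℂ) =
            restrict LieE.aSub_le ((LieAlgebra.IsKilling.rootSystem (complexify LieE.hSub)).root (f 0)) x) ∧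
          (∀ x, (l₆ x : ℂ) =
            restrict LieE.aSub_le ((LieAlgebra.IsKilling.rootSystem (complexify LieE.hSub)).root (f 5)) x) ∧
          (∀ w₅ w₆, l₁ (LieE.aPt w₅ w₆) = (w₅ - 2 * w₆) / 2) ∧
          (∀ w₅ w₆, l₆ (LieE.aPt w₅ w₆) = (w₅ + w₆) / 2) ∧
          restrictedRoots LieE.aSub = {l₁, l₆, l₁ + l₆, -l₁, -l₆, -(l₁ + l₆)} ∧
          IsRootSystemWithBase (restrictedRoots LieE.aSub) ![l₁, l₆] !![2, -1; -1, 2] ∧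
          rootMultiplicity LieE.aSub l₁ = 8 ∧ rootMultiplicity LieE.aSub l₆ = 8 := by
  refine ⟨⟨toMatrix_add, toMatrix_smul, toMatrix_injective, range_toMatrix, toMatrix_mul⟩,
    LieE.isCartanDecomposition, LieE.killingForm_pos_of_mem_pSub,
    LieE.killingForm_neg_of_mem_tSub, LieE.finrank_tSub, LieE.finrank_pSub,
    LieE.killingSignature_eq, LieE.hasCartanType_tSub, LieE.isMaximalAbelianIn_aSub,
    LieE.hSub_eq_sup, LieE.hSub_inf_tSub, LieE.isMaximalAbelian_hSub,
    LieE.isKilling_complex, LieE.isCartanSubalgebra_hSub, LieE.range_rootFunction, ?_⟩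
  obtain ⟨b, f, hf, hA⟩ := LieE.exists_base
  refine ⟨b, f, fun j w => ?_, LieE.isAdaptedBase hf, LieE.satakeDiagram_eq hf hA,
    LieE.aWeight (LieE.simpleRestrictedWt 0), LieE.aWeight (LieE.simpleRestrictedWt 1),
    fun x => ?_, fun x => ?_, fun y z => ?_, fun y z => ?_,
    LieE.restrictedRoots_eq_insert _ _ rfl rfl, ?_, ?_, ?_⟩
  · rw [hf, LieE.functional_hPt, LieE.weightFun_simpleWt]
  · obtain ⟨y, z, rfl⟩ := LieE.exists_eq_aPt x
    rw [hf, LieE.restrict_functional, LieE.aWeight_aPt]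
    simp [LieE.simpleRestrictedWt, LieE.simpleWt]
  · obtain ⟨y, z, rfl⟩ := LieE.exists_eq_aPt x
    rw [hf, LieE.restrict_functional, LieE.aWeight_aPt]
    simp [LieE.simpleRestrictedWt, LieE.simpleWt]
  · rw [LieE.aWeight_aPt]
    simp [LieE.simpleRestrictedWt]
    ring
  · rw [LieE.aWeight_aPt]
    simp [LieE.simpleRestrictedWt]
    ring
  · have h := LieE.isRootSystemWithBase_restrictedRoots
    have e : (fun i => LieE.aWeight (LieE.simpleRestrictedWt i)) =
        ![LieE.aWeight (LieE.simpleRestrictedWt 0), LieE.aWeight (LieE.simpleRestrictedWt 1)] := by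
      funext i
      fin_cases i <;> rfl
    rwa [e] at h
  · have e : LieE.simpleRestrictedWt 0 = LieE.restrictedWt (2, 1) := by decide
    rw [e]
    exact LieE.rootMultiplicity_eq _
  · have e : LieE.simpleRestrictedWt 1 = LieE.restrictedWt (0, 1) := by decide
    rw [e]
    exact LieE.rootMultiplicity_eq _
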